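/- **Lemma.** Let $K$ be a field, let $\operatorname{Spec} K$ carry the trivial log structure, and let $f : X \to \operatorname{Spec} K$ be a log-smooth curve. That is, $X$ is an fs log scheme (a scheme $\mathring X$ with a log structure $\alpha : M_X \to \mathcal O_X$ on its small étale site which, étale locally, has charts by finitely generated, integral, saturated monoids), $f$ is log smooth in the sense of Kato (the underlying morphism is locally of finite presentation and $f$ has the lifting property, étale locally, against strict square-zero closed immersions of fine log schemes), and $\mathring X$ is geometrically connected over $K$ and of pure dimension $1$. Then $\mathring X$ is smooth over $K$, of relative dimension $1$, in the classical sense, and there is an effective Cartier divisor $D \subset \mathring X$ such that $D \to \operatorname{Spec} K$ is étale and the log structure of $X$ is induced by $D$: there is an isomorphism of log structures $$M_X \;\cong\; M(\log D) := j_*\mathcal O_U^\times \cap \mathcal O_X \hookrightarrow \mathcal O_X, \qquad j : U = \mathring X \setminus D \hookrightarrow \mathring X,$$ on the étale site of $\mathring X$ (the functions that are invertible outside $D$). The divisor $D$ may be empty, in which case the log structure is trivial. -/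

import Mathlib

open CategoryTheory Limits AlgebraicGeometry Opposite

universe u

noncomputable section

namespace LogGeom

/-! ### The structure sheaf on the small étale site -/

/-- The presheaf of sets `X ↦ Γ(X, 𝒪_X)` on the category of schemes. -/
def globalSections : Scheme.{u}ᵒᵖ ⥤ Type u where
  obj X := Γ(X.unop, ⊤)
  map f := ↾fun s => f.unop.appTop s

/-- Global functions are the same as morphisms to the affine line. -/
def globalSectionsIso : globalSections.{u} ≅
    yoneda.obj (Spec (.of (MvPolynomial PUnit.{u + 1} (ULift ℤ)))) :=
  NatIso.ofComponents (fun X => equivEquivIso <|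
    (Equiv.funUnique PUnit.{u + 1} _).symm.trans
      (AffineSpace.toSpecMvPolyIntEquiv PUnit.{u + 1}).symm) (by
    intro X Y f
    ext s
    apply (AffineSpace.toSpecMvPolyIntEquiv PUnit.{u + 1}).injective
    ext i
    refine (congrFun (Equiv.apply_symm_apply (AffineSpace.toSpecMvPolyIntEquiv PUnit.{u + 1})
      (fun _ => f.unop.appTop s)) i).trans ?_
    refine Eq.trans ?_ (AffineSpace.toSpecMvPolyIntEquiv_comp PUnit.{u + 1} f.unop
      ((AffineSpace.toSpecMvPolyIntEquiv PUnit.{u + 1}).symm (fun _ => s)) i).symm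
    exact (congrArg (fun v : PUnit.{u + 1} → Γ(X.unop, ⊤) => f.unop.appTop (v i))
      (Equiv.apply_symm_apply (AffineSpace.toSpecMvPolyIntEquiv PUnit.{u + 1})
        (fun _ => s))).symm)

lemma isSheaf_globalSections : Presieve.IsSheaf Scheme.etaleTopology.{u} globalSections := by
  apply Presieve.isSheaf_iso _ globalSectionsIso.symm
  apply Presieve.isSheaf_of_le _ (Scheme.etaleTopology_le_proetaleTopology.trans
    Scheme.proetaleTopology_le_fpqcTopology)
  exact GrothendieckTopology.Subcanonical.isSheaf_of_isRepresentable _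

lemma etale_respectsIso : MorphismProperty.RespectsIso @Etale.{u} :=
  MorphismProperty.IsStableUnderBaseChange.respectsIso

lemma etale_isStableUnderComposition :
    MorphismProperty.IsStableUnderComposition @Etale.{u} where
  comp_mem f g hf hg := by
    have : Etale f := hf
    have : Etale g := hg
    exact (inferInstance : Etale (f ≫ g))

lemma etaleForget_isContinuous (X : Scheme.{u}) :
    (Scheme.Etale.forget X).IsContinuous X.smallEtaleTopology (Scheme.etaleTopology.over X) := by
  have := etale_respectsIso.{u}
  have := etale_isStableUnderComposition.{u}
  have : RepresentablyFlat (Scheme.Etale.forget X) := flat_of_preservesFiniteLimits _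
  have : (Scheme.Etale.forget X).LocallyCoverDense (Scheme.etaleTopology.over X) :=
    Scheme.locallyCoverDense_of_le (P := @Etale) (Q := @Etale) X le_rfl
  rw [Functor.isContinuous_iff_coverPreserving]
  exact Functor.coverPreserving_restrictedTopology (Scheme.Etale.forget X)
    (Scheme.etaleTopology.over X)

/-- The presheaf of sets underlying the structure sheaf on the small étale site of `X`. -/
def etaleFunctions (X : Scheme.{u}) : X.Etaleᵒᵖ ⥤ Type u :=
  (Scheme.Etale.forget X ⋙ Over.forget X).op ⋙ globalSections

lemma isSheaf_etaleFunctions (X : Scheme.{u}) :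
    Presieve.IsSheaf X.smallEtaleTopology (etaleFunctions X) := by
  have := etaleForget_isContinuous X
  have : (Scheme.Etale.forget X ⋙ Over.forget X).IsContinuous X.smallEtaleTopology
      Scheme.etaleTopology :=
    Functor.isContinuous_comp _ _ _ (Scheme.etaleTopology.over X) _
  exact Functor.op_comp_isSheaf_of_isSheaf_type _ _ isSheaf_globalSections

/-! ### Log structures -/

/-- A log structure on a scheme `X`: a sheaf of commutative monoids `M` on the small étale
site of `X` with a morphism of sheaves of monoids `α : M ⟶ (𝒪_X, ·)` that restricts to an
isomorphism `α⁻¹(𝒪_X^×) ≅ 𝒪_X^×`. -/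
structure LogStructure (X : Scheme.{u}) where
  presheaf : X.Etaleᵒᵖ ⥤ CommMonCat.{u}
  isSheaf : Presieve.IsSheaf X.smallEtaleTopology (presheaf ⋙ forget CommMonCat.{u})
  α (U : X.Etale) : presheaf.obj (op U) →* Γ(U.left, ⊤)
  α_naturality {U V : X.Etale} (h : U ⟶ V) (m : presheaf.obj (op V)) :
    α U (presheaf.map h.op m) = h.left.appTop (α V m)
  existsUnique_of_isUnit (U : X.Etale) (s : Γ(U.left, ⊤)) (hs : IsUnit s) :
    ∃! m : presheaf.obj (op U), α U m = s

namespace LogStructure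

variable {X : Scheme.{u}}

/-- The monoid of sections `M(U)` of the log structure over an étale `X`-scheme `U`. -/
abbrev sections (M : LogStructure X) (U : X.Etale) : Type u := M.presheaf.obj (op U)

/-- The restriction map `M(V) → M(U)` along a morphism `h : U ⟶ V` of étale `X`-schemes. -/
def res (M : LogStructure X) {U V : X.Etale} (h : U ⟶ V) : M.sections V →* M.sections U :=
  (M.presheaf.map h.op).hom

lemma res_id (M : LogStructure X) (U : X.Etale) (m : M.sections U) : M.res (𝟙 U) m = m := by
  simp [res]

lemma res_res (M : LogStructure X) {U V W : X.Etale} (h : U ⟶ V) (k : V ⟶ W)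
    (m : M.sections W) : M.res h (M.res k m) = M.res (h ≫ k) m := by
  simp [res]

lemma α_res (M : LogStructure X) {U V : X.Etale} (h : U ⟶ V) (m : M.sections V) :
    M.α U (M.res h m) = h.left.appTop (M.α V m) :=
  M.α_naturality h m

/-- An isomorphism of log structures on `X`: an isomorphism of sheaves of monoids compatible
with the maps to `𝒪_X`. -/
structure Iso (M N : LogStructure X) where
  iso : M.presheaf ≅ N.presheaf
  α_hom (U : X.Etale) (m : M.sections U) : N.α U (iso.hom.app (op U) m) = M.α U m

/-- For an open `U ⊆ X` and `V` étale over `X`, the functions on `V` that are invertible at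
all points of the preimage of `U`. -/
def invertibleOn (U : X.Opens) (V : X.Etale) : Submonoid Γ(V.left, ⊤) where
  carrier := {s | V.hom ⁻¹ᵁ U ≤ V.left.basicOpen s}
  one_mem' := by
    simp only [Set.mem_ofPred_eq]
    rw [Scheme.basicOpen_of_isUnit _ isUnit_one]
    exact le_top
  mul_mem' {s t} hs ht := by
    simp only [Set.mem_ofPred_eq] at *
    rw [Scheme.basicOpen_mul]
    exact le_inf hs ht

lemma mem_invertibleOn {U : X.Opens} {V : X.Etale} {s : Γ(V.left, ⊤)} :
    s ∈ invertibleOn U V ↔ V.hom ⁻¹ᵁ U ≤ V.left.basicOpen s := Iff.rfl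

lemma appTop_mem_invertibleOn {U : X.Opens} {V W : X.Etale} (h : V ⟶ W) {s : Γ(W.left, ⊤)}
    (hs : s ∈ invertibleOn U W) : h.left.appTop s ∈ invertibleOn U V := by
  rw [mem_invertibleOn] at *
  intro x hx
  have e : V.hom = h.left ≫ W.hom := (CategoryTheory.Over.w h.hom).symm
  have h1 : h.left x ∈ W.left.basicOpen s := hs (by
    rw [e] at hx
    exact hx)
  have := Scheme.preimage_basicOpen_top h.left s
  rw [← this]
  exact h1

/-- The functions invertible on the open `U`, as a subfunctor of the structure sheaf. -/
def invertibleOnSubfunctor (U : X.Opens) : Subfunctor (etaleFunctions X) where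
  obj V := (invertibleOn U V.unop : Set Γ(V.unop.left, ⊤))
  map h _ hs := appTop_mem_invertibleOn h.unop hs

lemma exists_of_mem_smallEtaleTopology {V : X.Etale} {S : Sieve V}
    (hS : S ∈ X.smallEtaleTopology V) (x : V.left) :
    ∃ (W : X.Etale) (h : W ⟶ V) (y : W.left), S h ∧ h.left y = x := by
  let Z : (Σ W : X.Etale, {h : W ⟶ V // S h}) → X.Etale := fun i => i.1
  have h1 : Sieve.ofArrows Z (fun i => i.2.1) ∈ X.smallEtaleTopology V :=
    GrothendieckTopology.superset_covering _
      (fun W h hh => Sieve.ofArrows_mk Z (fun i => i.2.1) ⟨W, h, hh⟩) hS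
  rw [Scheme.ofArrows_mem_smallEtaleTopology_iff] at h1
  obtain ⟨i, y, hy⟩ := Set.mem_iUnion.1 (h1.symm ▸ Set.mem_univ x)
  exact ⟨_, _, y, i.2.2, hy⟩

lemma isSheaf_invertibleOnSubfunctor (U : X.Opens) :
    Presieve.IsSheaf X.smallEtaleTopology (invertibleOnSubfunctor U).toFunctor := by
  rw [Subfunctor.isSheaf_iff _ (isSheaf_etaleFunctions X)]
  intro V (s : Γ(V.unop.left, ⊤)) hs x hx
  obtain ⟨W, h, y, hh, rfl⟩ := exists_of_mem_smallEtaleTopology hs x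
  have h1 : W.hom ⁻¹ᵁ U ≤ W.left.basicOpen (h.left.appTop s) := hh
  rw [← Scheme.preimage_basicOpen_top] at h1
  refine h1 ?_
  have e : W.hom = h.left ≫ V.unop.hom := (CategoryTheory.Over.w h.hom).symm
  rw [e]
  exact hx

/-- The log structure `j_* 𝒪_U^× ∩ 𝒪_X ⊆ 𝒪_X` for an open `j : U ⊆ X`, on the étale site. -/
def ofOpen (U : X.Opens) : LogStructure X where
  presheaf :=
    { obj V := CommMonCat.of (invertibleOn U V.unop)
      map {V W} h := CommMonCat.ofHom
        (((h.unop.left.appTop.hom : Γ(V.unop.left, ⊤) →* Γ(W.unop.left, ⊤)).comp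
          (invertibleOn U V.unop).subtype).codRestrict (invertibleOn U W.unop)
            fun s => appTop_mem_invertibleOn h.unop s.2)
      map_id V := by
        ext s
        change (Scheme.Hom.appTop (𝟙 V.unop.left)) s.1 = s.1
        simp
      map_comp f g := by
        ext s
        change (Scheme.Hom.appTop (g.unop.left ≫ f.unop.left)) s.1 =
          g.unop.left.appTop (f.unop.left.appTop s.1)
        rw [Scheme.Hom.comp_appTop]
        rfl }
  isSheaf := by
    exact isSheaf_invertibleOnSubfunctor U
  α V := (invertibleOn U V).subtype
  α_naturality h m := rfl
  existsUnique_of_isUnit V s hs := by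
    refine ⟨⟨s, ?_⟩, rfl, fun t ht => Subtype.ext ht⟩
    rw [mem_invertibleOn, Scheme.basicOpen_of_isUnit _ hs]
    exact le_top

/-- The trivial log structure `𝒪_X^× ⊆ 𝒪_X`. -/
def trivial (X : Scheme.{u}) : LogStructure X := ofOpen ⊤

/-- The log structure `M(log D)` induced by a closed subscheme (divisor) `D` of `X`: the functions
invertible outside `D`. -/
def ofDivisor (D : X.IdealSheafData) : LogStructure X := ofOpen D.support.compl

end LogStructure

/-! ### Log schemes and their morphisms -/

/-- A log scheme: a scheme with a log structure. -/
structure LogScheme where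
  scheme : Scheme.{u}
  logStructure : LogStructure scheme

namespace LogScheme

/-- The monoid of sections `M_X(U)` over an étale `X`-scheme `U`. -/
abbrev sections (X : LogScheme.{u}) (U : X.scheme.Etale) : Type u := X.logStructure.sections U

/-- Restriction `M_X(V) → M_X(U)`. -/
abbrev res (X : LogScheme.{u}) {U V : X.scheme.Etale} (h : U ⟶ V) :
    X.sections V →* X.sections U := X.logStructure.res h

/-- The structure map `M_X(U) → 𝒪(U)`. -/
abbrev α (X : LogScheme.{u}) (U : X.scheme.Etale) : X.sections U →* Γ(U.left, ⊤) :=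
  X.logStructure.α U

/-- A morphism of log schemes `X ⟶ Y`: a morphism `f` of schemes with a morphism of sheaves of
monoids `f⁻¹ M_Y ⟶ M_X` (equivalently `M_Y ⟶ f_* M_X`) compatible with the structure maps to
`f⁻¹ 𝒪_Y ⟶ 𝒪_X`. It is given as the compatible family of its components
`M_Y(V) → M_X(U)`, for all commutative squares over `f` with `U` étale over `X`, `V` étale
over `Y` and top arrow `g : U ⟶ V`. -/
structure Hom (X Y : LogScheme.{u}) where
  base : X.scheme ⟶ Y.scheme
  app (U : X.scheme.Etale) (V : Y.scheme.Etale) (g : U.left ⟶ V.left)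
    (hg : g ≫ V.hom = U.hom ≫ base) : Y.sections V →* X.sections U
  res_app_res {U' U : X.scheme.Etale} {V V' : Y.scheme.Etale} (h : U' ⟶ U) (k : V ⟶ V')
    (g : U.left ⟶ V.left) (hg : g ≫ V.hom = U.hom ≫ base)
    (g' : U'.left ⟶ V'.left) (hg' : g' ≫ V'.hom = U'.hom ≫ base)
    (e : g' = h.left ≫ g ≫ k.left) (m : Y.sections V') :
    X.res h (app U V g hg (Y.res k m)) = app U' V' g' hg' m
  α_app (U : X.scheme.Etale) (V : Y.scheme.Etale) (g : U.left ⟶ V.left)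
    (hg : g ≫ V.hom = U.hom ≫ base) (m : Y.sections V) :
    X.α U (app U V g hg m) = g.appTop (Y.α V m)

namespace Hom

/-- The identity of a log scheme. -/
def id (X : LogScheme.{u}) : Hom X X where
  base := 𝟙 X.scheme
  app U V g hg := X.res (MorphismProperty.Over.homMk g (by simpa using hg))
  res_app_res h k g hg g' hg' e m := by
    subst e
    exact (congrArg _ (LogStructure.res_res _ _ _ _)).trans (LogStructure.res_res _ _ _ _)
  α_app U V g hg m := LogStructure.α_res _ _ _

variable {X Y Z : LogScheme.{u}}

/-- The base change `V ×_Y X`, étale over `X`, of `V` étale over `Y`. -/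
def pullbackObj (f : X.scheme ⟶ Y.scheme) (V : Y.scheme.Etale) : X.scheme.Etale :=
  Scheme.Etale.mk (pullback.snd V.hom f)

/-- The projection `V ×_Y X ⟶ V`. -/
def pullbackProj (f : X.scheme ⟶ Y.scheme) (V : Y.scheme.Etale) :
    (pullbackObj f V).left ⟶ V.left :=
  pullback.fst V.hom f

lemma pullbackProj_hom (f : X.scheme ⟶ Y.scheme) (V : Y.scheme.Etale) :
    pullbackProj f V ≫ V.hom = (pullbackObj f V).hom ≫ f :=
  pullback.condition

/-- The map `U ⟶ V ×_Y X` induced by a commutative square. -/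
def pullbackLift (f : X.scheme ⟶ Y.scheme) (V : Y.scheme.Etale) {U : X.scheme.Etale}
    (g : U.left ⟶ V.left) (hg : g ≫ V.hom = U.hom ≫ f) : U ⟶ pullbackObj f V :=
  MorphismProperty.Over.homMk (pullback.lift g U.hom hg) (pullback.lift_snd _ _ _)

lemma pullbackLift_proj (f : X.scheme ⟶ Y.scheme) (V : Y.scheme.Etale) {U : X.scheme.Etale}
    (g : U.left ⟶ V.left) (hg : g ≫ V.hom = U.hom ≫ f) :
    (pullbackLift f V g hg).left ≫ pullbackProj f V = g :=
  pullback.lift_fst _ _ _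

lemma app_res (f : Hom X Y) {U : X.scheme.Etale} {V V' : Y.scheme.Etale} (k : V ⟶ V')
    (g : U.left ⟶ V.left) (hg : g ≫ V.hom = U.hom ≫ f.base) (g' : U.left ⟶ V'.left)
    (hg' : g' ≫ V'.hom = U.hom ≫ f.base) (e : g' = g ≫ k.left) (m : Y.sections V') :
    f.app U V g hg (Y.res k m) = f.app U V' g' hg' m := by
  rw [← f.res_app_res (𝟙 U) k g hg g' hg' (by rw [e]; exact (Category.id_comp _).symm) m]
  exact (LogStructure.res_id _ _ _).symm

lemma res_app (f : Hom X Y) {U' U : X.scheme.Etale} {V : Y.scheme.Etale} (h : U' ⟶ U)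
    (g : U.left ⟶ V.left) (hg : g ≫ V.hom = U.hom ≫ f.base) (g' : U'.left ⟶ V.left)
    (hg' : g' ≫ V.hom = U'.hom ≫ f.base) (e : g' = h.left ≫ g) (m : Y.sections V) :
    X.res h (f.app U V g hg m) = f.app U' V g' hg' m := by
  rw [← f.res_app_res h (𝟙 V) g hg g' hg' (by
    rw [e]
    exact congrArg (h.left ≫ ·) (Category.comp_id _).symm) m]
  rw [show Y.res (𝟙 V) m = m from LogStructure.res_id _ _ _]

lemma pullbackLift_hom (f : X.scheme ⟶ Y.scheme) (V : Y.scheme.Etale) {U : X.scheme.Etale}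
    (g : U.left ⟶ V.left) (hg : g ≫ V.hom = U.hom ≫ f) :
    (pullbackLift f V g hg).left ≫ (pullbackObj f V).hom = U.hom :=
  pullback.lift_snd _ _ _

lemma pullback_ext (f : X.scheme ⟶ Y.scheme) (V : Y.scheme.Etale) {T : Scheme.{u}}
    {a b : T ⟶ (pullbackObj f V).left} (h1 : a ≫ pullbackProj f V = b ≫ pullbackProj f V)
    (h2 : a ≫ (pullbackObj f V).hom = b ≫ (pullbackObj f V).hom) : a = b :=
  pullback.hom_ext h1 h2

/-- The first factor of a morphism `U ⟶ W` lying over a composition `g ∘ f`, through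
`W ×_Z Y`. -/
def factor (f : X.scheme ⟶ Y.scheme) (g : Y.scheme ⟶ Z.scheme) {U : X.scheme.Etale}
    {W : Z.scheme.Etale} (j : U.left ⟶ W.left) (hj : j ≫ W.hom = U.hom ≫ f ≫ g) :
    U.left ⟶ (pullbackObj g W).left :=
  pullback.lift j (U.hom ≫ f) (hj.trans (Category.assoc _ _ _).symm)

lemma factor_hom (f : X.scheme ⟶ Y.scheme) (g : Y.scheme ⟶ Z.scheme) {U : X.scheme.Etale}
    {W : Z.scheme.Etale} (j : U.left ⟶ W.left) (hj : j ≫ W.hom = U.hom ≫ f ≫ g) :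
    factor f g j hj ≫ (pullbackObj g W).hom = U.hom ≫ f :=
  pullback.lift_snd _ _ _

lemma factor_proj (f : X.scheme ⟶ Y.scheme) (g : Y.scheme ⟶ Z.scheme) {U : X.scheme.Etale}
    {W : Z.scheme.Etale} (j : U.left ⟶ W.left) (hj : j ≫ W.hom = U.hom ≫ f ≫ g) :
    factor f g j hj ≫ pullbackProj g W = j :=
  pullback.lift_fst _ _ _

/-- The components of the composition, computed through `W ×_Z Y`. -/
def compApp (f : Hom X Y) (g : Hom Y Z) (U : X.scheme.Etale) (W : Z.scheme.Etale)
    (j : U.left ⟶ W.left) (hj : j ≫ W.hom = U.hom ≫ f.base ≫ g.base) :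
    Z.sections W →* X.sections U :=
  (f.app U (pullbackObj g.base W) (factor f.base g.base j hj) (factor_hom _ _ _ _)).comp
    (g.app (pullbackObj g.base W) W (pullbackProj g.base W) (pullbackProj_hom _ _))

/-- The components of the composition can be computed through any factorization. -/
lemma compApp_eq (f : Hom X Y) (g : Hom Y Z) {U : X.scheme.Etale} {V : Y.scheme.Etale}
    {W : Z.scheme.Etale} (j : U.left ⟶ W.left) (hj : j ≫ W.hom = U.hom ≫ f.base ≫ g.base)
    (p : U.left ⟶ V.left) (hp : p ≫ V.hom = U.hom ≫ f.base) (q : V.left ⟶ W.left)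
    (hq : q ≫ W.hom = V.hom ≫ g.base) (e : p ≫ q = j) (m : Z.sections W) :
    f.app U V p hp (g.app V W q hq m) = compApp f g U W j hj m := by
  have h1 := g.res_app (pullbackLift g.base W q hq) (pullbackProj g.base W)
    (pullbackProj_hom _ _) q hq (pullbackLift_proj _ _ _ _).symm m
  refine (congrArg (f.app U V p hp) h1.symm).trans ?_
  refine f.app_res _ _ _ _ (factor_hom _ _ _ _) ?_ _
  apply pullback_ext
  · refine (factor_proj _ _ _ _).trans ?_
    refine Eq.trans ?_ (Category.assoc _ _ _).symm
    rw [pullbackLift_proj]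
    exact e.symm
  · refine (factor_hom _ _ _ _).trans ?_
    refine Eq.trans ?_ (Category.assoc _ _ _).symm
    rw [pullbackLift_hom]
    exact hp.symm

/-- The composition of morphisms of log schemes. -/
def comp (f : Hom X Y) (g : Hom Y Z) : Hom X Z where
  base := f.base ≫ g.base
  app := compApp f g
  res_app_res := by
    intro U' U W W' h k j hj j' hj' e m
    have h1 := g.app_res k (pullbackProj g.base W) (pullbackProj_hom _ _)
      (pullbackProj g.base W ≫ k.left) (by
        have := CategoryTheory.Over.w k.hom
        refine (Category.assoc _ _ _).trans (Eq.trans ?_ (pullbackProj_hom g.base W))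
        exact congrArg (pullbackProj g.base W ≫ ·) this) rfl m
    have h2 := f.res_app h (factor f.base g.base j hj) (factor_hom _ _ _ _)
      (h.left ≫ factor f.base g.base j hj) (by
        have := CategoryTheory.Over.w h.hom
        refine (Category.assoc _ _ _).trans ?_
        rw [factor_hom]
        refine (Category.assoc _ _ _).symm.trans ?_
        exact congrArg (· ≫ f.base) this) rfl
      (g.app (pullbackObj g.base W) W' (pullbackProj g.base W ≫ k.left) (by
        have := CategoryTheory.Over.w k.hom
        refine (Category.assoc _ _ _).trans (Eq.trans ?_ (pullbackProj_hom g.base W))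
        exact congrArg (pullbackProj g.base W ≫ ·) this) m)
    refine (congrArg (fun t => X.res h (f.app U _ (factor f.base g.base j hj)
      (factor_hom _ _ _ _) t)) h1).trans (h2.trans ?_)
    refine compApp_eq f g _ _ _ _ _ _ ?_ m
    rw [e, Category.assoc, ← Category.assoc (factor _ _ _ _), factor_proj]
  α_app U W j hj m := by
    refine (f.α_app _ _ _ _ _).trans ?_
    rw [g.α_app]
    have := congrArg (fun t : U.left ⟶ W.left => t.appTop (Z.α W m))
      (factor_proj f.base g.base j hj)
    rw [← this, Scheme.Hom.comp_appTop]
    rfl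

lemma ext' {f g : Hom X Y} (h : f.base = g.base)
    (h' : ∀ U V a ha hb m, f.app U V a ha m = g.app U V a hb m) : f = g := by
  obtain ⟨f0, f1, _, _⟩ := f
  obtain ⟨g0, g1, _, _⟩ := g
  dsimp at h
  subst h
  congr
  funext U V a ha
  ext m
  exact h' U V a ha ha m

end Hom

instance : Category LogScheme.{u} where
  Hom := Hom
  id := Hom.id
  comp := Hom.comp
  id_comp {X Y} f := by
    refine Hom.ext' (Category.id_comp _) fun U V a ha hb m => ?_
    refine (Hom.compApp_eq (Hom.id X) f (V := U) a ha (𝟙 U.left) ?_ a hb ?_ m).symm.trans ?_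
    · exact (Category.id_comp _).trans (Category.comp_id _).symm
    · exact Category.id_comp _
    · exact LogStructure.res_id _ _ _
  comp_id {X Y} f := by
    refine Hom.ext' (Category.comp_id _) fun U V a ha hb m => ?_
    refine (Hom.compApp_eq f (Hom.id Y) (V := V) a ha a hb (𝟙 V.left) ?_ ?_ m).symm.trans ?_
    · exact (Category.id_comp _).trans (Category.comp_id _).symm
    · exact Category.comp_id _
    · exact congrArg (f.app U V a hb) (LogStructure.res_id _ _ _)
  assoc {X Y Z T} f g h := by
    refine Hom.ext' (Category.assoc _ _ _) fun U V a ha hb m => ?_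
    have e2 : Hom.factor f.base (g.base ≫ h.base) a hb ≫
        (Hom.pullbackObj (g.base ≫ h.base) V).hom = U.hom ≫ f.base := Hom.factor_hom _ _ _ _
    have e3 := Hom.pullbackProj_hom (g.base ≫ h.base) V
    refine Eq.trans ?_ (Hom.compApp_eq f (Hom.comp g h) a hb
      (Hom.factor f.base (g.base ≫ h.base) a hb) e2
      (Hom.pullbackProj (g.base ≫ h.base) V) e3 (Hom.factor_proj _ _ _ _) m)
    have e4 := Hom.factor_hom g.base h.base (Hom.pullbackProj (g.base ≫ h.base) V) e3
    have e5 := Hom.factor_proj g.base h.base (Hom.pullbackProj (g.base ≫ h.base) V) e3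
    have e6 : (Hom.factor f.base (g.base ≫ h.base) a hb ≫
        Hom.factor g.base h.base (Hom.pullbackProj (g.base ≫ h.base) V) e3) ≫
        (Hom.pullbackObj h.base V).hom = U.hom ≫ f.base ≫ g.base := by
      rw [Category.assoc, e4, ← Category.assoc, e2, Category.assoc]
    refine Eq.trans ?_ (Hom.compApp_eq f g _ e6 _ e2 _ e4 rfl
      (h.app _ V (Hom.pullbackProj h.base V) (Hom.pullbackProj_hom _ _) m)).symm
    refine (Hom.compApp_eq (Hom.comp f g) h a ha _ e6 _ (Hom.pullbackProj_hom _ _) ?_ m).symm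
    rw [Category.assoc, e5]
    exact Hom.factor_proj _ _ _ _

variable {X Y : LogScheme.{u}}

/-- A morphism `f : X ⟶ Y` of log schemes is strict if the log structure of `X` is the pullback
of that of `Y`. The pullback `f^* M_Y` is the sheaf associated with the pushout of
`f⁻¹ M_Y ← f⁻¹ 𝒪_Y^× → 𝒪_X^×`, and the condition says that the canonical map `f^* M_Y ⟶ M_X` is
locally surjective and locally injective (units of `M_X` and `M_Y` being units of `𝒪_X` and
`𝒪_Y`). -/
structure IsStrict (f : X ⟶ Y) : Prop where
  locally_surjective (U : X.scheme.Etale) (m : X.sections U) (x : U.left) :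
    ∃ (U' : X.scheme.Etale) (h : U' ⟶ U) (x' : U'.left) (V : Y.scheme.Etale)
      (g : U'.left ⟶ V.left) (hg : g ≫ V.hom = U'.hom ≫ f.base)
      (n : Y.sections V) (w : X.sections U'),
      h.left x' = x ∧ IsUnit w ∧ X.res h m = w * f.app U' V g hg n
  locally_injective (U : X.scheme.Etale) (V : Y.scheme.Etale) (g : U.left ⟶ V.left)
    (hg : g ≫ V.hom = U.hom ≫ f.base) (n n' : Y.sections V) (w : X.sections U)
    (hw : IsUnit w) (e : f.app U V g hg n = w * f.app U V g hg n') (x : U.left) :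
    ∃ (U' : X.scheme.Etale) (h : U' ⟶ U) (x' : U'.left) (V' : Y.scheme.Etale) (k : V' ⟶ V)
      (g' : U'.left ⟶ V'.left) (hg' : g' ≫ V'.hom = U'.hom ≫ f.base) (v : Y.sections V'),
      h.left x' = x ∧ g' ≫ k.left = h.left ≫ g ∧ IsUnit v ∧
      Y.res k n = v * Y.res k n' ∧ f.app U' V' g' hg' v = X.res h w

/-- A homomorphism `φ : P → M_X(U)` is a chart on `U` if the canonical map `P^a ⟶ M_X|_U` from
the associated log structure is an isomorphism. Here `P^a` is the sheaf associated with the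
pushout of `P ← (α ∘ φ)⁻¹(𝒪_X^×) → 𝒪_X^×`, in which `(p, 1)` and `(q, w)` become equal if and
only if locally there are `a, b` in `(α ∘ φ)⁻¹(𝒪_X^×)` with `p a = q b` and
`α(φ(b)) = w α(φ(a))`; the condition says that the map is locally surjective and locally
injective. -/
structure IsChart {U : X.scheme.Etale} {P : Type u} [CommMonoid P] (φ : P →* X.sections U) :
    Prop where
  locally_surjective (W : X.scheme.Etale) (h : W ⟶ U) (m : X.sections W) (x : W.left) :
    ∃ (W' : X.scheme.Etale) (k : W' ⟶ W) (x' : W'.left) (p : P) (w : X.sections W'),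
      k.left x' = x ∧ IsUnit w ∧ X.res k m = w * X.res (k ≫ h) (φ p)
  locally_injective (W : X.scheme.Etale) (h : W ⟶ U) (p q : P) (w : X.sections W)
    (hw : IsUnit w) (e : X.res h (φ p) = w * X.res h (φ q)) (x : W.left) :
    ∃ (W' : X.scheme.Etale) (k : W' ⟶ W) (x' : W'.left) (a b : P),
      k.left x' = x ∧ IsUnit (X.res (k ≫ h) (φ a)) ∧ IsUnit (X.res (k ≫ h) (φ b)) ∧
      p * a = q * b ∧ X.res (k ≫ h) (φ b) = X.res k w * X.res (k ≫ h) (φ a)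

/-- A commutative monoid `P` is saturated if `x ∈ P^gp` and `x ^ n ∈ P` for some `n > 0` imply
`x ∈ P` (written out for `x = a / b`, for integral `P`). -/
def IsSaturated (P : Type u) [CommMonoid P] : Prop :=
  ∀ (a b c : P) (n : ℕ), 0 < n → a ^ n = b ^ n * c → ∃ d : P, a = b * d

/-- Fine log schemes: étale locally there is a chart by a finitely generated integral monoid. -/
def IsFine (X : LogScheme.{u}) : Prop :=
  ∀ x : X.scheme, ∃ (U : X.scheme.Etale) (y : U.left) (P : Type u) (_ : CommMonoid P)
    (φ : P →* X.sections U),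
    U.hom y = x ∧ Monoid.FG P ∧ IsCancelMul P ∧ IsChart φ

/-- Fs log schemes: étale locally there is a chart by a finitely generated, integral and
saturated monoid. -/
def IsFs (X : LogScheme.{u}) : Prop :=
  ∀ x : X.scheme, ∃ (U : X.scheme.Etale) (y : U.left) (P : Type u) (_ : CommMonoid P)
    (φ : P →* X.sections U),
    U.hom y = x ∧ Monoid.FG P ∧ IsCancelMul P ∧ IsSaturated P ∧ IsChart φ

/-- A log thickening of order one: a strict closed immersion `i : T' ⟶ T` of fine log schemes
whose ideal sheaf has square zero. -/
structure IsFirstOrderThickening {T' T : LogScheme.{u}} (i : T' ⟶ T) : Prop where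
  fine_source : T'.IsFine
  fine_target : T.IsFine
  strict : IsStrict i
  isClosedImmersion : IsClosedImmersion i.base
  mul_eq_zero (U : T.scheme.Opens) (a b : Γ(T.scheme, U)) (ha : i.base.app U a = 0)
    (hb : i.base.app U b = 0) : a * b = 0

/-- Log smoothness (for morphisms of fine log schemes): the underlying morphism is locally of
finite presentation, and for every commutative square from a log thickening `i : T' ⟶ T` to
`f : X ⟶ Y` there is, étale locally on `T`, a diagonal `g`. An étale neighbourhood in `T` is a
strict étale morphism `j : U ⟶ T`, and that `g` restricts to `s` on `U ×_T T'` is expressed on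
points with values in arbitrary log schemes `W`. -/
structure IsLogSmooth (f : X ⟶ Y) : Prop where
  locallyOfFinitePresentation : LocallyOfFinitePresentation f.base
  exists_lift (T' T : LogScheme.{u}) (i : T' ⟶ T) (hi : IsFirstOrderThickening i)
    (s : T' ⟶ X) (t : T ⟶ Y) (comm : s ≫ f = i ≫ t) (x : T.scheme) :
    ∃ (U : LogScheme.{u}) (j : U ⟶ T) (g : U ⟶ X),
      Etale j.base ∧ IsStrict j ∧ x ∈ Set.range j.base ∧ g ≫ f = j ≫ t ∧
      ∀ (W : LogScheme.{u}) (a : W ⟶ T') (b : W ⟶ U), a ≫ i = b ≫ j → a ≫ s = b ≫ g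

/-- A scheme with its trivial log structure. -/
def trivial (S : Scheme.{u}) : LogScheme.{u} := ⟨S, LogStructure.trivial S⟩

/-- A log-smooth curve over a field `K` with trivial log structure: an fs log scheme `X`,
log smooth over `Spec K`, whose underlying scheme is geometrically connected and of pure
dimension one. -/
structure IsLogSmoothCurve {K : Type u} [Field K] (f : X ⟶ trivial (Spec (.of K))) : Prop where
  fs : X.IsFs
  logSmooth : IsLogSmooth f
  geometricallyConnected : GeometricallyConnected f.base
  pureDimensionOne : ∀ Z ∈ irreducibleComponents X.scheme, topologicalKrullDim Z = 1

end LogScheme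

/-- Effective Cartier divisors: closed subschemes locally cut out by one nonzerodivisor. -/
def IsEffectiveCartierDivisor {X : Scheme.{u}} (D : X.IdealSheafData) : Prop :=
  ∀ x : X, ∃ (U : X.affineOpens) (s : Γ(X, U.1)), x ∈ U.1 ∧ s ∈ nonZeroDivisors Γ(X, U.1) ∧
    D.ideal U = Ideal.span {s}

end LogGeom

end

/-!
# Log smooth curves over a field with trivial log structure

Log smoothness is used only through test objects for which all étale sheaves are determined by their
global sections: *log points*, the spectra `T` of local rings with nilpotent maximal ideal and
separably closed residue field (`IsStrictPoint`), with the log structure of a monoid `Q` mapping to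
the functions on `T` such that only `1` becomes invertible (`pointLogStructure`). A morphism from a
log point to the domain of a chart `Q → M_X` is a morphism of schemes together with units that
compare the two homomorphisms from `Q` to the functions (`LogPoint.chartGenerators`), and étale
neighbourhoods of a log point split. So log smoothness becomes a lifting property for homomorphisms
out of the local rings of étale `X`-schemes, in `IsLogSmooth.exists_ringHom_of_isNilpotent`: given
`β : Q → B` and a local homomorphism to a quotient `B'` of `B` by a nilpotent ideal, compatible with
`β` and a chart up to units, there is a lift to `B` with the same property.

Every point has a chart by a sharp fine saturated monoid `Q`, all of whose elements other than `1`
vanish at the point (`IsFs.exists_sharp_chart`). The lifting property is applied in four ways, with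
`Ω` an algebraic closure of the residue field.

* For the truncations of `Ω[Q]` at the vertex, it shows that `Ω[Q]` has dimension at most that of
  the curve there, in the form that a power of the augmentation ideal is principal modulo the next
  one. By `dvd_or_dvd_of_pow_le`, any two elements of `Q` are then comparable for divisibility, and
  `Q` is trivial or isomorphic to `ℕ` (`eq_one_or_exists_generator`).
* Such monoids are projective. So a classical infinitesimal lifting problem for the scheme
  underlying `X` can be provided with log structures and be solved
  (`IsLogSmoothCurve.exists_ringHom`). By a version of the Jacobian criterion at a geometric point,
  `formallySmooth_of_liftsAt`, the scheme is smooth, and its relative dimension is the dimension at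
  closed points.
* For the dual numbers over `Ω`, there is a tangent vector along which the generator `t` of a chart
  `ℕ → M_X` is not constant, where `t` vanishes. As the differentials are generated by one element,
  `t` is a local parameter and the residue field is finite separable over `K`
  (`IsLogSmoothCurve.maximalIdeal_eq_span`).
* For the rings `Ω[X] / (X ^ (n + 1))`, it shows that `t` is not nilpotent, and hence a
  nonzerodivisor (`IsLogSmoothCurve.chartGerm_mem_nonZeroDivisors`).

So the set of points where the log structure is not trivial consists of isolated closed points with
finite separable residue fields, each of which is cut out by a nonzerodivisor; with its reduced
structure, this set is the divisor `IsLogSmoothCurve.divisor`. Sections of the log structure are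
locally of the form `u t ^ n` for units `u`. They are determined by their images in the structure
sheaf (`IsLogSmoothCurve.α_injective`), which are the functions invertible outside the divisor
(`IsLogSmoothCurve.exists_α_eq_iff`): a function invertible where `t` is divides a power of the
local parameter `t`.
-/

namespace LogGeom

set_option linter.unusedSectionVars false

/-! ### Strict points -/

/-- A scheme `T` with one point such that every étale `T`-scheme `U` has a section through each
of its points, such as the spectrum of an Artinian local ring with separably closed residue
field. -/
class IsStrictPoint (T : Scheme.{u}) : Prop where
  nonempty : Nonempty T
  subsingleton : Subsingleton T
  exists_section {U : Scheme.{u}} (p : U ⟶ T) [Etale p] (x : U) :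
    ∃ σ : T ⟶ U, σ ≫ p = 𝟙 T ∧ ∀ t, σ t = x

attribute [instance] IsStrictPoint.nonempty IsStrictPoint.subsingleton

namespace IsStrictPoint

/-- A section of an étale morphism is an open immersion, so whatever meets only its image
factors through it. -/
lemma eq_comp_section {T U S : Scheme.{u}} (p : U ⟶ T) [Etale p] (σ : T ⟶ U)
    (hσ : σ ≫ p = 𝟙 T) (τ : S ⟶ U) (h : Set.range τ ⊆ Set.range σ) : τ = (τ ≫ p) ≫ σ := by
  have h1 : Etale (σ ≫ p) := by rw [hσ]; infer_instance
  have h2 : Etale σ := Etale.of_comp σ p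
  have h3 : Mono σ := by
    have : Mono (σ ≫ p) := by rw [hσ]; infer_instance
    exact mono_of_mono σ p
  have h4 : IsOpenImmersion σ := IsOpenImmersion.of_flat_of_mono σ
  have h5 := IsOpenImmersion.lift_fac σ τ h
  have h6 : IsOpenImmersion.lift σ τ h = τ ≫ p := by
    conv_rhs => rw [← h5, Category.assoc, hσ, Category.comp_id]
  rw [← h6, h5]

lemma section_ext {T U : Scheme.{u}} [IsStrictPoint T] (p : U ⟶ T) [Etale p] {σ τ : T ⟶ U}
    (hσ : σ ≫ p = 𝟙 T) (hτ : τ ≫ p = 𝟙 T) (t : T) (h : σ t = τ t) : σ = τ := by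
  have := eq_comp_section p τ hτ σ (by
    rintro _ ⟨s, rfl⟩
    exact ⟨t, by rw [← h, Subsingleton.elim s t]⟩)
  rwa [hσ, Category.id_comp] at this

/-- A morphism from a strict point lifts along étale morphisms through any point in the fibre. -/
lemma exists_lift {T V' V : Scheme.{u}} [IsStrictPoint T] (k : V' ⟶ V) [Etale k] (τ : T ⟶ V)
    (v : V') (t : T) (h : k v = τ t) : ∃ τ' : T ⟶ V', τ' ≫ k = τ ∧ ∀ s, τ' s = v := by
  obtain ⟨z, hz, -⟩ := Scheme.Pullback.exists_preimage_pullback v t h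
  obtain ⟨σ, hσ, hσ'⟩ := exists_section (pullback.snd k τ) z
  refine ⟨σ ≫ pullback.fst k τ, ?_, fun s => ?_⟩
  · rw [Category.assoc, pullback.condition, reassoc_of% hσ]
  · rw [Scheme.Hom.comp_apply, hσ', hz]

/-- Sections of an étale `T`-scheme over a morphism `i : T' ⟶ T` of strict points extend
uniquely to `T`. -/
lemma exists_extension {T' T V : Scheme.{u}} [IsStrictPoint T'] [IsStrictPoint T]
    (i : T' ⟶ T) (p : V ⟶ T) [Etale p] (τ : T' ⟶ V) (hτ : τ ≫ p = i) :
    ∃ σ : T ⟶ V, σ ≫ p = 𝟙 T ∧ i ≫ σ = τ := by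
  obtain ⟨t⟩ := nonempty (T := T')
  obtain ⟨σ, hσ, hσ'⟩ := exists_section p (τ t)
  refine ⟨σ, hσ, ?_⟩
  have := eq_comp_section p σ hσ τ (by
    rintro _ ⟨s, rfl⟩
    exact ⟨i t, by rw [hσ', Subsingleton.elim s t]⟩)
  rw [this, hτ]

lemma extension_unique {T' T V : Scheme.{u}} [IsStrictPoint T'] [IsStrictPoint T]
    (i : T' ⟶ T) (p : V ⟶ T) [Etale p] {σ σ' : T ⟶ V} (hσ : σ ≫ p = 𝟙 T) (hσ' : σ' ≫ p = 𝟙 T)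
    (h : i ≫ σ = i ≫ σ') : σ = σ' := by
  obtain ⟨t⟩ := nonempty (T := T')
  refine section_ext p hσ hσ' (i t) ?_
  rw [← Scheme.Hom.comp_apply, ← Scheme.Hom.comp_apply, h]

/-- The spectrum of a ring `B` with a surjection onto a separably closed field with nilpotent
kernel is a strict point. -/
lemma of_surjective {B Ω : Type u} [CommRing B] [Field Ω] [IsSepClosed Ω] (π : B →+* Ω)
    (hπ : Function.Surjective π) (hn : IsNilpotent (RingHom.ker π)) :
    IsStrictPoint (Spec (.of B)) := by
  have hmax : (RingHom.ker π).IsMaximal := RingHom.ker_isMaximal_of_surjective π hπ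
  have key (p : PrimeSpectrum B) : p = ⟨RingHom.ker π, hmax.isPrime⟩ := by
    obtain ⟨n, hn⟩ := hn
    have : RingHom.ker π ≤ p.asIdeal := by
      have h1 : RingHom.ker π ^ n ≤ p.asIdeal := by rw [hn]; exact bot_le
      exact p.isPrime.le_of_pow_le h1
    exact PrimeSpectrum.ext (hmax.eq_of_le p.isPrime.ne_top this).symm
  refine ⟨⟨⟨RingHom.ker π, hmax.isPrime⟩⟩, ⟨fun a b => (key a).trans (key b).symm⟩, ?_⟩
  intro U p hp x
  have hss : Subsingleton (Spec (.of B)) := ⟨fun a b => (key a).trans (key b).symm⟩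
  obtain ⟨l, hl, hlx⟩ := Scheme.exists_fac_of_etale_of_isSepClosed p
    (Spec.map (CommRingCat.ofHom π)) x (Subsingleton.elim _ _)
  obtain ⟨_, ⟨V, hV, rfl⟩, hxV, -⟩ :=
    U.isBasis_affineOpens.exists_subset_of_mem_open (Set.mem_univ x) isOpen_univ
  have : IsOpenImmersion hV.fromSpec := hV.isOpenImmersion_fromSpec
  have hrange : Set.range l ⊆ Set.range hV.fromSpec := by
    rw [hV.range_fromSpec]
    rintro _ ⟨s, rfl⟩
    rw [Subsingleton.elim s default, hlx]
    exact hxV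
  obtain ⟨φ, hφ⟩ := Spec.map_surjective (hV.fromSpec ≫ p)
  obtain ⟨ψ, hψ⟩ := Spec.map_surjective (IsOpenImmersion.lift hV.fromSpec l hrange)
  have het : Etale (Spec.map φ) := by rw [hφ]; infer_instance
  rw [HasRingHomProperty.Spec_iff (P := @Etale)] at het
  have hcomp : ψ.hom.comp φ.hom = π := by
    have : Spec.map (φ ≫ ψ) = Spec.map (CommRingCat.ofHom π) := by
      rw [Spec.map_comp, hφ, hψ, ← hl, IsOpenImmersion.lift_fac_assoc]
    exact congrArg CommRingCat.Hom.hom (Spec.map_injective this)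
  algebraize [φ.hom, π]
  let ψ' : Γ(U, V) →ₐ[B] Ω := ⟨ψ.hom, fun b => congr($hcomp b)⟩
  let π' : B →ₐ[B] Ω := Algebra.ofId B Ω
  let g := Algebra.FormallySmooth.liftOfSurjective ψ' π' hπ hn
  have hg : π.comp g.toRingHom = ψ.hom := RingHom.ext fun c =>
    Algebra.FormallySmooth.liftOfSurjective_apply ψ' π' hπ hn c
  refine ⟨Spec.map (CommRingCat.ofHom g.toRingHom) ≫ hV.fromSpec, ?_, fun t => ?_⟩
  · rw [Category.assoc, ← hφ, ← Spec.map_comp, ← Spec.map_id]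
    congr 1
    ext b
    exact g.commutes b
  · have h1 : Spec.map (CommRingCat.ofHom π) ≫ Spec.map (CommRingCat.ofHom g.toRingHom) ≫
        hV.fromSpec = l := by
      rw [← Spec.map_comp_assoc, ← CommRingCat.ofHom_comp, hg, CommRingCat.ofHom_hom, hψ,
        IsOpenImmersion.lift_fac]
    rw [← hlx, ← h1, Scheme.Hom.comp_apply (Spec.map (CommRingCat.ofHom π))]
    congr 1
    exact Subsingleton.elim _ _

end IsStrictPoint

/-! ### Log points -/

/-- `T` as an étale scheme over itself, the terminal object of the small étale site. -/
noncomputable abbrev basePt (T : Scheme.{u}) : T.Etale := Scheme.Etale.mk (𝟙 T)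

/-- A section of an étale `T`-scheme, as a morphism in the small étale site. -/
noncomputable def sectionHom {T : Scheme.{u}} {U : T.Etale} (σ : T ⟶ U.left) (h : σ ≫ U.hom = 𝟙 T) :
    basePt T ⟶ U :=
  MorphismProperty.Over.homMk σ h

lemma etale_hom_ext {T : Scheme.{u}} {U V : T.Etale} {a b : U ⟶ V} (h : a.left = b.left) :
    a = b :=
  MorphismProperty.Over.Hom.ext h

lemma left_hom {T : Scheme.{u}} {U V : T.Etale} (a : U ⟶ V) : a.left ≫ V.hom = U.hom :=
  CategoryTheory.Over.w a.hom

lemma basePt_w {T : Scheme.{u}} {U : T.Etale} (σ : basePt T ⟶ U) : σ.left ≫ U.hom = 𝟙 T :=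
  left_hom σ

lemma to_basePt_ext {T : Scheme.{u}} {U : T.Etale} (a b : U ⟶ basePt T) : a = b := by
  apply etale_hom_ext
  have h1 : a.left = U.hom := (Category.comp_id _).symm.trans (left_hom a)
  have h2 : b.left = U.hom := (Category.comp_id _).symm.trans (left_hom b)
  rw [h1, h2]

lemma comp_left' {T : Scheme.{u}} {U V W : T.Etale} (a : U ⟶ V) (b : V ⟶ W) :
    (a ≫ b).left = a.left ≫ b.left := rfl

section StrictPoint

variable {T : Scheme.{u}} [IsStrictPoint T]

lemma exists_sectionHom (U : T.Etale) (x : U.left) :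
    ∃ σ : basePt T ⟶ U, ∀ t : T, σ.left t = x := by
  obtain ⟨σ, hσ, hx⟩ := IsStrictPoint.exists_section (T := T) U.hom x
  exact ⟨sectionHom σ hσ, hx⟩

lemma exists_lift_sectionHom {U W : T.Etale} (h : W ⟶ U) (σ : basePt T ⟶ U) (y : W.left) (t : T)
    (hy : h.left y = σ.left t) : ∃ τ : basePt T ⟶ W, τ ≫ h = σ := by
  obtain ⟨τ, hτ, -⟩ := IsStrictPoint.exists_lift (T := T) h.left σ.left y t hy
  refine ⟨sectionHom τ ?_, etale_hom_ext hτ⟩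
  exact (congrArg (τ ≫ ·) (left_hom h)).symm.trans ((Category.assoc _ _ _).symm.trans
    ((congrArg (· ≫ U.hom) hτ).trans (basePt_w σ)))

/-- A covering sieve on the étale site of a strict point contains all sections. -/
lemma sieve_sectionHom {U : T.Etale} {S : Sieve U} (hS : S ∈ T.smallEtaleTopology U)
    (σ : basePt T ⟶ U) : S σ := by
  obtain ⟨t⟩ := IsStrictPoint.nonempty (T := T)
  obtain ⟨W, h, y, hh, hy⟩ := LogStructure.exists_of_mem_smallEtaleTopology hS (σ.left t)
  obtain ⟨τ, rfl⟩ := exists_lift_sectionHom h σ y t hy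
  exact S.downward_closed hh τ

lemma sections_cover (U : T.Etale) :
    Sieve.ofArrows (fun _ : basePt T ⟶ U => basePt T) (fun σ => σ) ∈ T.smallEtaleTopology U := by
  rw [Scheme.ofArrows_mem_smallEtaleTopology_iff, Set.eq_univ_iff_forall]
  intro x
  obtain ⟨σ, hσ⟩ := exists_sectionHom U x
  obtain ⟨t⟩ := IsStrictPoint.nonempty (T := T)
  exact Set.mem_iUnion.2 ⟨σ, t, hσ t⟩

/-- A function on an étale scheme over a strict point is given by its values on the sections. -/
lemma existsUnique_function (U : T.Etale) (b : (basePt T ⟶ U) → Γ(T, ⊤)) :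
    ∃! s : Γ(U.left, ⊤), ∀ σ : basePt T ⟶ U, σ.left.appTop s = b σ := by
  have h1 := isSheaf_etaleFunctions T _ (sections_cover U)
  rw [Sieve.ofArrows, ← Presieve.isSheafFor_iff_generate, Presieve.isSheafFor_arrows_iff] at h1
  refine h1 b fun σ τ W k l e => ?_
  rw [to_basePt_ext l k] at e ⊢
  by_cases hW : Nonempty W.left
  · obtain ⟨x⟩ := hW
    obtain ⟨ρ, -⟩ := exists_sectionHom W x
    have h2 : ρ ≫ k = 𝟙 _ := to_basePt_ext _ _
    have h3 : σ = τ := by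
      have := congrArg (ρ ≫ ·) e
      simpa only [← Category.assoc, h2, Category.id_comp] using this
    rw [h3]
  · have := not_nonempty_iff.1 hW
    have : Subsingleton Γ(W.left, ⊤) := inferInstance
    exact this.elim _ _

lemma function_ext {U : T.Etale} {s s' : Γ(U.left, ⊤)}
    (h : ∀ σ : basePt T ⟶ U, σ.left.appTop s = σ.left.appTop s') : s = s' :=
  (existsUnique_function U fun σ => σ.left.appTop s').unique h fun _ => rfl

variable {Q : Type u} [CommMonoid Q]

/-- The étale sheaf of monoids with stalk `Γ(T, 𝒪)ˣ × Q` on a strict point `T`. -/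
noncomputable def pointPresheaf (T : Scheme.{u}) (Q : Type u) [CommMonoid Q] :
    T.Etaleᵒᵖ ⥤ CommMonCat.{u} where
  obj U := CommMonCat.of ((basePt T ⟶ U.unop) → Γ(T, ⊤)ˣ × Q)
  map h := CommMonCat.ofHom
    { toFun := fun m σ => m (σ ≫ h.unop)
      map_one' := rfl
      map_mul' := fun _ _ => rfl }

/-- The value of a section at a section `σ : T ⟶ U`. -/
def pointEval {U : T.Etale} (σ : basePt T ⟶ U) :
    (pointPresheaf T Q).obj (op U) →* Γ(T, ⊤)ˣ × Q :=
  Pi.evalMonoidHom (fun _ : basePt T ⟶ U => Γ(T, ⊤)ˣ × Q) σ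

lemma pointPresheaf_isSheaf :
    Presieve.IsSheaf T.smallEtaleTopology (pointPresheaf T Q ⋙ forget CommMonCat.{u}) := by
  intro U S hS x hx
  rw [Presieve.compatible_iff_sieveCompatible] at hx
  let x' (W : T.Etale) (h : W ⟶ U) (hh : S h) : (basePt T ⟶ W) → Γ(T, ⊤)ˣ × Q := x h hh
  have hx' (W : T.Etale) (h : W ⟶ U) (hh : S h) (ρ : basePt T ⟶ W) :
      x' _ (ρ ≫ h) (S.downward_closed hh ρ) (𝟙 _) = x' W h hh ρ := by
    refine (congrFun (hx h ρ hh) (𝟙 (basePt T))).trans ?_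
    exact congrArg (x' W h hh) (Category.id_comp ρ)
  refine ⟨fun σ => x' _ σ (sieve_sectionHom hS σ) (𝟙 _), fun W h hh => funext fun ρ => ?_,
    fun t ht => funext fun σ => ?_⟩
  · exact hx' W h hh ρ
  · refine Eq.trans ?_ (congrFun (ht σ (sieve_sectionHom hS σ)) (𝟙 (basePt T)))
    exact congrArg t (Category.id_comp σ).symm

/-- The structure map `Γ(T, 𝒪)ˣ × Q → Γ(T, 𝒪)`. -/
noncomputable def stalkα (β : Q →* Γ(T, ⊤)) : Γ(T, ⊤)ˣ × Q →* Γ(T, ⊤) :=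
  (Units.coeHom Γ(T, ⊤)).coprod β

lemma stalkα_apply (β : Q →* Γ(T, ⊤)) (p : Γ(T, ⊤)ˣ × Q) : stalkα β p = p.1 * β p.2 := rfl

/-- The function with values `stalkα β (m σ)`. -/
noncomputable def pointα (β : Q →* Γ(T, ⊤)) (U : T.Etale) :
    (pointPresheaf T Q).obj (op U) →* Γ(U.left, ⊤) where
  toFun m := (existsUnique_function U fun σ => stalkα β (pointEval σ m)).choose
  map_one' := by
    refine function_ext fun σ => ?_
    rw [(existsUnique_function U fun σ => stalkα β (pointEval σ _)).choose_spec.1]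
    simp only [map_one]
    rfl
  map_mul' m n := by
    refine function_ext fun σ => ?_
    rw [map_mul σ.left.appTop.hom,
      (existsUnique_function U fun σ => stalkα β (pointEval σ _)).choose_spec.1,
      (existsUnique_function U fun σ => stalkα β (pointEval σ _)).choose_spec.1,
      (existsUnique_function U fun σ => stalkα β (pointEval σ _)).choose_spec.1, map_mul, map_mul]
    rfl

lemma appTop_pointα (β : Q →* Γ(T, ⊤)) (U : T.Etale) (m : (pointPresheaf T Q).obj (op U))
    (σ : basePt T ⟶ U) : σ.left.appTop (pointα β U m) = stalkα β (pointEval σ m) :=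
  (existsUnique_function U fun σ => stalkα β (pointEval σ m)).choose_spec.1 σ

lemma stalkα_injOn_unit {β : Q →* Γ(T, ⊤)} (hβ : ∀ q, IsUnit (β q) → q = 1)
    {p : Γ(T, ⊤)ˣ × Q} {v : Γ(T, ⊤)ˣ} (h : stalkα β p = v) : p = (v, 1) := by
  obtain ⟨w, q⟩ := p
  rw [stalkα_apply] at h
  have h1 : q = 1 := hβ q (isUnit_of_mul_isUnit_right (h ▸ v.isUnit))
  subst h1
  rw [map_one, mul_one] at h
  exact Prod.ext (Units.ext h) rfl

/-- The log structure on a strict point `T` associated with `β : Q → Γ(T, 𝒪)`, for a monoid `Q`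
in which only `1` becomes invertible. All étale sheaves on `T` are determined by their sections
over `T`, so no sheafification is needed. -/
noncomputable def pointLogStructure (β : Q →* Γ(T, ⊤)) (hβ : ∀ q, IsUnit (β q) → q = 1) :
    LogStructure T where
  presheaf := pointPresheaf T Q
  isSheaf := pointPresheaf_isSheaf
  α := pointα β
  α_naturality {U V} h m := by
    refine function_ext fun σ => ?_
    rw [appTop_pointα]
    have : σ.left.appTop (h.left.appTop (pointα β V m)) = (σ ≫ h).left.appTop (pointα β V m) := by
      rw [comp_left', Scheme.Hom.comp_appTop]
      rfl
    rw [this, appTop_pointα]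
    rfl
  existsUnique_of_isUnit U s hs := by
    let v (σ : basePt T ⟶ U) : Γ(T, ⊤)ˣ := (hs.map σ.left.appTop.hom).unit
    refine ⟨fun σ => (v σ, 1), function_ext fun σ => ?_, fun m hm => funext fun σ => ?_⟩
    · refine (appTop_pointα β U _ σ).trans ?_
      change (v σ : Γ(T, ⊤)) * β 1 = _
      rw [map_one, mul_one]
      rfl
    · refine stalkα_injOn_unit (p := pointEval σ m) hβ ?_
      rw [← appTop_pointα, hm]
      rfl

/-- The log point defined by `β : Q → Γ(T, 𝒪)`. -/
noncomputable abbrev logPoint (β : Q →* Γ(T, ⊤)) (hβ : ∀ q, IsUnit (β q) → q = 1) : LogScheme.{u} :=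
  ⟨T, pointLogStructure β hβ⟩

variable {β : Q →* Γ(T, ⊤)} {hβ : ∀ q, IsUnit (β q) → q = 1}

namespace LogPoint

/-- The value in `Γ(T, 𝒪)ˣ × Q` of a section of the log structure of a log point. -/
noncomputable def eval {U : T.Etale} (σ : basePt T ⟶ U) :
    (logPoint β hβ).sections U →* Γ(T, ⊤)ˣ × Q :=
  pointEval σ

/-- The section of the log structure of a log point with given values. -/
def mk {U : T.Etale} (m : (basePt T ⟶ U) → Γ(T, ⊤)ˣ × Q) : (logPoint β hβ).sections U := m

lemma eval_mk {U : T.Etale} (m : (basePt T ⟶ U) → Γ(T, ⊤)ˣ × Q) (σ : basePt T ⟶ U) :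
    eval σ (mk m : (logPoint β hβ).sections U) = m σ := rfl

lemma ext {U : T.Etale} {m m' : (logPoint β hβ).sections U}
    (h : ∀ σ : basePt T ⟶ U, eval σ m = eval σ m') : m = m' :=
  funext h

lemma eval_res {U V : T.Etale} (h : U ⟶ V) (σ : basePt T ⟶ U) (m : (logPoint β hβ).sections V) :
    eval σ ((logPoint β hβ).res h m) = eval (σ ≫ h) m := rfl

lemma appTop_α {U : T.Etale} (σ : basePt T ⟶ U) (m : (logPoint β hβ).sections U) :
    σ.left.appTop ((logPoint β hβ).α U m) = stalkα β (eval σ m) :=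
  appTop_pointα β U m σ

lemma eval_snd_of_isUnit {U : T.Etale} {w : (logPoint β hβ).sections U} (hw : IsUnit w)
    (σ : basePt T ⟶ U) : (eval σ w).2 = 1 :=
  hβ _ (((hw.map (eval σ)).map (MonoidHom.snd _ _)).map β)

lemma isUnit_mk {U : T.Etale} (v : (basePt T ⟶ U) → Γ(T, ⊤)ˣ) :
    IsUnit (mk (fun σ => (v σ, 1)) : (logPoint β hβ).sections U) :=
  IsUnit.of_mul_eq_one (mk fun σ => ((v σ)⁻¹, 1)) <| by
    refine ext fun σ => ?_
    rw [map_mul, eval_mk, eval_mk, map_one]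
    ext <;> simp

/-- The constant sections `(1, q)`. -/
noncomputable def const (U : T.Etale) : Q →* (logPoint β hβ).sections U where
  toFun q := mk fun _ => (1, q)
  map_one' := rfl
  map_mul' p q := ext fun σ => by simp [eval_mk]

lemma eval_const {U : T.Etale} (σ : basePt T ⟶ U) (q : Q) :
    eval σ (const U q : (logPoint β hβ).sections U) = (1, q) := rfl

lemma basePt_end (σ : basePt T ⟶ basePt T) : σ = 𝟙 _ := to_basePt_ext _ _

lemma isFine [IsCancelMul Q] [Monoid.FG Q] : (logPoint β hβ).IsFine := by
  intro x
  refine ⟨basePt T, x, Q, inferInstance, const (basePt T), rfl, inferInstance, inferInstance, ?_⟩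
  constructor
  · intro W h m y
    obtain ⟨σ, hσ⟩ := exists_sectionHom (T := T) W y
    refine ⟨basePt T, σ, x, (eval σ m).2, mk fun _ => ((eval σ m).1, 1), hσ x, isUnit_mk _,
      ext fun ρ => ?_⟩
    rw [map_mul, eval_res, eval_res, eval_const, eval_mk, basePt_end ρ, Category.id_comp]
    ext <;> simp
  · intro W h p q w hw e y
    obtain ⟨σ, hσ⟩ := exists_sectionHom (T := T) W y
    have e1 := congrArg (eval σ) e
    rw [map_mul, eval_res, eval_res, eval_const, eval_const] at e1
    have h2 := eval_snd_of_isUnit hw σ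
    have e2 := congrArg Prod.snd e1
    have e3 := congrArg Prod.fst e1
    simp only [Prod.fst_mul, Prod.snd_mul, h2, one_mul, mul_one] at e2 e3
    refine ⟨basePt T, σ, x, 1, 1, hσ x, ?_, ?_, by rw [e2], ext fun ρ => ?_⟩
    · rw [map_one, map_one]; exact isUnit_one
    · rw [map_one, map_one]; exact isUnit_one
    · rw [map_one, map_one, mul_one, eval_res, basePt_end ρ, Category.id_comp, map_one]
      exact Prod.ext e3 h2.symm

end LogPoint

end StrictPoint

/-! ### Morphisms from log points -/

section Refinement

variable {X : Scheme.{u}} {T : Scheme.{u}}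

/-- Two étale neighbourhoods of a `T`-point over a common one have a common refinement. -/
lemma exists_common_refinement {V V₁ V₂ : X.Etale} (k₁ : V₁ ⟶ V) (k₂ : V₂ ⟶ V)
    (τ₁ : T ⟶ V₁.left) (τ₂ : T ⟶ V₂.left) (e : τ₁ ≫ k₁.left = τ₂ ≫ k₂.left) :
    ∃ (V₃ : X.Etale) (p₁ : V₃ ⟶ V₁) (p₂ : V₃ ⟶ V₂) (τ : T ⟶ V₃.left),
      p₁ ≫ k₁ = p₂ ≫ k₂ ∧ τ ≫ p₁.left = τ₁ ∧ τ ≫ p₂.left = τ₂ := by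
  let V₃ : X.Etale := Scheme.Etale.mk (pullback.fst k₁.left k₂.left ≫ V₁.hom)
  let p₁ : V₃ ⟶ V₁ := MorphismProperty.Over.homMk (pullback.fst k₁.left k₂.left) rfl
  let p₂ : V₃ ⟶ V₂ := MorphismProperty.Over.homMk (pullback.snd k₁.left k₂.left) (by
    change pullback.snd k₁.left k₂.left ≫ V₂.hom = pullback.fst k₁.left k₂.left ≫ V₁.hom
    have h1 := left_hom k₁
    have h2 := left_hom k₂
    calc _ = pullback.snd k₁.left k₂.left ≫ k₂.left ≫ V.hom := congrArg _ h2.symm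
      _ = pullback.fst k₁.left k₂.left ≫ k₁.left ≫ V.hom := pullback.condition_assoc _ |>.symm
      _ = _ := congrArg _ h1)
  refine ⟨V₃, p₁, p₂, pullback.lift τ₁ τ₂ e, etale_hom_ext pullback.condition,
    pullback.lift_fst _ _ _, pullback.lift_snd _ _ _⟩

/-- Two `S`-morphisms to an étale `S`-scheme agree on an open subscheme, through which every
`T`-point at which they agree factors. -/
lemma exists_equalizing_etale {S U V : Scheme.{u}} (p : U ⟶ S) [Etale p] (l₁ l₂ : V ⟶ U)
    (h : l₁ ≫ p = l₂ ≫ p) (τ : T ⟶ V) (e : τ ≫ l₁ = τ ≫ l₂) :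
    ∃ (V' : Scheme.{u}) (k : V' ⟶ V) (_ : Etale k) (τ' : T ⟶ V'),
      k ≫ l₁ = k ≫ l₂ ∧ τ' ≫ k = τ := by
  have h1 : pullback.fst (pullback.lift l₁ l₂ h) (pullback.diagonal p) ≫ l₁ =
      pullback.snd (pullback.lift l₁ l₂ h) (pullback.diagonal p) := by
    have := congrArg (· ≫ pullback.fst p p)
      (pullback.condition (f := pullback.lift l₁ l₂ h) (g := pullback.diagonal p))
    simpa only [Category.assoc, pullback.lift_fst, pullback.diagonal_fst, Category.comp_id]
      using this
  have h2 : pullback.fst (pullback.lift l₁ l₂ h) (pullback.diagonal p) ≫ l₂ =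
      pullback.snd (pullback.lift l₁ l₂ h) (pullback.diagonal p) := by
    have := congrArg (· ≫ pullback.snd p p)
      (pullback.condition (f := pullback.lift l₁ l₂ h) (g := pullback.diagonal p))
    simpa only [Category.assoc, pullback.lift_snd, pullback.diagonal_snd, Category.comp_id]
      using this
  refine ⟨_, pullback.fst (pullback.lift l₁ l₂ h) (pullback.diagonal p), inferInstance,
    pullback.lift τ (τ ≫ l₁) ?_, h1.trans h2.symm, pullback.lift_fst _ _ _⟩
  apply pullback.hom_ext
  · simp only [Category.assoc, pullback.lift_fst, pullback.diagonal_fst, Category.comp_id]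
  · simp only [Category.assoc, pullback.lift_snd, pullback.diagonal_snd, Category.comp_id, e]

/-- Two morphisms between étale neighbourhoods of a `T`-point agree on a smaller one. -/
lemma exists_equalizing_refinement {V U : X.Etale} (l₁ l₂ : V ⟶ U) (τ : T ⟶ V.left)
    (e : τ ≫ l₁.left = τ ≫ l₂.left) :
    ∃ (V' : X.Etale) (k : V' ⟶ V) (τ' : T ⟶ V'.left), k ≫ l₁ = k ≫ l₂ ∧ τ' ≫ k.left = τ := by
  obtain ⟨V', k, hk, τ', h1, h2⟩ := exists_equalizing_etale U.hom l₁.left l₂.left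
    ((left_hom l₁).trans (left_hom l₂).symm) τ e
  exact ⟨Scheme.Etale.mk (k ≫ V.hom), MorphismProperty.Over.homMk k rfl, τ', etale_hom_ext h1, h2⟩

lemma appTop_comp_apply {S U V : Scheme.{u}} (f : S ⟶ U) (g : U ⟶ V) (s : Γ(V, ⊤)) :
    (f ≫ g).appTop s = f.appTop (g.appTop s) := by
  rw [Scheme.Hom.comp_appTop]
  rfl

lemma appTop_id_apply {S : Scheme.{u}} (s : Γ(S, ⊤)) : Scheme.Hom.appTop (𝟙 S) s = s := by
  simp

end Refinement

namespace LogPoint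

section Hom

variable {T : Scheme.{u}} [IsStrictPoint T] {Q : Type u} [CommMonoid Q] {β : Q →* Γ(T, ⊤)}
  {hβ : ∀ q, IsUnit (β q) → q = 1} {X : LogScheme.{u}}

/-- A morphism from a log point to `X` is given by a morphism `f` of schemes and compatible
homomorphisms `M_X(V) → Γ(T, 𝒪)ˣ × Q` for all étale neighbourhoods `V` of the `T`-point `f`. -/
noncomputable def homOfStalk (f : T ⟶ X.scheme)
    (θ : ∀ (V : X.scheme.Etale) (τ : T ⟶ V.left), τ ≫ V.hom = f →
      X.sections V →* Γ(T, ⊤)ˣ × Q)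
    (hres : ∀ (V W : X.scheme.Etale) (k : V ⟶ W) (τ : T ⟶ V.left) (hτ : τ ≫ V.hom = f)
      (τ' : T ⟶ W.left) (hτ' : τ' ≫ W.hom = f) (_ : τ ≫ k.left = τ') (m : X.sections W),
      θ V τ hτ (X.res k m) = θ W τ' hτ' m)
    (hα : ∀ (V : X.scheme.Etale) (τ : T ⟶ V.left) (hτ : τ ≫ V.hom = f) (m : X.sections V),
      stalkα β (θ V τ hτ m) = τ.appTop (X.α V m)) :
    logPoint β hβ ⟶ X where
  base := f
  app U V g hg :=
    have h (σ : basePt T ⟶ U) : (σ.left ≫ g) ≫ V.hom = f := by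
      refine (Category.assoc _ _ _).trans ((congrArg (σ.left ≫ ·) hg).trans ?_)
      refine (Category.assoc _ _ _).symm.trans ((congrArg (· ≫ f) (basePt_w σ)).trans ?_)
      exact Category.id_comp f
    { toFun := fun m => mk fun σ => θ V (σ.left ≫ g) (h σ) m
      map_one' := ext fun σ => (map_one (θ V (σ.left ≫ g) (h σ))).trans (map_one (eval σ)).symm
      map_mul' := fun m n => ext fun σ => map_mul (θ V (σ.left ≫ g) (h σ)) m n }
  res_app_res {U' U V V'} a k g hg g' hg' e m := by
    refine ext fun σ => ?_
    refine hres V V' k _ _ _ _ ?_ m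
    subst e
    change ((σ.left ≫ a.left) ≫ g) ≫ k.left = _
    simp only [Category.assoc]
    rfl
  α_app U V g hg m := by
    refine function_ext fun σ => ?_
    refine (appTop_α (hβ := hβ) σ _).trans ((hα _ _ _ _).trans ?_)
    exact appTop_comp_apply σ.left g _

/-- The homomorphism `M_X(V) → Γ(T, 𝒪)ˣ × Q` induced by a morphism from a log point to `X` on an
étale neighbourhood `V`. -/
noncomputable def stalkMap (g : logPoint β hβ ⟶ X) (V : X.scheme.Etale) (τ : T ⟶ V.left)
    (hτ : τ ≫ V.hom = g.base) : X.sections V →* Γ(T, ⊤)ˣ × Q :=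
  (eval (𝟙 (basePt T))).comp (g.app (basePt T) V τ (hτ.trans (Category.id_comp _).symm))

lemma stalkMap_homOfStalk (f : T ⟶ X.scheme) (θ hres hα) (V : X.scheme.Etale) (τ : T ⟶ V.left)
    (hτ : τ ≫ V.hom = f) (m : X.sections V) :
    stalkMap (homOfStalk (β := β) (hβ := hβ) f θ hres hα) V τ hτ m = θ V τ hτ m := by
  change θ V (𝟙 T ≫ τ) _ m = _
  congr 2

lemma eval_app (g : logPoint β hβ ⟶ X) (U : T.Etale) (V : X.scheme.Etale) (a : U.left ⟶ V.left)
    (ha : a ≫ V.hom = U.hom ≫ g.base) (σ : basePt T ⟶ U) (τ : T ⟶ V.left)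
    (hτ : τ ≫ V.hom = g.base) (e : σ.left ≫ a = τ) (m : X.sections V) :
    eval σ (g.app U V a ha m) = stalkMap g V τ hτ m := by
  have h1 := LogScheme.Hom.res_app g (U' := basePt T) (U := U) σ a ha τ
    (hτ.trans (Category.id_comp _).symm) e.symm m
  have h2 := congrArg (eval (hβ := hβ) (𝟙 (basePt T))) h1
  refine Eq.trans ?_ h2
  change eval σ _ = eval (𝟙 _ ≫ σ) _
  rw [Category.id_comp]
  rfl

lemma hom_ext {g g' : logPoint β hβ ⟶ X} (hb : g.base = g'.base)
    (h : ∀ (V : X.scheme.Etale) (τ : T ⟶ V.left) (hτ : τ ≫ V.hom = g.base)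
      (hτ' : τ ≫ V.hom = g'.base) (m : X.sections V),
      stalkMap g V τ hτ m = stalkMap g' V τ hτ' m) : g = g' := by
  refine LogScheme.Hom.ext' hb fun U V a ha hb' m => ext fun σ => ?_
  have e : (σ.left ≫ a) ≫ V.hom = g.base := by
    refine (Category.assoc _ _ _).trans ((congrArg (σ.left ≫ ·) ha).trans ?_)
    refine (Category.assoc _ _ _).symm.trans ((congrArg (· ≫ g.base) (basePt_w σ)).trans ?_)
    exact Category.id_comp _
  rw [eval_app g U V a ha σ (σ.left ≫ a) e rfl,
    eval_app g' U V a hb' σ (σ.left ≫ a) (e.trans hb) rfl]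
  exact h _ _ _ _ _

lemma stalkα_stalkMap (g : logPoint β hβ ⟶ X) (V : X.scheme.Etale) (τ : T ⟶ V.left)
    (hτ : τ ≫ V.hom = g.base) (m : X.sections V) :
    stalkα β (stalkMap g V τ hτ m) = τ.appTop (X.α V m) := by
  refine (appTop_α (hβ := hβ) (𝟙 (basePt T)) _).symm.trans ?_
  refine Eq.trans ?_ (g.α_app (basePt T) V τ (hτ.trans (Category.id_comp _).symm) m)
  exact (appTop_id_apply _).symm

lemma stalkMap_comp {Y : LogScheme.{u}} (g : logPoint β hβ ⟶ X) (p : X ⟶ Y) (V : Y.scheme.Etale)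
    (W : X.scheme.Etale) (a : T ⟶ W.left) (ha : a ≫ W.hom = g.base) (q : W.left ⟶ V.left)
    (hq : q ≫ V.hom = W.hom ≫ p.base) (τ : T ⟶ V.left) (hτ : τ ≫ V.hom = (g ≫ p).base)
    (e : a ≫ q = τ) (m : Y.sections V) :
    stalkMap (g ≫ p) V τ hτ m = stalkMap g W a ha (p.app W V q hq m) :=
  congrArg (eval (hβ := hβ) (𝟙 (basePt T)))
    (LogScheme.Hom.compApp_eq g p (U := basePt T) τ (hτ.trans (Category.id_comp _).symm) a
      (ha.trans (Category.id_comp _).symm) q hq e m).symm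

lemma stalkMap_id {V : T.Etale} (σ : basePt T ⟶ V) (hσ) (m : (logPoint β hβ).sections V) :
    stalkMap (𝟙 (logPoint β hβ)) V σ.left hσ m = eval σ m := by
  change eval (𝟙 _ ≫ _) m = eval σ m
  rw [Category.id_comp]
  rfl

/-- The image in `Γ(T, 𝒪)ˣ × Q` of a unit of `M_X(V)`. -/
noncomputable def unitStalk {V : X.scheme.Etale} (τ : T ⟶ V.left) :
    (X.sections V)ˣ →* Γ(T, ⊤)ˣ × Q :=
  (MonoidHom.inl _ _).comp
    (Units.map ((τ.appTop.hom : Γ(V.left, ⊤) →* Γ(T, ⊤)).comp (X.α V)))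

lemma unitStalk_fst {V : X.scheme.Etale} (τ : T ⟶ V.left) (w : (X.sections V)ˣ) :
    (((unitStalk τ w : Γ(T, ⊤)ˣ × Q).1 : Γ(T, ⊤)ˣ) : Γ(T, ⊤)) = τ.appTop (X.α V w) := rfl

lemma unitStalk_eq (hβ : ∀ q, IsUnit (β q) → q = 1) {V : X.scheme.Etale} (τ : T ⟶ V.left)
    (w : (X.sections V)ˣ) {p : Γ(T, ⊤)ˣ × Q}
    (h : stalkα β p = τ.appTop (X.α V w)) : p = unitStalk τ w :=
  stalkα_injOn_unit hβ (v := (unitStalk τ w : Γ(T, ⊤)ˣ × Q).1) h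

lemma unitStalk_res {V W : X.scheme.Etale} (k : V ⟶ W) (τ : T ⟶ V.left) (τ' : T ⟶ W.left)
    (e : τ ≫ k.left = τ') (w : (X.sections W)ˣ) :
    (unitStalk τ (Units.map (X.res k) w) : Γ(T, ⊤)ˣ × Q) = unitStalk τ' w := by
  refine Prod.ext (Units.ext ?_) rfl
  rw [unitStalk_fst, unitStalk_fst, ← e, Scheme.Hom.comp_appTop]
  exact congrArg τ.appTop (X.logStructure.α_res k w)

lemma stalkα_unitStalk {V : X.scheme.Etale} (τ : T ⟶ V.left) (w : (X.sections V)ˣ) :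
    stalkα β (unitStalk τ w) = τ.appTop (X.α V w) := by
  rw [stalkα_apply]
  change ((unitStalk τ w : Γ(T, ⊤)ˣ × Q).1 : Γ(T, ⊤)) * β 1 = _
  rw [map_one, mul_one, unitStalk_fst]

/-- A germ relation generating a morphism from a log point to `X` over `f`: a set `rel` of pairs
of a section of `M_X` and its prescribed image in `Γ(T, 𝒪)ˣ × Q`, such that near `f` every section
of `M_X` is a unit times a section from the set, and the prescriptions agree with each other and
with the structure maps. -/
structure Generators (β : Q →* Γ(T, ⊤)) (X : LogScheme.{u}) (f : T ⟶ X.scheme) where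
  rel (V : X.scheme.Etale) (τ : T ⟶ V.left) : X.sections V → Γ(T, ⊤)ˣ × Q → Prop
  exists_rel (V : X.scheme.Etale) (τ : T ⟶ V.left) (hτ : τ ≫ V.hom = f) (m : X.sections V) :
    ∃ (V' : X.scheme.Etale) (k : V' ⟶ V) (τ' : T ⟶ V'.left) (n : X.sections V')
      (w : (X.sections V')ˣ) (s : Γ(T, ⊤)ˣ × Q), τ' ≫ k.left = τ ∧ rel V' τ' n s ∧
        X.res k m = w * n
  rel_unique (V : X.scheme.Etale) (τ : T ⟶ V.left) (hτ : τ ≫ V.hom = f) (n n' : X.sections V)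
    (s s' : Γ(T, ⊤)ˣ × Q) (w : (X.sections V)ˣ) : rel V τ n s → rel V τ n' s' → n = w * n' →
      s = unitStalk τ w * s'
  rel_res (V W : X.scheme.Etale) (k : V ⟶ W) (τ : T ⟶ V.left) (τ' : T ⟶ W.left)
    (e : τ ≫ k.left = τ') (hτ : τ' ≫ W.hom = f) (n : X.sections W) (s : Γ(T, ⊤)ˣ × Q) :
    rel W τ' n s → rel V τ (X.res k n) s
  rel_mul (V : X.scheme.Etale) (τ : T ⟶ V.left) (hτ : τ ≫ V.hom = f) (n n' : X.sections V)
    (s s' : Γ(T, ⊤)ˣ × Q) : rel V τ n s → rel V τ n' s' →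
      ∃ (V' : X.scheme.Etale) (k : V' ⟶ V) (τ' : T ⟶ V'.left), τ' ≫ k.left = τ ∧
        rel V' τ' (X.res k (n * n')) (s * s')
  stalkα_rel (V : X.scheme.Etale) (τ : T ⟶ V.left) (hτ : τ ≫ V.hom = f) (n : X.sections V)
    (s : Γ(T, ⊤)ˣ × Q) : rel V τ n s → stalkα β s = τ.appTop (X.α V n)

namespace Generators

variable {f : T ⟶ X.scheme} (G : Generators β X f)

/-- The graph of the homomorphism `M_X(V) → Γ(T, 𝒪)ˣ × Q` defined by a germ relation. -/
def graph (V : X.scheme.Etale) (τ : T ⟶ V.left) (m : X.sections V) (s : Γ(T, ⊤)ˣ × Q) : Prop :=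
  ∃ (V' : X.scheme.Etale) (k : V' ⟶ V) (τ' : T ⟶ V'.left) (n : X.sections V')
    (w : (X.sections V')ˣ) (t : Γ(T, ⊤)ˣ × Q), τ' ≫ k.left = τ ∧ G.rel V' τ' n t ∧
      X.res k m = w * n ∧ s = unitStalk τ' w * t

lemma hom_of_left {V V' : X.scheme.Etale} (k : V' ⟶ V) {τ' : T ⟶ V'.left} {τ : T ⟶ V.left}
    (e : τ' ≫ k.left = τ) (hτ : τ ≫ V.hom = f) : τ' ≫ V'.hom = f := by
  rw [← hτ, ← e]
  exact (congrArg (τ' ≫ ·) (left_hom k)).symm.trans (Category.assoc _ _ _).symm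

lemma exists_graph (V : X.scheme.Etale) (τ : T ⟶ V.left) (hτ : τ ≫ V.hom = f)
    (m : X.sections V) : ∃ s, G.graph V τ m s := by
  obtain ⟨V', k, τ', n, w, s, h1, h2, h3⟩ := G.exists_rel V τ hτ m
  exact ⟨_, V', k, τ', n, w, s, h1, h2, h3, rfl⟩

lemma graph_unique {V : X.scheme.Etale} {τ : T ⟶ V.left} (hτ : τ ≫ V.hom = f)
    {m : X.sections V} {s s' : Γ(T, ⊤)ˣ × Q} (h : G.graph V τ m s) (h' : G.graph V τ m s') :
    s = s' := by
  obtain ⟨V₁, k₁, τ₁, n₁, w₁, t₁, e₁, r₁, a₁, rfl⟩ := h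
  obtain ⟨V₂, k₂, τ₂, n₂, w₂, t₂, e₂, r₂, a₂, rfl⟩ := h'
  obtain ⟨V₃, p₁, p₂, τ₃, e, c₁, c₂⟩ := exists_common_refinement k₁ k₂ τ₁ τ₂ (e₁.trans e₂.symm)
  have b₁ := G.rel_res _ _ p₁ τ₃ τ₁ c₁ (hom_of_left k₁ e₁ hτ) _ _ r₁
  have b₂ := G.rel_res _ _ p₂ τ₃ τ₂ c₂ (hom_of_left k₂ e₂ hτ) _ _ r₂
  have d : X.res p₁ (w₁ * n₁) = X.res p₂ (w₂ * n₂) := by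
    rw [← a₁, ← a₂]
    refine (X.logStructure.res_res _ _ _).trans (Eq.trans ?_ (X.logStructure.res_res _ _ _).symm)
    rw [e]
  rw [map_mul, map_mul] at d
  have := G.rel_unique V₃ τ₃ (hom_of_left p₁ c₁ (hom_of_left k₁ e₁ hτ)) _ _ _ _
    ((Units.map (X.res p₁) w₁)⁻¹ * Units.map (X.res p₂) w₂) b₁ b₂ (by
      rw [Units.val_mul, mul_assoc, Units.eq_inv_mul_iff_mul_eq]
      exact d)
  rw [this, ← unitStalk_res p₁ τ₃ τ₁ c₁ w₁, ← unitStalk_res p₂ τ₃ τ₂ c₂ w₂, ← mul_assoc,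
    ← map_mul, mul_inv_cancel_left]

lemma graph_res {V W : X.scheme.Etale} (k : V ⟶ W) {τ : T ⟶ V.left} {τ' : T ⟶ W.left}
    (e : τ ≫ k.left = τ') {m : X.sections W} {s : Γ(T, ⊤)ˣ × Q} (h : G.graph V τ (X.res k m) s) :
    G.graph W τ' m s := by
  obtain ⟨V₁, k₁, τ₁, n₁, w₁, t₁, e₁, r₁, a₁, rfl⟩ := h
  refine ⟨V₁, k₁ ≫ k, τ₁, n₁, w₁, t₁, ?_, r₁, ?_, rfl⟩
  · rw [comp_left', ← Category.assoc, e₁, e]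
  · rw [← a₁]
    exact (X.logStructure.res_res _ _ _).symm

lemma graph_mul {V : X.scheme.Etale} {τ : T ⟶ V.left} (hτ : τ ≫ V.hom = f)
    {m m' : X.sections V} {s s' : Γ(T, ⊤)ˣ × Q} (h : G.graph V τ m s) (h' : G.graph V τ m' s') :
    G.graph V τ (m * m') (s * s') := by
  obtain ⟨V₁, k₁, τ₁, n₁, w₁, t₁, e₁, r₁, a₁, rfl⟩ := h
  obtain ⟨V₂, k₂, τ₂, n₂, w₂, t₂, e₂, r₂, a₂, rfl⟩ := h'
  obtain ⟨V₃, p₁, p₂, τ₃, e, c₁, c₂⟩ := exists_common_refinement k₁ k₂ τ₁ τ₂ (e₁.trans e₂.symm)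
  have hτ₁ := hom_of_left k₁ e₁ hτ
  have b₁ := G.rel_res _ _ p₁ τ₃ τ₁ c₁ hτ₁ _ _ r₁
  have b₂ := G.rel_res _ _ p₂ τ₃ τ₂ c₂ (hom_of_left k₂ e₂ hτ) _ _ r₂
  obtain ⟨V₄, l, τ₄, c, r⟩ := G.rel_mul V₃ τ₃ (hom_of_left p₁ c₁ hτ₁) _ _ _ _ b₁ b₂
  refine ⟨V₄, l ≫ p₁ ≫ k₁, τ₄, _, Units.map (X.res l) (Units.map (X.res p₁) w₁ *
    Units.map (X.res p₂) w₂), _, ?_, r, ?_, ?_⟩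
  · rw [comp_left', comp_left', ← Category.assoc, c, ← Category.assoc, c₁, e₁]
  · have h1 : X.res (l ≫ p₁ ≫ k₁) m = X.res l (X.res p₁ (X.res k₁ m)) :=
      ((congrArg (X.res l) (X.logStructure.res_res _ _ _)).trans
        (X.logStructure.res_res _ _ _)).symm
    have h2 : X.res (l ≫ p₁ ≫ k₁) m' = X.res l (X.res p₂ (X.res k₂ m')) := by
      rw [e]
      exact ((congrArg (X.res l) (X.logStructure.res_res _ _ _)).trans
        (X.logStructure.res_res _ _ _)).symm
    rw [map_mul, h1, h2, a₁, a₂]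
    simp only [map_mul, Units.val_mul, Units.coe_map]
    rw [mul_mul_mul_comm]
  · rw [unitStalk_res l τ₄ τ₃ c, map_mul, unitStalk_res p₁ τ₃ τ₁ c₁, unitStalk_res p₂ τ₃ τ₂ c₂,
      mul_mul_mul_comm]

lemma stalkα_graph {V : X.scheme.Etale} {τ : T ⟶ V.left} (hτ : τ ≫ V.hom = f)
    {m : X.sections V} {s : Γ(T, ⊤)ˣ × Q} (h : G.graph V τ m s) :
    stalkα β s = τ.appTop (X.α V m) := by
  obtain ⟨V₁, k₁, τ₁, n₁, w₁, t₁, e₁, r₁, a₁, rfl⟩ := h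
  rw [map_mul, G.stalkα_rel V₁ τ₁ (hom_of_left k₁ e₁ hτ) _ _ r₁, stalkα_unitStalk, ← map_mul,
    ← map_mul, ← a₁, ← e₁, Scheme.Hom.comp_appTop]
  exact congrArg τ₁.appTop (X.logStructure.α_res k₁ m)

lemma graph_of_rel {V : X.scheme.Etale} {τ : T ⟶ V.left} {n : X.sections V}
    {s : Γ(T, ⊤)ˣ × Q} (h : G.rel V τ n s) : G.graph V τ n s :=
  ⟨V, 𝟙 V, τ, n, 1, s, Category.comp_id τ, h, by
    rw [Units.val_one, one_mul]
    exact X.logStructure.res_id _ _, by rw [map_one, one_mul]⟩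

/-- The homomorphism `M_X(V) → Γ(T, 𝒪)ˣ × Q` defined by a germ relation. -/
noncomputable def toStalk (hβ : ∀ q, IsUnit (β q) → q = 1) (V : X.scheme.Etale) (τ : T ⟶ V.left)
    (hτ : τ ≫ V.hom = f) : X.sections V →* Γ(T, ⊤)ˣ × Q where
  toFun m := (G.exists_graph V τ hτ m).choose
  map_one' := by
    refine stalkα_injOn_unit hβ (v := 1) ?_
    rw [G.stalkα_graph hτ (G.exists_graph V τ hτ 1).choose_spec, map_one, map_one, Units.val_one]
  map_mul' m n := G.graph_unique hτ (G.exists_graph V τ hτ (m * n)).choose_spec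
    (G.graph_mul hτ (G.exists_graph V τ hτ m).choose_spec (G.exists_graph V τ hτ n).choose_spec)

lemma graph_toStalk (V : X.scheme.Etale) (τ : T ⟶ V.left) (hτ : τ ≫ V.hom = f)
    (m : X.sections V) : G.graph V τ m (G.toStalk hβ V τ hτ m) :=
  (G.exists_graph V τ hτ m).choose_spec

/-- The morphism from a log point defined by a germ relation. -/
noncomputable def hom (hβ : ∀ q, IsUnit (β q) → q = 1) : logPoint β hβ ⟶ X :=
  homOfStalk f (G.toStalk hβ)
    (fun V W k τ hτ τ' hτ' e m => G.graph_unique hτ'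
      (G.graph_res k e (G.graph_toStalk V τ hτ _)) (G.graph_toStalk W τ' hτ' m))
    (fun V τ hτ m => G.stalkα_graph hτ (G.graph_toStalk V τ hτ m))

lemma stalkMap_hom {V : X.scheme.Etale} {τ : T ⟶ V.left} (hτ : τ ≫ V.hom = f)
    {n : X.sections V} {s : Γ(T, ⊤)ˣ × Q} (h : G.rel V τ n s) :
    stalkMap (G.hom hβ) V τ hτ n = s :=
  (stalkMap_homOfStalk _ _ _ _ V τ hτ n).trans
    (G.graph_unique hτ (G.graph_toStalk V τ hτ n) (G.graph_of_rel h))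

end Generators

end Hom

end LogPoint

/-! ### Charts and morphisms from log points -/

/-- The structure morphism to the terminal object of the small étale site. -/
noncomputable def toBase {X : Scheme.{u}} (V : X.Etale) : V ⟶ basePt X :=
  MorphismProperty.Over.homMk V.hom (Category.comp_id _)

/-- Two étale neighbourhoods of a `T`-point have a common refinement. -/
lemma exists_common_neighbourhood {X T : Scheme.{u}} (V₁ V₂ : X.Etale) (τ₁ : T ⟶ V₁.left)
    (τ₂ : T ⟶ V₂.left) (e : τ₁ ≫ V₁.hom = τ₂ ≫ V₂.hom) :
    ∃ (V₃ : X.Etale) (p₁ : V₃ ⟶ V₁) (p₂ : V₃ ⟶ V₂) (τ : T ⟶ V₃.left),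
      τ ≫ p₁.left = τ₁ ∧ τ ≫ p₂.left = τ₂ := by
  obtain ⟨V₃, p₁, p₂, τ, -, h1, h2⟩ := exists_common_refinement (toBase V₁) (toBase V₂) τ₁ τ₂ e
  exact ⟨V₃, p₁, p₂, τ, h1, h2⟩

namespace LogPoint

variable {T : Scheme.{u}} [IsStrictPoint T] {Q : Type u} [CommMonoid Q] {β : Q →* Γ(T, ⊤)}
  {hβ : ∀ q, IsUnit (β q) → q = 1} {X : LogScheme.{u}}

/-- A `T`-point `h` of the domain of a chart `φ : Q → M_X(U₀)`, together with units relating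
`h^* ∘ α ∘ φ` and `β`, generates a morphism from the log point of `β`. -/
noncomputable def chartGenerators (hβ : ∀ q, IsUnit (β q) → q = 1) {U₀ : X.scheme.Etale}
    {φ : Q →* X.sections U₀} (hφ : LogScheme.IsChart φ) (h : T ⟶ U₀.left) (v : Q →* Γ(T, ⊤)ˣ)
    (e : ∀ q, h.appTop (X.α U₀ (φ q)) = v q * β q) : Generators β X (h ≫ U₀.hom) where
  rel V τ n s := ∃ l : V ⟶ U₀, τ ≫ l.left = h ∧ ∃ q, n = X.res l (φ q) ∧ s = (v q, q)
  exists_rel V τ hτ m := by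
    obtain ⟨t⟩ := IsStrictPoint.nonempty (T := T)
    obtain ⟨V₃, p₁, p₂, τ₃, e1, e2⟩ := exists_common_neighbourhood V U₀ τ h hτ
    obtain ⟨W, k, x, q, w, hx, hw, hk⟩ := hφ.locally_surjective V₃ p₂ (X.res p₁ m) (τ₃ t)
    obtain ⟨τ', hτ', -⟩ := IsStrictPoint.exists_lift (T := T) k.left τ₃ x t hx
    refine ⟨W, k ≫ p₁, τ', _, hw.unit, _, ?_, ⟨k ≫ p₂, ?_, q, rfl, rfl⟩, ?_⟩
    · rw [comp_left', ← Category.assoc, hτ', e1]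
    · rw [comp_left', ← Category.assoc, hτ', e2]
    · exact (X.logStructure.res_res _ _ _).symm.trans hk
  rel_unique V τ hτ n n' s s' w := by
    rintro ⟨l, hl, q, rfl, rfl⟩ ⟨l', hl', q', rfl, rfl⟩ hn
    obtain ⟨t⟩ := IsStrictPoint.nonempty (T := T)
    obtain ⟨V', k, τ', hk, hk'⟩ := exists_equalizing_refinement l l' τ (hl.trans hl'.symm)
    have h1 : X.res (k ≫ l) (φ q) = X.res k w * X.res (k ≫ l) (φ q') := by
      have := congrArg (X.res k) hn
      rw [map_mul] at this
      refine (X.logStructure.res_res _ _ _).symm.trans (this.trans ?_)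
      rw [hk]
      exact congrArg _ (X.logStructure.res_res _ _ _)
    obtain ⟨W, k', x, a, b, hx, ha, hb, hab, hw⟩ :=
      hφ.locally_injective V' (k ≫ l) q q' _ (w.isUnit.map _) h1 (τ' t)
    obtain ⟨τ₂, hτ₂, -⟩ := IsStrictPoint.exists_lift (T := T) k'.left τ' x t hx
    have h2 : τ₂ ≫ (k' ≫ k ≫ l).left = h := by
      rw [comp_left', comp_left', ← Category.assoc, hτ₂, ← Category.assoc, hk', hl]
    have key (c : Q) (hc : IsUnit (X.res (k' ≫ k ≫ l) (φ c))) : c = 1 := by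
      have h3 : IsUnit (τ₂.appTop (X.α W (X.res (k' ≫ k ≫ l) (φ c)))) :=
        (hc.map (X.α W)).map τ₂.appTop.hom
      have h4 : τ₂.appTop (X.α W (X.res (k' ≫ k ≫ l) (φ c))) = v c * β c := by
        rw [← e, ← h2, appTop_comp_apply]
        exact congrArg τ₂.appTop (X.logStructure.α_res _ _)
      rw [h4] at h3
      exact hβ c (isUnit_of_mul_isUnit_right h3)
    obtain rfl := key a ha
    obtain rfl := key b hb
    have hqq : q = q' := by simpa using hab
    subst hqq
    simp only [map_one, mul_one] at hw
    have h5 : Units.map (X.res k') (Units.map (X.res k) w) = 1 := Units.ext hw.symm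
    rw [← unitStalk_res k τ' τ hk' w, ← unitStalk_res k' τ₂ τ' hτ₂, h5, map_one, one_mul]
  rel_res V W k τ τ' e' hτ n s := by
    rintro ⟨l, hl, q, rfl, rfl⟩
    refine ⟨k ≫ l, ?_, q, X.logStructure.res_res _ _ _, rfl⟩
    rw [comp_left', ← Category.assoc, e', hl]
  rel_mul V τ hτ n n' s s' := by
    rintro ⟨l, hl, q, rfl, rfl⟩ ⟨l', hl', q', rfl, rfl⟩
    obtain ⟨V', k, τ', hk, hk'⟩ := exists_equalizing_refinement l l' τ (hl.trans hl'.symm)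
    refine ⟨V', k, τ', hk', k ≫ l, ?_, q * q', ?_, ?_⟩
    · rw [comp_left', ← Category.assoc, hk', hl]
    · rw [map_mul, map_mul, map_mul]
      refine congrArg₂ _ (X.logStructure.res_res _ _ _) ?_
      rw [hk]
      exact X.logStructure.res_res _ _ _
    · rw [map_mul]
      rfl
  stalkα_rel V τ hτ n s := by
    rintro ⟨l, hl, q, rfl, rfl⟩
    rw [stalkα_apply]
    refine (e q).symm.trans ?_
    rw [← hl, appTop_comp_apply]
    exact congrArg τ.appTop (X.logStructure.α_res _ _).symm

section Section

variable {U : LogScheme.{u}} (j : U ⟶ logPoint β hβ)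

lemma section_w {V : U.scheme.Etale} {W : T.Etale} {σ₀ : T ⟶ U.scheme}
    (hσ₀ : σ₀ ≫ j.base = 𝟙 T) {τ : T ⟶ V.left} (hτ : τ ≫ V.hom = σ₀) {g : V.left ⟶ W.left}
    (hg : g ≫ W.hom = V.hom ≫ j.base) : (τ ≫ g) ≫ W.hom = 𝟙 T := by
  refine (Category.assoc _ _ _).trans ((congrArg (τ ≫ ·) hg).trans ?_)
  exact (Category.assoc _ _ _).symm.trans ((congrArg (· ≫ j.base) hτ).trans hσ₀)

/-- The germ relation generating the section of a strict étale morphism to a log point over a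
section of the underlying morphism of schemes. -/
def sectionGenerators [Etale j.base] (hj : LogScheme.IsStrict j) (σ₀ : T ⟶ U.scheme)
    (hσ₀ : σ₀ ≫ j.base = 𝟙 T) : Generators β U σ₀ where
  rel V τ n s := ∃ (W : T.Etale) (g : V.left ⟶ W.left) (hg : g ≫ W.hom = V.hom ≫ j.base)
    (n₀ : (logPoint β hβ).sections W), n = j.app V W g hg n₀ ∧
      ∀ ρ : basePt T ⟶ W, ρ.left = τ ≫ g → s = eval ρ n₀
  exists_rel V τ hτ m := by
    obtain ⟨t⟩ := IsStrictPoint.nonempty (T := T)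
    obtain ⟨V', k, x, W, g, hg, n, w, hx, hw, hm⟩ := hj.locally_surjective V m (τ t)
    obtain ⟨τ', hτ', -⟩ := IsStrictPoint.exists_lift (T := T) k.left τ x t hx
    have h1 := section_w j hσ₀ (Generators.hom_of_left k hτ' hτ) hg
    refine ⟨V', k, τ', _, hw.unit, eval (sectionHom (U := W) _ h1) n, hτ',
      ⟨W, g, hg, n, rfl, fun ρ hρ => ?_⟩, hm⟩
    rw [show ρ = sectionHom (U := W) _ h1 from etale_hom_ext hρ]
  rel_unique V τ hτ n n' s s' w := by
    rintro ⟨W₁, g₁, hg₁, n₁, rfl, h₁⟩ ⟨W₂, g₂, hg₂, n₂, rfl, h₂⟩ hn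
    obtain ⟨t⟩ := IsStrictPoint.nonempty (T := T)
    obtain ⟨W₃, p₁, p₂, g₃, e₁, e₂⟩ := exists_common_neighbourhood (X := T) W₁ W₂ g₁ g₂
      (hg₁.trans hg₂.symm)
    have hg₃ : g₃ ≫ W₃.hom = V.hom ≫ j.base := by
      refine Eq.trans ?_ hg₁
      rw [← e₁]
      exact (congrArg (g₃ ≫ ·) (left_hom p₁)).symm.trans (Category.assoc _ _ _).symm
    have a₁ := j.app_res p₁ g₃ hg₃ g₁ hg₁ e₁.symm n₁
    have a₂ := j.app_res p₂ g₃ hg₃ g₂ hg₂ e₂.symm n₂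
    rw [← a₁, ← a₂] at hn
    obtain ⟨V', k, x, W, l, g, hg, v, hx, hl, hv, hv1, hv2⟩ :=
      hj.locally_injective V W₃ g₃ hg₃ _ _ _ w.isUnit hn (τ t)
    obtain ⟨τ', hτ', -⟩ := IsStrictPoint.exists_lift (T := T) k.left τ x t hx
    have c1 := section_w j hσ₀ (Generators.hom_of_left k hτ' hτ) hg
    let ρ : basePt T ⟶ W := sectionHom (U := W) _ c1
    have c2 : (ρ ≫ l).left = τ ≫ g₃ := by
      rw [← hτ']
      refine (Category.assoc _ _ _).trans ((congrArg (τ' ≫ ·) hl).trans ?_)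
      exact (Category.assoc _ _ _).symm
    have b₁ := h₁ ((ρ ≫ l) ≫ p₁) (by
      rw [comp_left', c2, ← e₁]
      exact Category.assoc _ _ _)
    have b₂ := h₂ ((ρ ≫ l) ≫ p₂) (by
      rw [comp_left', c2, ← e₂]
      exact Category.assoc _ _ _)
    have c3 : (eval ((ρ ≫ l) ≫ p₁) n₁ : Γ(T, ⊤)ˣ × Q) = eval ρ v * eval ((ρ ≫ l) ≫ p₂) n₂ := by
      have := congrArg (eval (hβ := hβ) ρ) hv1
      rw [map_mul] at this
      exact this
    rw [b₁, c3, ← b₂]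
    congr 1
    refine unitStalk_eq hβ τ w ?_
    refine (appTop_α (hβ := hβ) ρ v).symm.trans ?_
    have c4 := j.α_app V' W g hg v
    rw [hv2] at c4
    refine (appTop_comp_apply τ' g _).trans ((congrArg τ'.appTop c4.symm).trans ?_)
    rw [← hτ', appTop_comp_apply]
    exact congrArg τ'.appTop (U.logStructure.α_res k w)
  rel_res V V₁ k τ τ' e hτ n s := by
    rintro ⟨W, g, hg, n₀, rfl, h⟩
    have h1 : (k.left ≫ g) ≫ W.hom = V.hom ≫ j.base := by
      refine (Category.assoc _ _ _).trans ((congrArg (k.left ≫ ·) hg).trans ?_)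
      exact (Category.assoc _ _ _).symm.trans (congrArg (· ≫ j.base) (left_hom k))
    refine ⟨W, k.left ≫ g, h1, n₀, j.res_app k g hg _ h1 rfl n₀, fun ρ hρ => h ρ ?_⟩
    rw [hρ, ← e]
    exact (Category.assoc _ _ _).symm
  rel_mul V τ hτ n n' s s' := by
    rintro ⟨W₁, g₁, hg₁, n₁, rfl, h₁⟩ ⟨W₂, g₂, hg₂, n₂, rfl, h₂⟩
    obtain ⟨W₃, p₁, p₂, g₃, e₁, e₂⟩ := exists_common_neighbourhood (X := T) W₁ W₂ g₁ g₂
      (hg₁.trans hg₂.symm)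
    have hg₃ : g₃ ≫ W₃.hom = V.hom ≫ j.base := by
      refine Eq.trans ?_ hg₁
      rw [← e₁]
      exact (congrArg (g₃ ≫ ·) (left_hom p₁)).symm.trans (Category.assoc _ _ _).symm
    have a₁ := j.app_res p₁ g₃ hg₃ g₁ hg₁ e₁.symm n₁
    have a₂ := j.app_res p₂ g₃ hg₃ g₂ hg₂ e₂.symm n₂
    refine ⟨V, 𝟙 V, τ, Category.comp_id τ, W₃, g₃, hg₃,
      (logPoint β hβ).res p₁ n₁ * (logPoint β hβ).res p₂ n₂, ?_, fun ρ hρ => ?_⟩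
    · rw [map_mul (j.app V W₃ g₃ hg₃), a₁, a₂]
      exact U.logStructure.res_id _ _
    · rw [map_mul]
      have b₁ := h₁ (ρ ≫ p₁) (by
        rw [comp_left', hρ, ← e₁]
        exact Category.assoc _ _ _)
      have b₂ := h₂ (ρ ≫ p₂) (by
        rw [comp_left', hρ, ← e₂]
        exact Category.assoc _ _ _)
      exact congrArg₂ _ b₁ b₂
  stalkα_rel V τ hτ n s := by
    rintro ⟨W, g, hg, n₀, rfl, h⟩
    have h1 := section_w j hσ₀ hτ hg
    rw [h (sectionHom (U := W) _ h1) rfl]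
    refine (appTop_α (hβ := hβ) (sectionHom (U := W) _ h1) n₀).symm.trans ?_
    refine (appTop_comp_apply τ g _).trans ?_
    exact congrArg τ.appTop (j.α_app V W g hg n₀).symm

/-- A strict étale morphism to a log point has a section through each of its points. -/
lemma exists_section_of_isStrict [Etale j.base] (hj : LogScheme.IsStrict j) (σ₀ : T ⟶ U.scheme)
    (hσ₀ : σ₀ ≫ j.base = 𝟙 T) : ∃ σ : logPoint β hβ ⟶ U, σ.base = σ₀ ∧ σ ≫ j = 𝟙 _ := by
  let G := sectionGenerators j hj σ₀ hσ₀
  refine ⟨G.hom hβ, rfl, hom_ext hσ₀ fun V τ hτ hτ' m => ?_⟩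
  have h1 : τ ≫ V.hom = σ₀ ≫ j.base := hτ.trans rfl
  let a : T ⟶ (LogScheme.Hom.pullbackObj j.base V).left := pullback.lift τ σ₀ h1
  have ha : a ≫ (LogScheme.Hom.pullbackObj j.base V).hom = σ₀ := pullback.lift_snd _ _ _
  have ha' : a ≫ LogScheme.Hom.pullbackProj j.base V = τ := pullback.lift_fst _ _ _
  refine (stalkMap_comp (G.hom hβ) j V _ a ha _ (LogScheme.Hom.pullbackProj_hom j.base V) τ hτ
    ha' m).trans ?_
  refine Eq.trans ?_ (stalkMap_id (sectionHom (U := V) τ hτ') hτ' m).symm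
  refine G.stalkMap_hom ha ⟨V, _, LogScheme.Hom.pullbackProj_hom j.base V, m, rfl, fun ρ hρ => ?_⟩
  rw [show ρ = sectionHom (U := V) τ hτ' from etale_hom_ext (hρ.trans ha')]

end Section

end LogPoint

/-! ### Thickenings of log points and the lifting property -/

namespace LogPoint

variable {T' T : Scheme.{u}} [IsStrictPoint T'] [IsStrictPoint T] {Q : Type u} [CommMonoid Q]
  {β : Q →* Γ(T, ⊤)}

/-- The pullback of `β` along `i : T' ⟶ T`. -/
def pullbackβ (i : T' ⟶ T) (β : Q →* Γ(T, ⊤)) : Q →* Γ(T', ⊤) :=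
  (i.appTop.hom : Γ(T, ⊤) →* Γ(T', ⊤)).comp β

/-- The map `Γ(T, 𝒪)ˣ × Q → Γ(T', 𝒪)ˣ × Q`. -/
def mapUnits (i : T' ⟶ T) : Γ(T, ⊤)ˣ × Q →* Γ(T', ⊤)ˣ × Q :=
  MonoidHom.prodMap (Units.map (i.appTop.hom : Γ(T, ⊤) →* Γ(T', ⊤))) (MonoidHom.id Q)

lemma stalkα_mapUnits (i : T' ⟶ T) (s : Γ(T, ⊤)ˣ × Q) :
    stalkα (pullbackβ i β) (mapUnits i s) = i.appTop (stalkα β s) := by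
  rw [stalkα_apply, stalkα_apply]
  exact (map_mul i.appTop.hom _ _).symm

lemma exists_extension_sectionHom (i : T' ⟶ T) (V : T.Etale) (τ : T' ⟶ V.left)
    (hτ : τ ≫ V.hom = i) : ∃ σ : basePt T ⟶ V, i ≫ σ.left = τ := by
  obtain ⟨σ, hσ, h⟩ := IsStrictPoint.exists_extension (T := T) (T' := T') i V.hom τ hτ
  exact ⟨sectionHom σ hσ, h⟩

/-- The extension to `T` of a `T'`-point of an étale `T`-scheme. -/
noncomputable def extend (i : T' ⟶ T) (V : T.Etale) (τ : T' ⟶ V.left) (hτ : τ ≫ V.hom = i) :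
    basePt T ⟶ V :=
  (exists_extension_sectionHom i V τ hτ).choose

lemma comp_extend (i : T' ⟶ T) (V : T.Etale) (τ : T' ⟶ V.left) (hτ : τ ≫ V.hom = i) :
    i ≫ (extend i V τ hτ).left = τ :=
  (exists_extension_sectionHom i V τ hτ).choose_spec

lemma eq_extend {i : T' ⟶ T} {V : T.Etale} {τ : T' ⟶ V.left} {hτ : τ ≫ V.hom = i}
    {σ : basePt T ⟶ V} (h : i ≫ σ.left = τ) : extend i V τ hτ = σ :=
  etale_hom_ext (IsStrictPoint.extension_unique (T := T) (T' := T') i V.hom (basePt_w _)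
    (basePt_w σ) ((comp_extend i V τ hτ).trans h.symm))

/-- The strict morphism of log points over a morphism `i : T' ⟶ T`. -/
noncomputable def pointMap (i : T' ⟶ T) (hβ : ∀ q, IsUnit (β q) → q = 1)
    (hβ' : ∀ q, IsUnit (pullbackβ i β q) → q = 1) :
    logPoint (pullbackβ i β) hβ' ⟶ logPoint β hβ :=
  homOfStalk (X := logPoint β hβ) i
    (fun V τ hτ => (mapUnits i).comp (eval (hβ := hβ) (extend i V τ hτ)))
    (fun V W k τ hτ τ' hτ' e m => by
      refine congrArg (mapUnits i) ((eval_res k _ m).trans ?_)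
      rw [eq_extend (i := i) (V := W) (hτ := hτ') (σ := extend i V τ hτ ≫ k)]
      rw [comp_left', ← e]
      exact (Category.assoc _ _ _).symm.trans (congrArg (· ≫ k.left) (comp_extend i V τ hτ)))
    (fun V τ hτ m => by
      refine (stalkα_mapUnits i _).trans ?_
      rw [← appTop_α (hβ := hβ)]
      refine (appTop_comp_apply i _ _).symm.trans ?_
      exact congrArg (fun τ : T' ⟶ V.left => τ.appTop ((logPoint β hβ).α V m))
        (comp_extend i V τ hτ))

lemma stalkMap_pointMap (i : T' ⟶ T) (hβ : ∀ q, IsUnit (β q) → q = 1)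
    (hβ' : ∀ q, IsUnit (pullbackβ i β q) → q = 1) (V : T.Etale) (τ : T' ⟶ V.left)
    (hτ : τ ≫ V.hom = i) (σ : basePt T ⟶ V) (h : i ≫ σ.left = τ)
    (m : (logPoint β hβ).sections V) :
    stalkMap (pointMap i hβ hβ') V τ hτ m = mapUnits i (eval σ m) := by
  refine (stalkMap_homOfStalk (X := logPoint β hβ) i _ _ _ V τ hτ m).trans ?_
  change mapUnits i (eval (extend i V τ hτ) m) = _
  rw [eq_extend h]

lemma isStrict_pointMap (i : T' ⟶ T) (hβ : ∀ q, IsUnit (β q) → q = 1)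
    (hβ' : ∀ q, IsUnit (pullbackβ i β q) → q = 1) :
    LogScheme.IsStrict (pointMap i hβ hβ') := by
  obtain ⟨t⟩ := IsStrictPoint.nonempty (T := T')
  have hi : i ≫ (basePt T).hom = (basePt T').hom ≫ i :=
    (Category.comp_id i).trans (Category.id_comp i).symm
  have key (n : (logPoint β hβ).sections (basePt T)) :
      eval (𝟙 (basePt T')) ((pointMap i hβ hβ').app (basePt T') (basePt T) i hi n) =
        mapUnits i (eval (𝟙 _) n) := by
    refine (eval_app (pointMap i hβ hβ') (basePt T') (basePt T) i hi (𝟙 _) i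
      (Category.comp_id i) (Category.id_comp i) n).trans ?_
    exact stalkMap_pointMap i hβ hβ' _ _ _ _ (Category.comp_id i) n
  constructor
  · intro U m x
    obtain ⟨σ, hσ⟩ := exists_sectionHom (T := T') U x
    refine ⟨basePt T', σ, t, basePt T, i, hi, const _ (eval σ m).2,
      mk fun _ => ((eval σ m).1, 1), hσ t, isUnit_mk _, ext fun ρ => ?_⟩
    obtain rfl := basePt_end ρ
    rw [map_mul, eval_res, Category.id_comp, eval_mk, key]
    refine Prod.ext ?_ (one_mul _).symm
    have h1 : (mapUnits i ((1, (eval σ m).2) : Γ(T, ⊤)ˣ × Q)).1 = 1 :=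
      map_one (Units.map (i.appTop.hom : Γ(T, ⊤) →* Γ(T', ⊤)))
    exact ((congrArg _ h1).trans (mul_one _)).symm
  · intro U V g hg n n' w hw e x
    obtain ⟨σ, hσ⟩ := exists_sectionHom (T := T') U x
    have hσg : (σ.left ≫ g) ≫ V.hom = i := by
      refine (Category.assoc _ _ _).trans ((congrArg (σ.left ≫ ·) hg).trans ?_)
      refine (Category.assoc _ _ _).symm.trans ((congrArg (· ≫ i) (basePt_w σ)).trans ?_)
      exact Category.id_comp _
    let ρ := extend i V (σ.left ≫ g) hσg
    have hρ := comp_extend i V (σ.left ≫ g) hσg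
    have h1 (n : (logPoint β hβ).sections V) :
        eval σ ((pointMap i hβ hβ').app U V g hg n) = mapUnits i (eval ρ n) :=
      (eval_app (pointMap i hβ hβ') U V g hg σ _ hσg rfl n).trans
        (stalkMap_pointMap i hβ hβ' _ _ _ _ hρ n)
    have e1 := congrArg (eval σ) e
    rw [map_mul, h1, h1] at e1
    have hw2 := eval_snd_of_isUnit hw σ
    have e2 : (eval ρ n).2 = (eval ρ n').2 := by
      have := congrArg Prod.snd e1
      rw [Prod.snd_mul, hw2, one_mul] at this
      exact this
    have e3 : Units.map (i.appTop.hom : Γ(T, ⊤) →* Γ(T', ⊤)) (eval ρ n).1 =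
        (eval σ w).1 * Units.map (i.appTop.hom : Γ(T, ⊤) →* Γ(T', ⊤)) (eval ρ n').1 :=
      congrArg Prod.fst e1
    refine ⟨basePt T', σ, t, basePt T, ρ, i, hi, mk fun _ => ((eval ρ n).1 / (eval ρ n').1, 1),
      hσ t, hρ, isUnit_mk _, ext fun ρ' => ?_, ext fun ρ' => ?_⟩
    · obtain rfl := basePt_end ρ'
      rw [map_mul, eval_res, eval_res, Category.id_comp, eval_mk]
      refine Prod.ext ?_ (e2.trans (one_mul _).symm)
      exact (div_mul_cancel _ _).symm
    · obtain rfl := basePt_end ρ'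
      rw [key, eval_mk, eval_res, Category.id_comp]
      refine Prod.ext ?_ hw2.symm
      refine (map_div (Units.map (i.appTop.hom : Γ(T, ⊤) →* Γ(T', ⊤))) _ _).trans ?_
      rw [e3]
      exact mul_div_cancel_right _ _

/-- A square-zero extension of strict points gives a log thickening of order one. -/
lemma isFirstOrderThickening_pointMap [IsCancelMul Q] [Monoid.FG Q] (i : T' ⟶ T)
    [IsClosedImmersion i] (hβ : ∀ q, IsUnit (β q) → q = 1)
    (hβ' : ∀ q, IsUnit (pullbackβ i β q) → q = 1)
    (hi : ∀ a b : Γ(T, ⊤), i.appTop a = 0 → i.appTop b = 0 → a * b = 0) :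
    LogScheme.IsFirstOrderThickening (pointMap i hβ hβ') where
  fine_source := isFine
  fine_target := isFine
  strict := isStrict_pointMap i hβ hβ'
  isClosedImmersion := inferInstanceAs (IsClosedImmersion i)
  mul_eq_zero U a b ha hb := by
    change T.Opens at U
    change Γ(T, U) at a b
    change i.app U a = 0 at ha
    change i.app U b = 0 at hb
    change a * b = 0
    have h1 : U = ⊥ ∨ U = ⊤ := by
      rcases (U : Set T).eq_empty_or_nonempty with h | ⟨x, hx⟩
      · exact Or.inl (TopologicalSpace.Opens.ext h)
      · refine Or.inr (TopologicalSpace.Opens.ext (Set.eq_univ_of_forall fun y => ?_))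
        rwa [IsStrictPoint.subsingleton.elim y x]
    rcases h1 with rfl | rfl
    · exact Subsingleton.elim _ _
    · exact hi a b ha hb

end LogPoint

namespace LogScheme

variable {X : LogScheme.{u}} {S : Scheme.{u}}

lemma isUnit_of_top_le_basicOpen {Y : Scheme.{u}} {s : Γ(Y, ⊤)} (h : ⊤ ≤ Y.basicOpen s) :
    IsUnit s :=
  RingedSpace.isUnit_of_isUnit_germ Y.toSheafedSpace ⊤ s fun x hx =>
    (Y.mem_basicOpen s x hx).1 (h hx)

lemma isUnit_of_trivial {V : S.Etale} (n : (trivial S).sections V) :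
    IsUnit ((trivial S).α V n) := by
  have h : V.hom ⁻¹ᵁ ⊤ ≤ V.left.basicOpen n.1 := n.2
  exact isUnit_of_top_le_basicOpen h

lemma isUnit_of_isUnit_α {U : X.scheme.Etale} {m : X.sections U} (h : IsUnit (X.α U m)) :
    IsUnit m := by
  obtain ⟨n, hn, -⟩ := X.logStructure.existsUnique_of_isUnit U _ h.unit⁻¹.isUnit
  refine IsUnit.of_mul_eq_one n ?_
  refine (X.logStructure.existsUnique_of_isUnit U 1 isUnit_one).unique ?_ (map_one _)
  exact (map_mul (X.α U) m n).trans (by rw [show X.α U n = _ from hn]; exact h.mul_val_inv)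

lemma eq_of_α_eq {U : X.scheme.Etale} {m n : X.sections U} (hm : IsUnit (X.α U m))
    (h : X.α U m = X.α U n) : m = n :=
  (X.logStructure.existsUnique_of_isUnit U _ hm).unique rfl h.symm

/-- A morphism to a scheme with trivial log structure is determined by the underlying morphism
of schemes. -/
lemma hom_trivial_ext {f g : X ⟶ trivial S} (h : f.base = g.base) : f = g := by
  refine Hom.ext' h fun U V a ha hb m => ?_
  have h1 := f.α_app U V a ha m
  have h2 := g.α_app U V a hb m
  refine eq_of_α_eq ?_ (h1.trans h2.symm)
  rw [show X.α U (f.app U V a ha m) = _ from h1]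
  exact (isUnit_of_trivial m).map a.appTop.hom

/-- The morphism of log schemes to `S` with its trivial log structure over a morphism of
schemes. -/
noncomputable def homTrivial (t : X.scheme ⟶ S) : X ⟶ trivial S where
  base := t
  app U V g hg :=
    have h (m : (trivial S).sections V) :=
      X.logStructure.existsUnique_of_isUnit U _ ((isUnit_of_trivial m).map g.appTop.hom)
    { toFun := fun m => (h m).choose
      map_one' := (h 1).unique (h 1).choose_spec.1 <| by
        exact (map_one (X.α U)).trans (((congrArg _ (map_one ((trivial S).α V))).trans
          (map_one g.appTop.hom)).symm)
      map_mul' := fun m n => (h (m * n)).unique (h (m * n)).choose_spec.1 <| by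
        refine (map_mul (X.α U) _ _).trans ?_
        refine (congrArg₂ (· * ·) (h m).choose_spec.1 (h n).choose_spec.1).trans ?_
        exact (map_mul g.appTop.hom _ _).symm.trans
          (congrArg g.appTop (map_mul ((trivial S).α V) m n).symm) }
  res_app_res {U' U V V'} a k g hg g' hg' e m := by
    have h (U : X.scheme.Etale) (V : S.Etale) (g : U.left ⟶ V.left) (m : (trivial S).sections V) :=
      X.logStructure.existsUnique_of_isUnit U _ ((isUnit_of_trivial m).map g.appTop.hom)
    refine (h U' V' g' m).unique ?_ (h U' V' g' m).choose_spec.1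
    refine (X.logStructure.α_res a _).trans ?_
    refine (congrArg a.left.appTop (h U V g _).choose_spec.1).trans ?_
    rw [e]
    refine Eq.trans ?_ (appTop_comp_apply a.left (g ≫ k.left) _).symm
    refine Eq.trans ?_ (congrArg a.left.appTop (appTop_comp_apply g k.left _)).symm
    exact congrArg (fun x => a.left.appTop (g.appTop x)) ((trivial S).logStructure.α_res k m)
  α_app U V g hg m :=
    (X.logStructure.existsUnique_of_isUnit U _
      ((isUnit_of_trivial m).map g.appTop.hom)).choose_spec.1

open LogPoint in
/-- The lifting property of a log smooth morphism to a scheme with trivial log structure, for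
square-zero extensions of strict points and morphisms expressed in a chart: a `T'`-point `h'` of
the domain of a chart `φ : Q → M_X(U₀)` such that `h'^* ∘ α ∘ φ` is a family of units times the
restriction of `β : Q → Γ(T, 𝒪)` lifts to a `T`-point with the analogous property. -/
theorem IsLogSmooth.exists_lift_of_isChart {f : X ⟶ trivial S} (hf : IsLogSmooth f)
    {T' T : Scheme.{u}} [IsStrictPoint T'] [IsStrictPoint T] {Q : Type u} [CommMonoid Q]
    [IsCancelMul Q] [Monoid.FG Q] {U₀ : X.scheme.Etale} {φ : Q →* X.sections U₀} (hφ : IsChart φ)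
    (i : T' ⟶ T) [IsClosedImmersion i]
    (hi : ∀ a b : Γ(T, ⊤), i.appTop a = 0 → i.appTop b = 0 → a * b = 0)
    (β : Q →* Γ(T, ⊤)) (hβ' : ∀ q, IsUnit (i.appTop (β q)) → q = 1)
    (h' : T' ⟶ U₀.left) (v' : Q →* Γ(T', ⊤)ˣ)
    (e : ∀ q, h'.appTop (X.α U₀ (φ q)) = v' q * i.appTop (β q))
    (t : T ⟶ S) (ht : i ≫ t = (h' ≫ U₀.hom) ≫ f.base) :
    ∃ (h : T ⟶ U₀.left) (v : Q →* Γ(T, ⊤)ˣ), i ≫ h = h' ∧ (h ≫ U₀.hom) ≫ f.base = t ∧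
      (∀ q, h.appTop (X.α U₀ (φ q)) = v q * β q) ∧
      ∀ q, i.appTop (v q : Γ(T, ⊤)) = v' q := by
  have hβ (q : Q) (hq : IsUnit (β q)) : q = 1 := hβ' q (hq.map i.appTop.hom)
  let G := chartGenerators (β := pullbackβ i β) hβ' hφ h' v' e
  let s : logPoint (pullbackβ i β) hβ' ⟶ X := G.hom hβ'
  let tt : logPoint β hβ ⟶ trivial S := homTrivial t
  let I := pointMap i hβ hβ'
  have comm : s ≫ f = I ≫ tt := hom_trivial_ext ht.symm
  obtain ⟨t₀⟩ := IsStrictPoint.nonempty (T := T)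
  obtain ⟨U, j, g, hj1, hj2, ⟨y, hy⟩, hg, hW⟩ := hf.exists_lift _ _ I
    (isFirstOrderThickening_pointMap i hβ hβ' hi) s tt comm t₀
  -- The étale local diagonal becomes a diagonal on `T` by means of a section of `j`.
  obtain ⟨σ₀, hσ₀, -⟩ := IsStrictPoint.exists_section (T := T) j.base y
  obtain ⟨σ, hσ, hσ'⟩ := exists_section_of_isStrict j hj2 σ₀ hσ₀
  let g' : logPoint β hβ ⟶ X := σ ≫ g
  have hs : s = I ≫ g' := by
    have := hW _ (𝟙 _) (I ≫ σ) (by rw [Category.assoc, hσ', Category.id_comp, Category.comp_id])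
    rw [Category.id_comp, Category.assoc] at this
    exact this
  have hbase : i ≫ g'.base = h' ≫ U₀.hom := congrArg Hom.base hs.symm
  have hbase2 : g'.base ≫ f.base = t := by
    have : g' ≫ f = tt := by rw [Category.assoc, hg, ← Category.assoc, hσ', Category.id_comp]
    exact congrArg Hom.base this
  -- The diagonal factors through the étale neighbourhood `U₀`, because `h'` does.
  obtain ⟨σ₁, hσ₁, hσ₁'⟩ := IsStrictPoint.exists_extension (T := T) (T' := T') i
    (pullback.snd U₀.hom g'.base) (pullback.lift h' i hbase.symm) (pullback.lift_snd _ _ _)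
  let h : T ⟶ U₀.left := σ₁ ≫ pullback.fst U₀.hom g'.base
  have hh : i ≫ h = h' := by
    refine (Category.assoc _ _ _).symm.trans ?_
    rw [hσ₁']
    exact pullback.lift_fst _ _ _
  have hh' : h ≫ U₀.hom = g'.base := by
    refine (Category.assoc _ _ _).trans ?_
    rw [pullback.condition, ← Category.assoc, hσ₁]
    exact Category.id_comp _
  -- The restriction to `T'` determines the component in `Q` of the image of `φ q`.
  have key (q : Q) : mapUnits i (stalkMap g' U₀ h hh' (φ q)) = (v' q, q) := by
    have h1 : stalkMap s U₀ h' rfl (φ q) = (v' q, q) :=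
      G.stalkMap_hom (hβ := hβ') rfl ⟨𝟙 U₀, Category.comp_id h', q,
        (X.logStructure.res_id _ _).symm, rfl⟩
    have h2 : stalkMap (I ≫ g') U₀ h' hbase.symm (φ q) = (v' q, q) := by
      rw [← h1]
      congr 1
      simp only [hs]
    rw [← h2]
    let W := Hom.pullbackObj g'.base U₀
    have c1 : pullback.lift h (𝟙 T) (hh'.trans (Category.id_comp _).symm) ≫ W.hom = 𝟙 T :=
      pullback.lift_snd _ _ _
    have c2 : pullback.lift h (𝟙 T) (hh'.trans (Category.id_comp _).symm) ≫
      Hom.pullbackProj g'.base U₀ = h := pullback.lift_fst _ _ _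
    let ρ : basePt T ⟶ W := sectionHom (U := W) _ c1
    have c3 : (i ≫ ρ.left) ≫ W.hom = I.base :=
      (Category.assoc _ _ _).trans ((congrArg (i ≫ ·) c1).trans (Category.comp_id _))
    have c4 : (i ≫ ρ.left) ≫ Hom.pullbackProj g'.base U₀ = h' :=
      (Category.assoc _ _ _).trans ((congrArg (i ≫ ·) c2).trans hh)
    refine Eq.symm ((stalkMap_comp I g' U₀ W (i ≫ ρ.left) c3 _ (Hom.pullbackProj_hom g'.base U₀)
      h' hbase.symm c4 (φ q)).trans ?_)
    refine (stalkMap_pointMap i hβ hβ' W _ c3 ρ rfl _).trans ?_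
    exact congrArg (mapUnits i) (eval_app g' W U₀ _ _ ρ h hh' c2 (φ q))
  refine ⟨h, (MonoidHom.fst _ _).comp ((stalkMap g' U₀ h hh').comp φ), hh,
    (congrArg (· ≫ f.base) hh').trans hbase2, fun q => ?_, fun q => ?_⟩
  · have h2 : (stalkMap g' U₀ h hh' (φ q)).2 = q := congrArg Prod.snd (key q)
    have h3 := stalkα_stalkMap g' U₀ h hh' (φ q)
    rw [stalkα_apply, h2] at h3
    exact h3.symm
  · exact congrArg Units.val (congrArg Prod.fst (key q))

end LogScheme

/-! ### Saturated monoids and faces -/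

section Monoids

/-- A character of a subgroup `E` of a finitely generated commutative group `G` extends to `G` if
`G / E` is torsion-free. -/
lemma exists_extension_of_torsionFree {E G A : Type*} [CommGroup E] [CommGroup G] [CommGroup A]
    [Group.FG G] (j : E →* G) (hj : Function.Injective j)
    (htf : ∀ (g : G) (n : ℕ), 0 < n → g ^ n ∈ j.range → g ∈ j.range) (χ : E →* A) :
    ∃ c : G →* A, c.comp j = χ := by
  have h1 : IsMulTorsionFree (G ⧸ j.range) := by
    rw [isMulTorsionFree_iff_not_isOfFinOrder]
    intro a ha hfin
    obtain ⟨g, rfl⟩ := QuotientGroup.mk_surjective a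
    obtain ⟨n, hn, hg⟩ := hfin.exists_pow_eq_one
    refine ha ((QuotientGroup.eq_one_iff g).2 (htf g n hn ?_))
    rwa [← QuotientGroup.eq_one_iff, QuotientGroup.mk_pow]
  have h2 : Module.Finite ℤ (Additive (G ⧸ j.range)) :=
    Module.Finite.iff_addGroup_fg.2 inferInstance
  -- The quotient is free, so there is a retraction `r : G → E`.
  have h3 : Module.Free ℤ (Additive (G ⧸ j.range)) := Module.free_of_finite_type_torsion_free'
  obtain ⟨s, hs⟩ := Module.projective_lifting_property
    (MonoidHom.toAdditive (QuotientGroup.mk' j.range)).toIntLinearMap LinearMap.id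
    (QuotientGroup.mk'_surjective j.range)
  let s' : (G ⧸ j.range) →* G := AddMonoidHom.toMultiplicative s.toAddMonoidHom
  have hs' (a : G ⧸ j.range) : (s' a : G ⧸ j.range) = a := LinearMap.congr_fun hs (Additive.ofMul a)
  let r : G →* j.range :=
    (MonoidHom.id G / s'.comp (QuotientGroup.mk' j.range)).codRestrict j.range fun g => by
      rw [← QuotientGroup.eq_one_iff]
      change ((g / s' g : G) : G ⧸ j.range) = 1
      rw [QuotientGroup.mk_div, hs', div_self']
  refine ⟨χ.comp ((MonoidHom.ofInjective hj).symm.toMonoidHom.comp r), MonoidHom.ext fun e => ?_⟩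
  have h4 : r (j e) = MonoidHom.ofInjective hj e := by
    apply Subtype.ext
    change j e / s' (j e : G ⧸ j.range) = j e
    rw [(QuotientGroup.eq_one_iff (j e)).2 (MonoidHom.mem_range.2 ⟨e, rfl⟩), map_one, div_one]
  change χ ((MonoidHom.ofInjective hj).symm (r (j e))) = χ e
  rw [h4, MulEquiv.symm_apply_apply]

variable {P : Type u} [CommMonoid P] [IsCancelMul P]

/-- A character of a face of a fine saturated monoid extends to the monoid. -/
lemma exists_extension_of_face [Monoid.FG P] (hP : LogScheme.IsSaturated P) (F : Submonoid P)
    (hF : ∀ p q, p * q ∈ F → p ∈ F) {A : Type*} [CommGroup A] (χ : F →* A) :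
    ∃ c : P →* A, ∀ f : F, c f = χ f := by
  let ι : P →* Algebra.GrothendieckGroup P := Algebra.GrothendieckGroup.of
  have hι : Function.Injective ι := Algebra.GrothendieckGroup.of_injective
  let ιF : F →* Algebra.GrothendieckGroup F := Algebra.GrothendieckGroup.of
  let j : Algebra.GrothendieckGroup F →* Algebra.GrothendieckGroup P :=
    Algebra.GrothendieckGroup.lift (ι.comp F.subtype)
  have hjι (f : F) : j (ιF f) = ι f :=
    DFunLike.congr_fun (Algebra.GrothendieckGroup.lift.symm_apply_apply (ι.comp F.subtype)) f
  have frac {M : Type u} [CommMonoid M] (x : Algebra.GrothendieckGroup M) :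
      ∃ a b : M, x * Algebra.GrothendieckGroup.of b = Algebra.GrothendieckGroup.of a := by
    obtain ⟨⟨a, b⟩, h⟩ := (Localization.monoidOf (⊤ : Submonoid M)).surj x
    exact ⟨a, b, h⟩
  -- `F^gp → P^gp` is injective with torsion-free cokernel: if `g ^ n ∈ F^gp`, then a multiple of
  -- `g` by an element of `F` is in `P` by saturation, and then in `F` since `F` is a face.
  have hj : Function.Injective j := by
    rw [injective_iff_map_eq_one]
    intro e he
    obtain ⟨a, b, hab⟩ := frac e
    have h1 := congrArg j hab
    rw [map_mul, he, one_mul] at h1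
    have h2 : (b : P) = a := hι (((hjι b).symm.trans h1).trans (hjι a))
    obtain rfl : b = a := Subtype.ext h2
    exact mul_eq_right.1 hab
  have htf (g : Algebra.GrothendieckGroup P) (n : ℕ) (hn : 0 < n) (hg : g ^ n ∈ j.range) :
      g ∈ j.range := by
    obtain ⟨a, b, hab⟩ := frac g
    obtain ⟨e, he⟩ := hg
    obtain ⟨f, f', hff⟩ := frac e
    have h1 : g ^ n * ι f' = ι f := by
      have := congrArg j hff
      rw [map_mul, he] at this
      exact (congrArg (g ^ n * ·) (hjι f')).symm.trans (this.trans (hjι f))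
    have h2 : a ^ n * f' = b ^ n * f := by
      apply hι
      rw [map_mul, map_mul, map_pow, map_pow, show ι a = _ from hab.symm, mul_pow, mul_right_comm,
        h1, mul_comm]
    have h3 : (a * f') ^ n = b ^ n * (f * f' ^ (n - 1) : P) := by
      obtain ⟨k, rfl⟩ := Nat.exists_eq_succ_of_ne_zero hn.ne'
      rw [mul_pow, Nat.succ_sub_one, pow_succ (f' : P), ← mul_assoc (b ^ _), ← h2]
      simp only [mul_assoc, mul_comm, mul_left_comm]
    obtain ⟨d, hd⟩ := hP _ _ _ n hn h3
    have h4 : d ^ n = f * f' ^ (n - 1) := by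
      rw [hd, mul_pow] at h3
      exact mul_left_cancel h3
    have h5 : d ∈ F := by
      refine hF d (d ^ (n - 1)) ?_
      rw [← pow_succ', Nat.sub_add_cancel hn, h4]
      exact F.mul_mem f.2 (F.pow_mem f'.2 _)
    refine ⟨ιF ⟨d, h5⟩ / ιF f', ?_⟩
    rw [map_div, hjι, hjι, div_eq_iff_eq_mul]
    have h6 : ι a * ι f' = ι b * ι d := by rw [← map_mul, hd, map_mul]
    rw [show ι a = _ from hab.symm, mul_right_comm] at h6
    exact (mul_right_cancel (h6.trans (mul_comm _ _))).symm
  have : Group.FG (Algebra.GrothendieckGroup P) := Group.fg_iff_monoid_fg.2 inferInstance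
  obtain ⟨c, hc⟩ := exists_extension_of_torsionFree j hj htf (Algebra.GrothendieckGroup.lift χ)
  refine ⟨c.comp ι, fun f => ?_⟩
  have h1 := DFunLike.congr_fun hc (ιF f)
  change c (j (ιF f)) = _ at h1
  rw [hjι] at h1
  refine h1.trans ?_
  exact DFunLike.congr_fun (Algebra.GrothendieckGroup.lift.symm_apply_apply χ) f

/-- Two elements of a monoid are equivalent modulo a submonoid `F` if they become equal after
multiplication with elements of `F`. -/
def faceCon (F : Submonoid P) : Con P where
  r p q := ∃ f ∈ F, ∃ g ∈ F, p * f = q * g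
  iseqv :=
    { refl := fun p => ⟨1, F.one_mem, 1, F.one_mem, rfl⟩
      symm := fun ⟨f, hf, g, hg, h⟩ => ⟨g, hg, f, hf, h.symm⟩
      trans := fun ⟨f, hf, g, hg, h⟩ ⟨f', hf', g', hg', h'⟩ =>
        ⟨f * f', F.mul_mem hf hf', g * g', F.mul_mem hg hg', by
          rw [← mul_assoc, h, mul_right_comm, h', mul_right_comm, mul_assoc]⟩ }
  mul' := fun ⟨f, hf, g, hg, h⟩ ⟨f', hf', g', hg', h'⟩ =>
    ⟨f * f', F.mul_mem hf hf', g * g', F.mul_mem hg hg', by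
      rw [mul_mul_mul_comm, h, h', mul_mul_mul_comm]⟩

lemma faceCon_eq {F : Submonoid P} {p q : P} :
    ((p : (faceCon F).Quotient) = q) ↔ ∃ f ∈ F, ∃ g ∈ F, p * f = q * g :=
  (faceCon F).eq

instance (F : Submonoid P) : IsCancelMul (faceCon F).Quotient := by
  refine @CommMagma.IsLeftCancelMul.toIsCancelMul _ _ ⟨fun a b c h => ?_⟩
  induction a using Con.induction_on with | _ a
  induction b using Con.induction_on with | _ b
  induction c using Con.induction_on with | _ c
  simp only [← Con.coe_mul] at h
  obtain ⟨f, hf, g, hg, h⟩ := faceCon_eq.1 h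
  refine faceCon_eq.2 ⟨f, hf, g, hg, ?_⟩
  rw [mul_assoc, mul_assoc] at h
  exact mul_left_cancel h

instance [Monoid.FG P] (F : Submonoid P) : Monoid.FG (faceCon F).Quotient :=
  Monoid.fg_of_surjective (faceCon F).mk' (faceCon F).mk'_surjective

lemma isSaturated_faceCon (hP : LogScheme.IsSaturated P) (F : Submonoid P) :
    LogScheme.IsSaturated (faceCon F).Quotient := by
  intro a b c n hn h
  induction a using Con.induction_on with | _ a
  induction b using Con.induction_on with | _ b
  induction c using Con.induction_on with | _ c
  change ((a ^ n : P) : (faceCon F).Quotient) = ((b ^ n * c : P) : (faceCon F).Quotient) at h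
  obtain ⟨f, hf, g, hg, h⟩ := faceCon_eq.1 h
  obtain ⟨k, rfl⟩ := Nat.exists_eq_succ_of_ne_zero hn.ne'
  obtain ⟨d, hd⟩ := hP (a * f) b (c * g * f ^ k) _ hn (by
    rw [mul_pow, pow_succ f, ← mul_assoc, mul_right_comm, h]
    simp only [mul_assoc])
  exact ⟨d, faceCon_eq.2 ⟨f, hf, 1, F.one_mem, by rw [hd, mul_one]⟩⟩

lemma coe_eq_one_of_mem {F : Submonoid P} {p : P} (hp : p ∈ F) :
    (p : (faceCon F).Quotient) = 1 :=
  faceCon_eq.2 ⟨1, F.one_mem, p, hp, by rw [mul_one, one_mul]⟩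

/-- A finitely generated cancellative monoid without units, in which any two elements are
comparable for divisibility, is trivial or generated by one element. -/
lemma eq_one_or_exists_generator [Monoid.FG P] (hu : ∀ p : P, IsUnit p → p = 1)
    (hc : ∀ p q : P, p ∣ q ∨ q ∣ p) :
    (∀ p : P, p = 1) ∨ ∃ t : P, t ≠ 1 ∧ ∀ p, ∃ n : ℕ, p = t ^ n := by
  classical
  obtain ⟨S, hS⟩ := (Monoid.fg_def (M := P)).1 inferInstance
  by_cases h0 : ∀ p : P, p = 1
  · exact Or.inl h0
  right
  have hne : (S.filter (· ≠ 1)).Nonempty := by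
    by_contra h
    rw [Finset.not_nonempty_iff_eq_empty, Finset.filter_eq_empty_iff] at h
    refine h0 fun p => ?_
    have : p ∈ Submonoid.closure (S : Set P) := hS ▸ Submonoid.mem_top p
    have hle : Submonoid.closure (S : Set P) ≤ ⊥ := Submonoid.closure_le.2 fun s hs => by
      simpa using h hs
    exact Submonoid.mem_bot.1 (hle this)
  have hmin (A : Finset P) (hA : A.Nonempty) : ∃ t ∈ A, ∀ s ∈ A, t ∣ s := by
    induction hA using Finset.Nonempty.cons_induction with
    | singleton a => exact ⟨a, by simp, by simp⟩
    | cons a A ha hA ih =>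
      obtain ⟨t, ht, h⟩ := ih
      rcases hc a t with hat | hta
      · refine ⟨a, by simp, fun s hs => ?_⟩
        rcases Finset.mem_cons.1 hs with rfl | hs
        · exact dvd_rfl
        · exact hat.trans (h s hs)
      · refine ⟨t, by simp [ht], fun s hs => ?_⟩
        rcases Finset.mem_cons.1 hs with rfl | hs
        · exact hta
        · exact h s hs
  obtain ⟨t, ht, hdiv⟩ := hmin _ hne
  have ht1 : t ≠ 1 := (Finset.mem_filter.1 ht).2
  have hdvd (p : P) : p = 1 ∨ t ∣ p := by
    have : p ∈ Submonoid.closure (S : Set P) := hS ▸ Submonoid.mem_top p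
    induction this using Submonoid.closure_induction with
    | mem x hx =>
      by_cases h : x = 1
      · exact Or.inl h
      · exact Or.inr (hdiv x (Finset.mem_filter.2 ⟨hx, h⟩))
    | one => exact Or.inl rfl
    | mul x y _ _ hx hy =>
      rcases hx with rfl | hx
      · rcases hy with rfl | hy
        · exact Or.inl (one_mul 1)
        · exact Or.inr (hy.mul_left _)
      · exact Or.inr (hx.mul_right _)
  refine ⟨t, ht1, fun p => ?_⟩
  by_contra hp
  -- By Dickson's lemma, dividing by `t` cannot go on forever.
  have step (a : {a : P // ∀ n : ℕ, a ≠ t ^ n}) :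
      ∃ b : {a : P // ∀ n : ℕ, a ≠ t ^ n}, (a : P) = t * b := by
    obtain ⟨b, hb⟩ := (hdvd a).resolve_left (by simpa using a.2 0)
    refine ⟨⟨b, fun n hn => a.2 (n + 1) ?_⟩, hb⟩
    rw [hb, hn, pow_succ']
  choose nxt hnxt using step
  let q (k : ℕ) : {a : P // ∀ n : ℕ, a ≠ t ^ n} := nxt^[k] ⟨p, by simpa using hp⟩
  have hq (k l : ℕ) : (q k : P) = t ^ l * q (k + l) := by
    induction l with
    | zero => simp
    | succ l ih =>
      rw [ih, pow_succ, mul_assoc, hnxt (q (k + l))]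
      congr 2
      simp only [q]
      rw [← Function.iterate_succ_apply' nxt]
      rfl
  let e : (S → ℕ) → P := fun v => ∏ s : S, (s : P) ^ v s
  have he (p : P) : ∃ v, e v = p := by
    have : p ∈ Submonoid.closure (S : Set P) := hS ▸ Submonoid.mem_top p
    induction this using Submonoid.closure_induction with
    | mem x hx =>
      refine ⟨Pi.single ⟨x, hx⟩ 1, ?_⟩
      simp only [e]
      rw [Finset.prod_eq_single ⟨x, hx⟩ (fun b _ hb => by rw [Pi.single_eq_of_ne hb, pow_zero])
        (by simp), Pi.single_eq_same, pow_one]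
    | one => exact ⟨0, by simp [e]⟩
    | mul x y _ _ hx hy =>
      obtain ⟨v, rfl⟩ := hx
      obtain ⟨w, rfl⟩ := hy
      exact ⟨v + w, by simp [e, pow_add, Finset.prod_mul_distrib]⟩
  choose v hv using fun k => he (q k)
  obtain ⟨i, j, hij, hle⟩ := wellQuasiOrdered_le (α := S → ℕ) v
  obtain ⟨l, rfl⟩ := Nat.exists_eq_add_of_lt hij
  have h1 : (q i : P) ∣ q (i + l + 1) := by
    rw [← hv, ← hv]
    exact Finset.prod_dvd_prod_of_dvd _ _ fun s _ => pow_dvd_pow _ (hle s)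
  obtain ⟨r, hr⟩ := h1
  have h2 := hq i (l + 1)
  rw [← add_assoc, hr, mul_left_comm] at h2
  have h3 : t ^ (l + 1) * r = 1 := mul_left_cancel ((mul_one (q i : P)).trans h2).symm
  refine ht1 (hu t (IsUnit.of_mul_eq_one (t ^ l * r) ?_))
  rw [← h3, pow_succ', mul_assoc]

end Monoids

/-! ### Sharp charts -/

lemma appTop_mem_basicOpen {Y Z : Scheme.{u}} (f : Y ⟶ Z) (s : Γ(Z, ⊤)) (y : Y) :
    y ∈ Y.basicOpen (f.appTop s) ↔ f y ∈ Z.basicOpen s := by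
  rw [← Scheme.preimage_basicOpen_top]
  rfl

/-- The restriction of an étale `X`-scheme to an open subscheme. -/
noncomputable def restrictOpen {X : Scheme.{u}} (U : X.Etale) (V : U.left.Opens) : X.Etale :=
  Scheme.Etale.mk (V.ι ≫ U.hom)

/-- The inclusion of an open subscheme, as a morphism of étale schemes. -/
noncomputable def restrictOpenι {X : Scheme.{u}} (U : X.Etale) (V : U.left.Opens) :
    restrictOpen U V ⟶ U :=
  MorphismProperty.Over.homMk V.ι rfl

lemma isUnit_appTop_ι {Y : Scheme.{u}} (s : Γ(Y, ⊤)) :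
    IsUnit ((Y.basicOpen s).ι.appTop s) := by
  refine LogScheme.isUnit_of_top_le_basicOpen fun x _ => ?_
  rw [appTop_mem_basicOpen]
  exact x.2

lemma mul_mul_mul_eq₁ {M : Type*} [CommMonoid M] (w a c d : M) :
    w * (a * c) * d = w * c * d * a := by
  ac_rfl

lemma mul_mul_mul_eq₂ {M : Type*} [CommMonoid M] (w a c d e : M) :
    w * c * d * a * e = w * (a * (d * c * e)) := by
  ac_rfl

namespace LogScheme

variable {X : LogScheme.{u}}

/-- Every point of an fs log scheme has an étale neighbourhood with a chart by a fine saturated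
monoid, of which only `1` becomes invertible at the point. Such a chart is obtained from any
chart `P → M` by dividing out the face of the elements that become invertible, after twisting the
chart by a character of `P` with values in units that is inverse to it on this face. -/
theorem IsFs.exists_sharp_chart (hX : X.IsFs) (x : X.scheme) :
    ∃ (U : X.scheme.Etale) (y : U.left) (Q : Type u) (_ : CommMonoid Q) (φ : Q →* X.sections U),
      U.hom y = x ∧ Monoid.FG Q ∧ IsCancelMul Q ∧ IsSaturated Q ∧ IsChart φ ∧
      ∀ q, y ∈ U.left.basicOpen (X.α U (φ q)) → q = 1 := by
  obtain ⟨U, y, P, _, ψ, hy, _, _, hP, hψ⟩ := hX x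
  let F : Submonoid P :=
    { carrier := {p | y ∈ U.left.basicOpen (X.α U (ψ p))}
      one_mem' := by
        change y ∈ U.left.basicOpen _
        rw [map_one, map_one, Scheme.basicOpen_of_isUnit _ isUnit_one]
        trivial
      mul_mem' := fun {a b} ha hb => by
        change y ∈ U.left.basicOpen _
        rw [map_mul, map_mul, Scheme.basicOpen_mul]
        exact ⟨ha, hb⟩ }
  have hF (p q : P) (h : p * q ∈ F) : p ∈ F := by
    change y ∈ U.left.basicOpen _ at h
    rw [map_mul, map_mul, Scheme.basicOpen_mul] at h
    exact h.1
  classical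
  obtain ⟨S, hS⟩ := (Monoid.fg_def (M := P)).1 inferInstance
  -- The elements of the face `F` are units on the open set where the product of the generators of
  -- `F` is a unit.
  let f₀ : P := ∏ s ∈ S.filter (· ∈ F), s
  have hf₀ : f₀ ∈ F := Submonoid.prod_mem _ fun s hs => (Finset.mem_filter.1 hs).2
  let V := U.left.basicOpen (X.α U (ψ f₀))
  let U₁ := restrictOpen U V
  let r : U₁ ⟶ U := restrictOpenι U V
  have hunit₀ : IsUnit (X.res r (ψ f₀)) := by
    refine isUnit_of_isUnit_α ?_
    rw [show X.α U₁ (X.res r (ψ f₀)) = _ from X.logStructure.α_res r _]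
    exact isUnit_appTop_ι _
  have hunit (p : P) (hp : p ∈ F) : IsUnit (X.res r (ψ p)) := by
    have : p ∈ Submonoid.closure (S : Set P) := hS ▸ Submonoid.mem_top p
    induction this using Submonoid.closure_induction with
    | mem s hs =>
      have : s ∣ f₀ := Finset.dvd_prod_of_mem _ (Finset.mem_filter.2 ⟨hs, hp⟩)
      exact isUnit_of_dvd_unit (map_dvd (X.res r) (map_dvd ψ this)) hunit₀
    | one => rw [map_one, map_one]; exact isUnit_one
    | mul a b _ _ ha hb =>
      rw [map_mul, map_mul]
      exact (ha (hF a b hp)).mul (hb (hF b a (by rwa [mul_comm])))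
  -- The twisted chart `φ₀` is trivial on `F` and so factors through the quotient by `F`.
  let χ : F →* (X.sections U₁)ˣ :=
    { toFun := fun f => (hunit f f.2).unit
      map_one' := Units.ext <| by
        change X.res r (ψ 1) = 1
        rw [map_one, map_one]
      map_mul' := fun a b => Units.ext <| by
        change X.res r (ψ (a * b)) = X.res r (ψ a) * X.res r (ψ b)
        rw [map_mul, map_mul] }
  obtain ⟨c, hc⟩ := exists_extension_of_face hP F hF χ⁻¹
  let φ₀ : P →* X.sections U₁ := ((X.res r).comp ψ) * (Units.coeHom _).comp c
  have hφ₀ (p : P) : φ₀ p = X.res r (ψ p) * c p := rfl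
  have hφ₀F (f : P) (hf : f ∈ F) : φ₀ f = 1 := by
    rw [hφ₀, hc ⟨f, hf⟩]
    exact (hunit f hf).mul_val_inv
  let φ : (faceCon F).Quotient →* X.sections U₁ := (faceCon F).lift φ₀ fun p q h => by
    obtain ⟨f, hf, g, hg, h⟩ := h
    have := congrArg φ₀ h
    rw [map_mul, map_mul, hφ₀F f hf, hφ₀F g hg, mul_one, mul_one] at this
    exact this
  have hφ (p : P) : φ p = X.res r (ψ p) * c p := rfl
  refine ⟨U₁, (⟨y, hf₀⟩ : V), _, inferInstance, φ, hy, inferInstance, inferInstance,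
    isSaturated_faceCon hP F, ⟨fun W h m z => ?_, fun W h p q w hw e z => ?_⟩, fun q hq => ?_⟩
  · obtain ⟨W', k, z', p, w, hz, hw, hk⟩ := hψ.locally_surjective W (h ≫ r) m z
    refine ⟨W', k, z', p, w * X.res (k ≫ h) ((c p)⁻¹ : (X.sections U₁)ˣ), hz,
      hw.mul ((c p)⁻¹.isUnit.map _), ?_⟩
    rw [hk, hφ, mul_assoc, ← map_mul, mul_left_comm, Units.inv_mul, mul_one]
    congr 1
    exact ((X.logStructure.res_res _ _ _).trans (by rw [Category.assoc])).symm
  · induction p using Con.induction_on with | _ p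
    induction q using Con.induction_on with | _ q
    rw [hφ, hφ, map_mul, map_mul] at e
    have e2 : X.res (h ≫ r) (ψ p) =
        (w * X.res h (c q) * X.res h ((c p)⁻¹ : (X.sections U₁)ˣ)) * X.res (h ≫ r) (ψ q) := by
      have h1 (p : P) : X.res (h ≫ r) (ψ p) = X.res h (X.res r (ψ p)) :=
        (X.logStructure.res_res _ _ _).symm
      have h2 : X.res h (c p) * X.res h ((c p)⁻¹ : (X.sections U₁)ˣ) = 1 := by
        rw [← map_mul, Units.mul_inv, map_one]
      rw [h1, h1, ← mul_one (X.res h (X.res r (ψ p))), ← h2, ← mul_assoc, e]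
      exact mul_mul_mul_eq₁ _ _ _ _
    obtain ⟨W', k, z', a, b, hz, ha, hb, hab, hw'⟩ := hψ.locally_injective W (h ≫ r) p q _
      ((hw.mul ((c q).isUnit.map _)).mul ((c p)⁻¹.isUnit.map _)) e2 z
    have h1 (p : P) : X.res (k ≫ h ≫ r) (ψ p) = X.res (k ≫ h) (X.res r (ψ p)) := by
      rw [← Category.assoc]
      exact (X.logStructure.res_res _ _ _).symm
    have h3 (m : X.sections U₁) : X.res k (X.res h m) = X.res (k ≫ h) m :=
      X.logStructure.res_res _ _ _
    refine ⟨W', k, z', a, b, hz, ?_, ?_, congrArg (fun x : P => (x : (faceCon F).Quotient)) hab,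
      ?_⟩
    · rw [hφ, map_mul, ← h1]
      exact ha.mul ((c a).isUnit.map _)
    · rw [hφ, map_mul, ← h1]
      exact hb.mul ((c b).isUnit.map _)
    · have h4 : ((c p)⁻¹ : (X.sections U₁)ˣ) * c q * c b = c a := by
        have := congrArg c hab
        rw [map_mul, map_mul] at this
        rw [mul_assoc, ← this, inv_mul_cancel_left]
      rw [hφ, hφ, map_mul, map_mul, ← h1, ← h1, hw', map_mul, map_mul, h3, h3, ← h4]
      simp only [Units.val_mul, map_mul]
      exact mul_mul_mul_eq₂ _ _ _ _ _
  · induction q using Con.induction_on with | _ p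
    refine coe_eq_one_of_mem ?_
    rw [hφ, map_mul, Scheme.basicOpen_mul] at hq
    have h1 := hq.1
    rw [show X.α U₁ (X.res r (ψ p)) = _ from X.logStructure.α_res r _] at h1
    exact (appTop_mem_basicOpen V.ι _ _).1 h1

end LogScheme

/-! ### Monoid algebras of sharp saturated monoids -/

section MonoidAlgebra

variable {Q : Type u} [CommMonoid Q] (κ : Type u) [Field κ]

open Classical in
/-- The character of a monoid without nontrivial units that vanishes outside `1`. -/
noncomputable def augmentationChar (hu : ∀ q : Q, IsUnit q → q = 1) : Q →* κ where
  toFun q := if q = 1 then 1 else 0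
  map_one' := if_pos rfl
  map_mul' p q := by
    by_cases hp : p = 1
    · simp [hp]
    · have : p * q ≠ 1 := fun h => hp (hu p (IsUnit.of_mul_eq_one q h))
      simp [hp, this]

/-- The homomorphism `κ[Q] → κ` that sends all elements of `Q` other than `1` to zero. -/
noncomputable def augmentation (hu : ∀ q : Q, IsUnit q → q = 1) : MonoidAlgebra κ Q →ₐ[κ] κ :=
  MonoidAlgebra.lift κ κ Q (augmentationChar κ hu)

variable {κ} {hu : ∀ q : Q, IsUnit q → q = 1}

lemma augmentation_single {q : Q} (hq : q ≠ 1) (r : κ) :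
    augmentation κ hu (MonoidAlgebra.single q r) = 0 := by
  rw [augmentation, MonoidAlgebra.lift_single]
  simp [augmentationChar, hq]

lemma augmentation_single_one (r : κ) :
    augmentation κ hu (MonoidAlgebra.single 1 r) = r := by
  rw [augmentation, MonoidAlgebra.lift_single]
  simp [augmentationChar]

lemma augmentation_surjective : Function.Surjective (augmentation κ hu) := fun r =>
  ⟨_, augmentation_single_one r⟩

/-- The augmentation ideal is generated by the elements of `Q` other than `1`. -/
lemma ker_augmentation_eq_span : RingHom.ker (augmentation κ hu) =
    Ideal.span ((fun q => MonoidAlgebra.single q 1) '' {q : Q | q ≠ 1}) := by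
  apply le_antisymm
  · have key (x : MonoidAlgebra κ Q) : x - MonoidAlgebra.single 1 (augmentation κ hu x) ∈
        Ideal.span ((fun q => MonoidAlgebra.single q (1 : κ)) '' {q : Q | q ≠ 1}) := by
      induction x using MonoidAlgebra.induction_linear with
      | zero => simp
      | add x y hx hy =>
        rw [map_add, MonoidAlgebra.single_add, add_sub_add_comm]
        exact add_mem hx hy
      | single q r =>
        by_cases hq : q = 1
        · subst hq
          simp [augmentation_single_one]
        · rw [augmentation_single hq, MonoidAlgebra.single_zero, sub_zero]
          have : MonoidAlgebra.single q r =
              MonoidAlgebra.single 1 r * MonoidAlgebra.single q (1 : κ) := by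
            rw [MonoidAlgebra.single_mul_single, one_mul, mul_one]
          rw [this]
          exact Ideal.mul_mem_left _ _ (Ideal.subset_span ⟨q, hq, rfl⟩)
    intro x hx
    have := key x
    rwa [show augmentation κ hu x = 0 from hx, MonoidAlgebra.single_zero, sub_zero] at this
  · rw [Ideal.span_le]
    rintro _ ⟨q, hq, rfl⟩
    exact augmentation_single hq 1

variable [IsCancelMul Q] [Monoid.FG Q]

lemma isMulTorsionFree_of_isSaturated (hQ : LogScheme.IsSaturated Q)
    (hu : ∀ q : Q, IsUnit q → q = 1) : IsMulTorsionFree Q := by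
  refine ⟨fun n hn a b h => ?_⟩
  change a ^ n = b ^ n at h
  obtain ⟨d, hd⟩ := hQ a b 1 n (Nat.pos_of_ne_zero hn) (by rw [h, mul_one])
  obtain ⟨e, he⟩ := hQ b a 1 n (Nat.pos_of_ne_zero hn) (by rw [h, mul_one])
  have h1 : d * e = 1 := by
    rw [he, mul_assoc] at hd
    have := mul_left_cancel ((mul_one a).trans hd)
    rw [mul_comm, ← this]
  rw [hd, hu d (IsUnit.of_mul_eq_one e h1), mul_one]

lemma isDomain_monoidAlgebra (hQ : LogScheme.IsSaturated Q) (hu : ∀ q : Q, IsUnit q → q = 1) :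
    IsDomain (MonoidAlgebra κ Q) := by
  have := isMulTorsionFree_of_isSaturated hQ hu
  let _ : CancelCommMonoid Q := { ‹CommMonoid Q›, ‹IsCancelMul Q› with }
  have h : TwoUniqueProds Q := AffineMonoid.to_twoUniqueProds
  exact inferInstance

/-- There is a homomorphism from `κ[Q]` that identifies two incomparable elements `p` and `q` of
`Q`, maps all elements of `Q` to units, and has kernel contained in the augmentation ideal. The
target is the group algebra of `Q^gp / (p / q)`; the augmentation is the coefficient at `1` in this
group algebra, because no power of `p / q` other than `1` lies in the saturated monoid `Q`. -/
lemma exists_ringHom_of_not_dvd (hQ : LogScheme.IsSaturated Q) {p q : Q} (hpq : ¬ p ∣ q)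
    (hqp : ¬ q ∣ p) :
    ∃ (B : Type u) (_ : CommRing B) (Φ : MonoidAlgebra κ Q →+* B),
      Φ (MonoidAlgebra.single p 1) = Φ (MonoidAlgebra.single q 1) ∧
      (∀ r : Q, IsUnit (Φ (MonoidAlgebra.single r 1))) ∧
      ∀ s, Φ s = 0 → augmentation κ hu s = 0 := by
  let ι : Q →* Algebra.GrothendieckGroup Q := Algebra.GrothendieckGroup.of
  have hι : Function.Injective ι := Algebra.GrothendieckGroup.of_injective
  let H := Algebra.GrothendieckGroup Q ⧸ Subgroup.zpowers (ι p / ι q)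
  let θ : Q →* H := (QuotientGroup.mk' _).comp ι
  have hθ (r : Q) (hr : θ r = 1) : r = 1 := by
    have h1 : ι r ∈ Subgroup.zpowers (ι p / ι q) := (QuotientGroup.eq_one_iff _).1 hr
    obtain ⟨n, hn⟩ := Subgroup.mem_zpowers_iff.1 h1
    have aux (a b : Q) (hab : ¬ b ∣ a) (k : ℕ) (h : (ι a / ι b) ^ k = ι r) : r = 1 := by
      rcases Nat.eq_zero_or_pos k with rfl | hk
      · exact hι (by rw [map_one, ← h, pow_zero])
      · exfalso
        refine hab (hQ a b r k hk (hι ?_))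
        rw [map_mul, ← h, map_pow, map_pow, div_pow, mul_div_cancel]
    rcases Int.eq_nat_or_neg n with ⟨k, rfl | rfl⟩
    · rw [zpow_natCast] at hn
      exact aux p q hqp k hn
    · rw [zpow_neg, ← inv_zpow, inv_div, zpow_natCast] at hn
      exact aux q p hpq k hn
  let Φ : MonoidAlgebra κ Q →ₐ[κ] MonoidAlgebra κ H :=
    MonoidAlgebra.lift κ _ Q ((MonoidAlgebra.of κ H).comp θ)
  have hΦ (r : Q) (c : κ) : Φ (MonoidAlgebra.single r c) = MonoidAlgebra.single (θ r) c := by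
    simp only [Φ, MonoidAlgebra.lift_single]
    simp
  refine ⟨MonoidAlgebra κ H, inferInstance, Φ.toRingHom, ?_, fun r => ?_, fun s hs => ?_⟩
  · change Φ _ = Φ _
    rw [hΦ, hΦ]
    congr 1
    refine (div_eq_one.1 ?_ : θ p = θ q)
    refine (map_div (QuotientGroup.mk' (Subgroup.zpowers (ι p / ι q))) (ι p) (ι q)).symm.trans ?_
    exact (QuotientGroup.eq_one_iff _).2 (Subgroup.mem_zpowers _)
  · change IsUnit (Φ _)
    rw [hΦ]
    exact (Group.isUnit (θ r)).map (MonoidAlgebra.of κ H)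
  · have key (s : MonoidAlgebra κ Q) : (Φ s).coeff 1 = augmentation κ hu s := by
      induction s using MonoidAlgebra.induction_linear with
      | zero => simp
      | add x y hx hy => rw [map_add, map_add, MonoidAlgebra.coeff_add, Finsupp.add_apply, hx, hy]
      | single r c =>
        classical
        rw [hΦ, MonoidAlgebra.coeff_single, Finsupp.single_apply]
        by_cases hr : r = 1
        · subst hr
          rw [map_one, if_pos rfl, augmentation_single_one]
        · rw [if_neg fun h => hr (hθ r h), augmentation_single hr]
    rw [← key]
    change (Φ s).coeff 1 = 0
    rw [show Φ s = 0 from hs]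
    simp

/-- If `Q` is sharp and saturated, and a power of the augmentation ideal of `κ[Q]` is principal
modulo the next power, so that `κ[Q]` is at most one-dimensional, then any two elements of `Q` are
comparable. For incomparable `p` and `q` there is a prime ideal over `p - q` strictly between zero
and the augmentation ideal. -/
theorem dvd_or_dvd_of_pow_le (hQ : LogScheme.IsSaturated Q) (hu : ∀ q : Q, IsUnit q → q = 1)
    {f : MonoidAlgebra κ Q} (hf : f ∈ RingHom.ker (augmentation κ hu)) (k : ℕ)
    (h : RingHom.ker (augmentation κ hu) ^ k ≤
      Ideal.span {f} ⊔ RingHom.ker (augmentation κ hu) ^ (k + 1)) (p q : Q) :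
    p ∣ q ∨ q ∣ p := by
  by_contra! hpq
  have := isDomain_monoidAlgebra (κ := κ) hQ hu
  have hnoeth : IsNoetherianRing (MonoidAlgebra κ Q) := Algebra.FiniteType.isNoetherianRing κ _
  set m := RingHom.ker (augmentation κ hu) with hm
  have hmax : m.IsMaximal := RingHom.ker_isMaximal_of_surjective _ augmentation_surjective
  -- By Nakayama's lemma, the augmentation ideal is minimal over `f`.
  have hmin : m ∈ (Ideal.span {f}).minimalPrimes := by
    obtain ⟨r, hr, hr'⟩ := Submodule.exists_sub_one_mem_and_smul_le_of_fg_of_le_sup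
      (I := m) (N := Ideal.span {f}) (N' := m ^ k) (IsNoetherian.noetherian _) le_rfl
      (by rw [smul_eq_mul, ← pow_succ']; exact h)
    refine ⟨⟨hmax.isPrime, (Ideal.span_singleton_le_iff_mem _).2 hf⟩, fun P ⟨hP, hfP⟩ hPm => ?_⟩
    have hrm : r ∉ P := fun hrP => hmax.ne_top <| (Ideal.eq_top_iff_one _).2 <| by
      have := sub_mem (hPm hrP) hr
      rwa [sub_sub_cancel] at this
    refine hP.le_of_pow_le (n := k) fun x hx => ?_
    have h1 : r * x ∈ Ideal.span {f} := hr' (Submodule.smul_mem_pointwise_smul x r _ hx)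
    exact (hP.mem_or_mem (hfP h1)).resolve_left hrm
  have hheight : m.height ≤ 1 := Ideal.height_le_one_of_isPrincipal_of_mem_minimalPrimes _ _ hmin
  obtain ⟨B, _, Φ, hΦ1, hΦ2, hΦ3⟩ :=
    exists_ringHom_of_not_dvd (κ := κ) (hu := hu) hQ hpq.1 hpq.2
  let x : MonoidAlgebra κ Q := MonoidAlgebra.single p 1
  -- There is a prime ideal over the kernel of `Φ` inside the augmentation ideal that avoids `p`:
  -- the image of `p` is a unit.
  obtain ⟨P, hP, hle, hdisj⟩ := Ideal.exists_le_prime_disjoint (RingHom.ker Φ)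
    (m.primeCompl ⊔ Submonoid.powers x) (by
      rw [Set.disjoint_left]
      intro y hy hy'
      obtain ⟨s, hs, _, ⟨n, rfl⟩, rfl⟩ := Submonoid.mem_sup.1 hy'
      refine hs (hΦ3 s ?_)
      have h1 : Φ (s * x ^ n) = 0 := hy
      rw [map_mul, map_pow] at h1
      exact ((hΦ2 p).pow n).mul_left_eq_zero.1 h1)
  have hPm : P ≤ m := fun y hy => by
    by_contra hym
    exact Set.disjoint_left.1 hdisj hy (Submonoid.mem_sup_left (S := m.primeCompl) hym)
  have hp1 : p ≠ 1 := fun h => hpq.1 (h ▸ one_dvd q)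
  have hPm' : P < m := lt_of_le_of_ne hPm fun h => by
    have hx : x ∈ P := h ▸ augmentation_single hp1 1
    exact Set.disjoint_left.1 hdisj hx (Submonoid.mem_sup_right (Submonoid.mem_powers x))
  have hP0 : (⊥ : Ideal (MonoidAlgebra κ Q)) < P := by
    refine bot_lt_iff_ne_bot.2 fun h => ?_
    have h1 : x - MonoidAlgebra.single q 1 ∈ P := hle (by
      rw [RingHom.mem_ker, map_sub, hΦ1, sub_self])
    rw [h, Ideal.mem_bot, sub_eq_zero, MonoidAlgebra.single_left_inj one_ne_zero] at h1
    exact hpq.1 (h1 ▸ dvd_rfl)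
  have h1 := Ideal.height_add_one_le_of_lt_of_isPrime hP0
  have h2 := Ideal.height_add_one_le_of_lt_of_isPrime hPm'
  have h3 : (1 : ℕ∞) + 1 ≤ 1 :=
    (add_le_add_left (le_trans (by simp) h1) 1).trans (h2.trans hheight)
  exact absurd h3 (by decide)

end MonoidAlgebra

/-! ### The lifting property on stalks -/

section Stalk

variable {Y : Scheme.{u}} (y : Y)

/-- The germ at `y` of a global function. -/
noncomputable def germTop : Γ(Y, ⊤) →+* Y.presheaf.stalk y :=
  (Y.presheaf.germ ⊤ y trivial).hom

lemma isUnit_germTop_iff (s : Γ(Y, ⊤)) : IsUnit (germTop y s) ↔ y ∈ Y.basicOpen s :=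
  (Y.mem_basicOpen s y trivial).symm

/-- The scalars in the stalk at `y` of a scheme over `Spec K`. -/
noncomputable def stalkScalar {K : Type u} [CommRing K] (p : Y ⟶ Spec (.of K)) :
    K →+* Y.presheaf.stalk y :=
  (Spec.preimage (Y.fromSpecStalk y ≫ p)).hom

lemma map_stalkScalar {K : Type u} [CommRing K] (p : Y ⟶ Spec (.of K)) :
    Spec.map (CommRingCat.ofHom (stalkScalar y p)) = Y.fromSpecStalk y ≫ p :=
  Spec.map_preimage _

variable {y} in
lemma appTop_map_fromSpecStalk {B : Type u} [CommRing B] (g : Y.presheaf.stalk y →+* B)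
    (s : Γ(Y, ⊤)) :
    (Spec.map (CommRingCat.ofHom g) ≫ Y.fromSpecStalk y).appTop s =
      (Scheme.ΓSpecIso (.of B)).inv (g (germTop y s)) := by
  rw [appTop_comp_apply, Scheme.fromSpecStalk_appTop]
  have h1 := Scheme.ΓSpecIso_inv_naturality (CommRingCat.ofHom g)
  have h2 := ConcreteCategory.congr_hom h1 (germTop y s)
  refine Eq.trans ?_ h2.symm
  change (Spec.map (CommRingCat.ofHom g)).appTop _ = (Spec.map (CommRingCat.ofHom g)).appTop _
  congr 1

lemma exists_eq_map_fromSpecStalk {B : Type u} [CommRing B] [IsLocalRing B]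
    (h : Spec (.of B) ⟶ Y) (hy : h (IsLocalRing.closedPoint B) = y) :
    ∃ g : Y.presheaf.stalk y →+* B, IsLocalHom g ∧
      h = Spec.map (CommRingCat.ofHom g) ≫ Y.fromSpecStalk y := by
  subst hy
  exact ⟨(Scheme.stalkClosedPointTo h).hom, inferInstance,
    (Scheme.Spec_stalkClosedPointTo_fromSpecStalk h).symm⟩

lemma map_fromSpecStalk_closedPoint {B : Type u} [CommRing B] [IsLocalRing B]
    (g : Y.presheaf.stalk y →+* B) [IsLocalHom g] :
    (Spec.map (CommRingCat.ofHom g) ≫ Y.fromSpecStalk y) (IsLocalRing.closedPoint B) = y := by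
  have : IsLocalHom (CommRingCat.ofHom g).hom := ‹_›
  refine (Scheme.Hom.comp_apply _ _ _).trans ?_
  refine (congrArg (Y.fromSpecStalk y) (Spec_closedPoint (f := CommRingCat.ofHom g))).trans ?_
  exact Scheme.fromSpecStalk_closedPoint

lemma map_fromSpecStalk_injective {B : Type u} [CommRing B] {g g' : Y.presheaf.stalk y →+* B}
    (h : Spec.map (CommRingCat.ofHom g) ≫ Y.fromSpecStalk y =
      Spec.map (CommRingCat.ofHom g') ≫ Y.fromSpecStalk y) : g = g' := by
  rw [cancel_mono] at h
  exact congrArg CommRingCat.Hom.hom (Spec.map_injective h)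

end Stalk

section Nilpotent

variable {B B' Ω : Type*} [CommRing B] [CommRing B']

lemma isNilpotent_ker_comp [CommRing Ω] (ρ : B' →+* Ω) (π : B →+* B')
    (hρ : IsNilpotent (RingHom.ker ρ)) (hπ : IsNilpotent (RingHom.ker π)) :
    IsNilpotent (RingHom.ker (ρ.comp π)) := by
  obtain ⟨n, hn⟩ := hρ
  obtain ⟨m, hm⟩ := hπ
  refine ⟨n * m, ?_⟩
  rw [pow_mul, Ideal.zero_eq_bot, ← le_bot_iff, ← Ideal.zero_eq_bot, ← hm]
  refine Ideal.pow_right_mono ?_ m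
  rw [← RingHom.comap_ker]
  refine (Ideal.le_comap_pow π n).trans ?_
  rw [hn]
  exact le_rfl

lemma isLocalRing_of_isNilpotent_ker [Field Ω] (ρ : B →+* Ω) (hρ : Function.Surjective ρ)
    (hn : IsNilpotent (RingHom.ker ρ)) : IsLocalRing B := by
  have hmax : (RingHom.ker ρ).IsMaximal := RingHom.ker_isMaximal_of_surjective ρ hρ
  obtain ⟨n, hn⟩ := hn
  refine IsLocalRing.of_unique_max_ideal ⟨RingHom.ker ρ, hmax, fun I hI => ?_⟩
  have h1 : RingHom.ker ρ ^ n ≤ I := by rw [hn]; exact bot_le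
  exact (hmax.eq_of_le hI.ne_top (hI.isPrime.le_of_pow_le h1)).symm

end Nilpotent

namespace LogScheme

variable {K : Type u} [Field K] {X : LogScheme.{u}} {f : X ⟶ trivial (Spec (.of K))}

/-- The germs at `y` of the functions in the image of a chart. -/
noncomputable def chartGerm {U : X.scheme.Etale} (y : U.left) {Q : Type u} [CommMonoid Q]
    (φ : Q →* X.sections U) : Q →* U.left.presheaf.stalk y :=
  (germTop y : Γ(U.left, ⊤) →* U.left.presheaf.stalk y).comp ((X.α U).comp φ)

/-- The scalars in the stalk at `y` of an étale scheme over a log scheme over `K`. -/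
noncomputable def scalar (f : X ⟶ trivial (Spec (.of K))) {U : X.scheme.Etale} (y : U.left) :
    K →+* U.left.presheaf.stalk y :=
  stalkScalar y (U.hom ≫ f.base)

lemma IsLogSmooth.exists_ringHom_of_sq_zero (hf : IsLogSmooth f) {U : X.scheme.Etale}
    {Q : Type u} [CommMonoid Q] [IsCancelMul Q] [Monoid.FG Q] {φ : Q →* X.sections U}
    (hφ : IsChart φ) (y : U.left) {B B' : Type u} [CommRing B] [CommRing B']
    [IsStrictPoint (Spec (.of B))] [IsStrictPoint (Spec (.of B'))] [IsLocalRing B]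
    [IsLocalRing B'] (π : B →+* B') (hπ : Function.Surjective π)
    (hsq : ∀ a b, π a = 0 → π b = 0 → a * b = 0) (β : Q →* B)
    (hβ : ∀ q, IsUnit (π (β q)) → q = 1) (g' : U.left.presheaf.stalk y →+* B') [IsLocalHom g']
    (v' : Q →* B'ˣ) (e : ∀ q, g' (chartGerm y φ q) = v' q * π (β q)) (c : K →+* B)
    (hc : π.comp c = g'.comp (scalar f y)) :
    ∃ (g : U.left.presheaf.stalk y →+* B) (v : Q →* Bˣ), IsLocalHom g ∧ π.comp g = g' ∧
      g.comp (scalar f y) = c ∧ (∀ q, g (chartGerm y φ q) = v q * β q) ∧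
      ∀ q, π (v q : B) = v' q := by
  let i : Spec (.of B') ⟶ Spec (.of B) := Spec.map (CommRingCat.ofHom π)
  have hi : IsClosedImmersion i := IsClosedImmersion.spec_of_surjective _ hπ
  have hiΓ (b : B) : i.appTop ((Scheme.ΓSpecIso (.of B)).inv b) =
      (Scheme.ΓSpecIso (.of B')).inv (π b) :=
    (ConcreteCategory.congr_hom (Scheme.ΓSpecIso_inv_naturality (CommRingCat.ofHom π)) b).symm
  have hinj : Function.Injective (Scheme.ΓSpecIso (.of B')).inv :=
    (ConcreteCategory.bijective_of_isIso (Scheme.ΓSpecIso (.of B')).inv).1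
  have hsurj : Function.Surjective (Scheme.ΓSpecIso (.of B)).inv :=
    (ConcreteCategory.bijective_of_isIso (Scheme.ΓSpecIso (.of B)).inv).2
  have hinj' : Function.Injective (Scheme.ΓSpecIso (.of B)).inv :=
    (ConcreteCategory.bijective_of_isIso (Scheme.ΓSpecIso (.of B)).inv).1
  let eB : B →+* Γ(Spec (.of B), ⊤) := (Scheme.ΓSpecIso (.of B)).inv.hom
  let eB' : B' →+* Γ(Spec (.of B'), ⊤) := (Scheme.ΓSpecIso (.of B')).inv.hom
  let eBi : Γ(Spec (.of B), ⊤) →+* B := (Scheme.ΓSpecIso (.of B)).hom.hom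
  have heB (b : B) : eBi (eB b) = b :=
    ConcreteCategory.congr_hom (Scheme.ΓSpecIso (.of B)).inv_hom_id b
  have heB2 (b) : eB (eBi b) = b :=
    ConcreteCategory.congr_hom (Scheme.ΓSpecIso (.of B)).hom_inv_id b
  have hunit (b : B') (hb : IsUnit (eB' b)) : IsUnit b := by
    have := hb.map (Scheme.ΓSpecIso (.of B')).hom.hom
    rwa [show (Scheme.ΓSpecIso (.of B')).hom.hom (eB' b) = b from
      ConcreteCategory.congr_hom (Scheme.ΓSpecIso (.of B')).inv_hom_id b] at this
  let h' : Spec (.of B') ⟶ U.left := Spec.map (CommRingCat.ofHom g') ≫ U.left.fromSpecStalk y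
  obtain ⟨h, v, hh, ht, hv, hvi⟩ := hf.exists_lift_of_isChart hφ i (by
      intro a b ha hb
      obtain ⟨a, rfl⟩ := hsurj a
      obtain ⟨b, rfl⟩ := hsurj b
      rw [hiΓ] at ha hb
      have ha' : π a = 0 := hinj (ha.trans (map_zero eB').symm)
      have hb' : π b = 0 := hinj (hb.trans (map_zero eB').symm)
      exact (map_mul eB a b).symm.trans ((congrArg eB (hsq a b ha' hb')).trans (map_zero eB)))
    ((eB : B →* _).comp β) (fun q hq => hβ q (hunit _ (by
      have := hiΓ (β q)
      exact this ▸ hq))) h' ((Units.map (eB' : B' →* _)).comp v') (fun q => by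
      refine (appTop_map_fromSpecStalk g' _).trans ?_
      refine (congrArg eB' (e q)).trans ((map_mul eB' _ _).trans ?_)
      exact congrArg (eB' (v' q : B') * ·) (hiΓ (β q)).symm) (Spec.map (CommRingCat.ofHom c)) (by
      rw [← Spec.map_comp, ← CommRingCat.ofHom_comp, hc, CommRingCat.ofHom_comp, Spec.map_comp]
      refine (congrArg (Spec.map (CommRingCat.ofHom g') ≫ ·)
        (map_stalkScalar y (U.hom ≫ f.base))).trans ?_
      simp only [h', Category.assoc]
      rfl)
  have hpt : h (IsLocalRing.closedPoint B) = y := by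
    have h1 := map_fromSpecStalk_closedPoint y g'
    change h' _ = y at h1
    rw [← hh] at h1
    refine Eq.trans (congrArg h ?_) ((Scheme.Hom.comp_apply i h _).symm.trans h1)
    exact (IsStrictPoint.subsingleton (T := Spec (.of B))).elim _ _
  obtain ⟨g, hg, rfl⟩ := exists_eq_map_fromSpecStalk y h hpt
  refine ⟨g, (Units.map (eBi : _ →* B)).comp v, hg, ?_, ?_, fun q => ?_, fun q => ?_⟩
  · apply map_fromSpecStalk_injective y
    refine Eq.trans ?_ hh
    rw [CommRingCat.ofHom_comp, Spec.map_comp, Category.assoc]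
  · refine congrArg CommRingCat.Hom.hom (Spec.map_injective (a₁ := CommRingCat.ofHom
      (g.comp (scalar f y))) (a₂ := CommRingCat.ofHom c) ?_)
    rw [← ht, CommRingCat.ofHom_comp, Spec.map_comp]
    refine (congrArg (Spec.map (CommRingCat.ofHom g) ≫ ·)
      (map_stalkScalar y (U.hom ≫ f.base))).trans ?_
    simp only [Category.assoc]
    rfl
  · have h1 := (appTop_map_fromSpecStalk g _).symm.trans (hv q)
    have h2 := congrArg eBi h1
    rw [map_mul] at h2
    exact (heB _).symm.trans (h2.trans (congrArg (eBi (v q : Γ(Spec (.of B), ⊤)) * ·) (heB (β q))))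
  · apply hinj
    refine (hiΓ _).symm.trans (Eq.trans ?_ (hvi q))
    exact congrArg i.appTop (heB2 _)

/-- The lifting property of log smooth morphisms on stalks, for surjections `B → B'` with nilpotent
kernel of local rings with nilpotent maximal ideal and separably closed residue field `Ω`. -/
theorem IsLogSmooth.exists_ringHom_of_isNilpotent (hf : IsLogSmooth f) {U : X.scheme.Etale}
    {Q : Type u} [CommMonoid Q] [IsCancelMul Q] [Monoid.FG Q] {φ : Q →* X.sections U}
    (hφ : IsChart φ) (y : U.left) {Ω : Type u} [Field Ω] [IsSepClosed Ω] {B' : Type u}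
    [CommRing B'] (ρ' : B' →+* Ω) (hρ : Function.Surjective ρ') (hn : IsNilpotent (RingHom.ker ρ'))
    (g' : U.left.presheaf.stalk y →+* B') (hg' : IsLocalHom g') (v' : Q →* B'ˣ)
    {B : Type u} [CommRing B] (π : B →+* B') (hπ : Function.Surjective π)
    (hπn : IsNilpotent (RingHom.ker π)) (β : Q →* B)
    (hβ : ∀ q, IsUnit (ρ' (π (β q))) → q = 1)
    (e : ∀ q, g' (chartGerm y φ q) = v' q * π (β q)) (c : K →+* B)
    (hc : π.comp c = g'.comp (scalar f y)) :
    ∃ (g : U.left.presheaf.stalk y →+* B) (v : Q →* Bˣ), IsLocalHom g ∧ π.comp g = g' ∧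
      g.comp (scalar f y) = c ∧ (∀ q, g (chartGerm y φ q) = v q * β q) ∧
      ∀ q, π (v q : B) = v' q := by
  obtain ⟨n, hn'⟩ := hπn
  have hn1 : RingHom.ker π ^ (n + 1) = 0 := by rw [pow_succ, hn', zero_mul]
  clear hn'
  have := IsStrictPoint.of_surjective ρ' hρ hn
  have := isLocalRing_of_isNilpotent_ker ρ' hρ hn
  induction n generalizing B with
  | zero =>
    rw [zero_add, pow_one] at hn1
    have hπn : IsNilpotent (RingHom.ker π) := ⟨1, by rw [pow_one, hn1]⟩
    have h1 := isNilpotent_ker_comp ρ' π hn hπn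
    have := IsStrictPoint.of_surjective (ρ'.comp π) (hρ.comp hπ) h1
    have := isLocalRing_of_isNilpotent_ker (ρ'.comp π) (hρ.comp hπ) h1
    refine hf.exists_ringHom_of_sq_zero hφ y π hπ (fun a b ha _ => ?_) β
      (fun q hq => hβ q (hq.map ρ')) g' v' e c hc
    have ha' : a ∈ RingHom.ker π := ha
    rw [hn1] at ha'
    rw [show a = 0 from ha', zero_mul]
  | succ n ih =>
    -- Lift to the quotient by `J`, where the induction hypothesis applies, and then to `B`, which
    -- is a square-zero extension of this quotient.
    let J := RingHom.ker π ^ (n + 1)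
    have hJ : J ≤ RingHom.ker π := Ideal.pow_le_self n.succ_ne_zero
    let π₁ : B ⧸ J →+* B' := Ideal.Quotient.lift J π hJ
    have hπ₁ : Function.Surjective π₁ := Ideal.Quotient.lift_surjective_of_surjective J hJ hπ
    have hker : RingHom.ker π₁ = (RingHom.ker π).map (Ideal.Quotient.mk J) :=
      Ideal.ker_quotient_lift π hJ
    have hker' : RingHom.ker π₁ ^ (n + 1) = 0 := by
      rw [hker, ← Ideal.map_pow]
      exact Ideal.map_quotient_self J
    obtain ⟨g₁, v₁, hg₁, h1, h2, h3, h4⟩ := ih π₁ hπ₁ ((Ideal.Quotient.mk J : B →* B ⧸ J).comp β)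
      hβ e ((Ideal.Quotient.mk J).comp c) hc hker'
    have hn₁ := isNilpotent_ker_comp ρ' π₁ hn ⟨_, hker'⟩
    have hn₂ := isNilpotent_ker_comp ρ' π hn ⟨_, hn1⟩
    have := IsStrictPoint.of_surjective (ρ'.comp π₁) (hρ.comp hπ₁) hn₁
    have := isLocalRing_of_isNilpotent_ker (ρ'.comp π₁) (hρ.comp hπ₁) hn₁
    have := IsStrictPoint.of_surjective (ρ'.comp π) (hρ.comp hπ) hn₂
    have := isLocalRing_of_isNilpotent_ker (ρ'.comp π) (hρ.comp hπ) hn₂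
    have hsq (a b : B) (ha : Ideal.Quotient.mk J a = 0) (hb : Ideal.Quotient.mk J b = 0) :
        a * b = 0 := by
      rw [Ideal.Quotient.eq_zero_iff_mem] at ha hb
      have h5 : a * b ∈ J * J := Ideal.mul_mem_mul ha hb
      have h6 : J * J ≤ RingHom.ker π ^ (n + 1 + 1) := by
        rw [← pow_add]
        exact Ideal.pow_le_pow_right (by omega)
      have h7 := h6 h5
      rwa [hn1] at h7
    obtain ⟨g, v, hg, e1, e2, e3, e4⟩ := hf.exists_ringHom_of_sq_zero hφ y (Ideal.Quotient.mk J)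
      Ideal.Quotient.mk_surjective hsq β
      (fun q hq => hβ q ((hq.map π₁).map ρ')) g₁ v₁ h3 c h2.symm
    refine ⟨g, v, hg, ?_, e2, e3, fun q => ?_⟩
    · rw [← h1, ← e1, ← RingHom.comp_assoc]
      rfl
    · rw [← h4, ← e4]
      rfl

end LogScheme

/-! ### Local rings of pure one-dimensional schemes -/

section Dimension

lemma coheight_le_one {X : Scheme.{u}}
    (hX : ∀ Z ∈ irreducibleComponents X, topologicalKrullDim Z = 1) (x : X) :
    Order.coheight x ≤ 1 := by
  refine Order.coheight_le fun p _ => ?_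
  let Z := irreducibleComponent p.last
  have hZ : IsClosed Z := isClosed_irreducibleComponent
  have hmem (i) : p i ∈ Z := by
    have h1 : p i ≤ p.last := p.monotone (Fin.le_last i)
    exact (Scheme.le_iff_specializes.1 h1).mem_closed hZ mem_irreducibleComponent
  let q : LTSeries Z := ⟨p.length, fun i => ⟨p i, hmem i⟩, fun i => p.step i⟩
  let F (z : Z) : TopologicalSpace.IrreducibleCloseds Z :=
    ⟨closure {z}, isIrreducible_singleton.closure, isClosed_closure⟩
  have hle {a b : Z} : F a ≤ F b ↔ a ≤ b := by
    refine Iff.trans ?_ (Iff.trans (Topology.IsInducing.subtypeVal.specializes_iff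
      (x := b) (y := a)).symm Scheme.le_iff_specializes.symm)
    exact specializes_iff_closure_subset.symm
  have hF : StrictMono F := fun a b h =>
    lt_of_le_not_ge (hle.2 h.le) (fun h' => h.not_ge (hle.1 h'))
  have h1 := Order.LTSeries.length_le_krullDim (q.map F hF)
  have h2 : Order.krullDim (TopologicalSpace.IrreducibleCloseds Z) = 1 :=
    hX Z (irreducibleComponent_mem_irreducibleComponents _)
  rw [h2] at h1
  exact_mod_cast h1

lemma one_le_coheight {X : Scheme.{u}}
    (hX : ∀ Z ∈ irreducibleComponents X, topologicalKrullDim Z = 1) {x : X}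
    (hx : IsClosed {x}) : 1 ≤ Order.coheight x := by
  rw [Order.one_le_iff_ne_zero, Ne, Order.coheight_eq_zero]
  intro hmax
  have hsub : irreducibleComponent x ⊆ {x} := by
    obtain ⟨η, hη⟩ := QuasiSober.sober (isIrreducible_irreducibleComponent (x := x))
      isClosed_irreducibleComponent
    have h1 : η ⤳ x := hη.specializes mem_irreducibleComponent
    have h2 : x ⤳ η := hmax (b := η) h1
    have h3 : irreducibleComponent x = closure {η} := hη.symm
    rw [h3, (h1.antisymm h2).eq, hx.closure_eq]
  have h := hX _ (irreducibleComponent_mem_irreducibleComponents x)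
  have : Subsingleton (irreducibleComponent x) :=
    ⟨fun a b => Subtype.ext ((hsub a.2).trans (hsub b.2).symm)⟩
  have h0 := topologicalKrullDim_zero_of_discreteTopology (irreducibleComponent x)
  rw [h] at h0
  exact absurd h0 (by decide)

lemma exists_maximalIdeal_pow_le_span (R : Type*) [CommRing R] [IsNoetherianRing R]
    [IsLocalRing R] (h : ringKrullDim R ≤ 1) :
    ∃ (e : R) (k : ℕ), e ∈ IsLocalRing.maximalIdeal R ∧
      IsLocalRing.maximalIdeal R ^ k ≤ Ideal.span {e} := by
  rw [← IsLocalRing.maximalIdeal_height_eq_ringKrullDim] at h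
  obtain ⟨s, hI, hs⟩ := Ideal.exists_finset_card_eq_height_of_isNoetherianRing
    (IsLocalRing.maximalIdeal R)
  have hs1 : s.card ≤ 1 := by
    rw [← hs] at h
    exact_mod_cast h
  obtain ⟨e, he, hIe⟩ : ∃ e ∈ IsLocalRing.maximalIdeal R,
      Ideal.span (s : Set R) = Ideal.span {e} := by
    obtain ⟨e, he⟩ := Finset.card_le_one_iff_subset_singleton.1 hs1
    obtain rfl | rfl := Finset.subset_singleton_iff.1 he
    · exact ⟨0, zero_mem _, by simp⟩
    · exact ⟨e, hI.1.2 (Ideal.subset_span (by simp)), by simp⟩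
  rw [hIe] at hI
  have hrad : IsLocalRing.maximalIdeal R ≤ (Ideal.span {e}).radical := by
    rw [Ideal.radical_eq_sInf]
    refine le_sInf fun J ⟨hJ, hJp⟩ => ?_
    exact hI.2 ⟨hJp, hJ⟩ (IsLocalRing.le_maximalIdeal hJp.ne_top)
  obtain ⟨k, hk⟩ := Ideal.exists_pow_le_of_le_radical_of_fg hrad
    (IsNoetherian.noetherian _)
  exact ⟨e, k, he, hk⟩

lemma map_maximalIdeal_stalkMap {U X : Scheme.{u}} (h : U ⟶ X) [Etale h] (y : U) :
    (IsLocalRing.maximalIdeal (X.presheaf.stalk (h y))).map (h.stalkMap y).hom =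
      IsLocalRing.maximalIdeal (U.presheaf.stalk y) := by
  algebraize [(h.stalkMap y).hom]
  have : IsLocalHom (algebraMap (X.presheaf.stalk (h y)) (U.presheaf.stalk y)) :=
    inferInstanceAs <| IsLocalHom (h.stalkMap y).hom
  have : Algebra.EssFiniteType (X.presheaf.stalk (h y)) (U.presheaf.stalk y) := by
    rw [← RingHom.essFiniteType_algebraMap, RingHom.algebraMap_toAlgebra]
    exact LocallyOfFiniteType.stalkMap h y
  have : Algebra.FormallyUnramified (X.presheaf.stalk (h y)) (U.presheaf.stalk y) := by
    rw [← RingHom.formallyUnramified_algebraMap, RingHom.algebraMap_toAlgebra]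
    exact FormallyUnramified.stalkMap h y
  exact Algebra.FormallyUnramified.map_maximalIdeal

lemma exists_maximalIdeal_stalk_pow_le_span {U X : Scheme.{u}} [IsLocallyNoetherian X]
    (hX : ∀ Z ∈ irreducibleComponents X, topologicalKrullDim Z = 1) (h : U ⟶ X) [Etale h] (y : U) :
    ∃ (e : U.presheaf.stalk y) (k : ℕ), e ∈ IsLocalRing.maximalIdeal (U.presheaf.stalk y) ∧
      IsLocalRing.maximalIdeal (U.presheaf.stalk y) ^ k ≤ Ideal.span {e} := by
  obtain ⟨e, k, he, hk⟩ := exists_maximalIdeal_pow_le_span (X.presheaf.stalk (h y)) (by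
    rw [ringKrullDim_stalk_eq_coheight]
    exact_mod_cast coheight_le_one hX (h y))
  refine ⟨h.stalkMap y e, k, ?_, ?_⟩
  · rw [← map_maximalIdeal_stalkMap h y]
    exact Ideal.mem_map_of_mem _ he
  · rw [← map_maximalIdeal_stalkMap h y, ← Ideal.map_pow]
    refine (Ideal.map_mono hk).trans ?_
    rw [Ideal.map_span, Set.image_singleton]

end Dimension

namespace LogScheme

variable {K : Type u} [Field K] {X : LogScheme.{u}} {f : X ⟶ trivial (Spec (.of K))}

/-- The embedding of the residue field at `y` in an algebraic closure, as a geometric point. -/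
noncomputable def geometricPoint {Y : Scheme.{u}} (y : Y) : Y.presheaf.stalk y →+*
    AlgebraicClosure (IsLocalRing.ResidueField (Y.presheaf.stalk y)) :=
  (algebraMap _ (AlgebraicClosure (IsLocalRing.ResidueField (Y.presheaf.stalk y)))).comp
    (IsLocalRing.residue (Y.presheaf.stalk y))

instance isLocalHom_geometricPoint {Y : Scheme.{u}} (y : Y) : IsLocalHom (geometricPoint y) :=
  RingHom.isLocalHom_comp _ _

/-- The monoid of a chart at a point where the local ring has dimension at most one is totally
ordered by divisibility: otherwise the monoid algebra would have dimension at least two at the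
vertex, but its truncations are quotients of the local ring of the curve, up to an extension of
scalars. -/
theorem IsLogSmooth.dvd_or_dvd (hf : IsLogSmooth f) {U : X.scheme.Etale} (y : U.left)
    {Q : Type u} [CommMonoid Q] [IsCancelMul Q] [Monoid.FG Q] (hQ : IsSaturated Q)
    {φ : Q →* X.sections U} (hφ : IsChart φ)
    (hy : ∀ q, y ∈ U.left.basicOpen (X.α U (φ q)) → q = 1)
    {d : U.left.presheaf.stalk y} {k : ℕ}
    (hd : d ∈ IsLocalRing.maximalIdeal (U.left.presheaf.stalk y))
    (hk : IsLocalRing.maximalIdeal (U.left.presheaf.stalk y) ^ k ≤ Ideal.span {d}) (p q : Q) :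
    p ∣ q ∨ q ∣ p := by
  let Ω := AlgebraicClosure (IsLocalRing.ResidueField (U.left.presheaf.stalk y))
  have hu (q : Q) (hq : IsUnit q) : q = 1 :=
    hy q ((isUnit_germTop_iff y _).1 (hq.map (chartGerm y φ)))
  have hm (q : Q) (hq : q ≠ 1) :
      chartGerm y φ q ∈ IsLocalRing.maximalIdeal (U.left.presheaf.stalk y) :=
    fun h => hq (hy q ((isUnit_germTop_iff y _).1 h))
  have hg0 (a) (ha : a ∈ IsLocalRing.maximalIdeal (U.left.presheaf.stalk y)) :
      geometricPoint y a = 0 := by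
    refine (congrArg (algebraMap _ Ω) ((IsLocalRing.residue_eq_zero_iff a).2 ha)).trans ?_
    exact map_zero _
  -- The geometric point at `y` lifts to the truncation of `Ω[Q]` in such a way that the chart is
  -- mapped to the tautological one up to units.
  let m := RingHom.ker (augmentation Ω hu)
  let mk := Ideal.Quotient.mk (m ^ (k + 1))
  have hle : m ^ (k + 1) ≤ m := Ideal.pow_le_self k.succ_ne_zero
  let π : MonoidAlgebra Ω Q ⧸ m ^ (k + 1) →+* Ω :=
    Ideal.Quotient.lift _ (augmentation Ω hu : MonoidAlgebra Ω Q →+* Ω) hle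
  have hπ (a) : π (mk a) = augmentation Ω hu a := rfl
  have hπs : Function.Surjective π := fun r => by
    obtain ⟨a, ha⟩ := augmentation_surjective (κ := Ω) (hu := hu) r
    exact ⟨mk a, ha⟩
  have hker : RingHom.ker π = m.map mk := Ideal.ker_quotient_lift _ hle
  let β : Q →* MonoidAlgebra Ω Q ⧸ m ^ (k + 1) :=
    (mk : MonoidAlgebra Ω Q →* _).comp (MonoidAlgebra.of Ω Q)
  have hβ0 (q : Q) (hq : q ≠ 1) : π (β q) = 0 := augmentation_single hq 1
  obtain ⟨g, v, -, h1, -, h2, -⟩ := hf.exists_ringHom_of_isNilpotent hφ y (RingHom.id Ω)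
    Function.surjective_id
    ⟨1, by rw [pow_one]; exact (RingHom.ker_eq_bot_iff_eq_zero _).2 fun _ => id⟩
    (geometricPoint y) inferInstance 1 π hπs ⟨k + 1, by
      rw [hker, ← Ideal.map_pow]; exact Ideal.map_quotient_self _⟩ β (fun q hq => by
      by_contra hq'
      rw [hβ0 q hq', map_zero] at hq
      exact not_isUnit_zero hq) (fun q => by
      by_cases hq : q = 1
      · subst hq
        simp
      · rw [hβ0 q hq, hg0 _ (hm q hq), mul_zero])
    ((mk.comp (algebraMap Ω _)).comp ((geometricPoint y).comp (scalar f y))) (by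
      refine RingHom.ext fun r => ?_
      exact augmentation_single_one _)
  obtain ⟨a, ha⟩ := Ideal.Quotient.mk_surjective (g d)
  have ham : a ∈ m := by
    have h3 : π (g d) = geometricPoint y d := RingHom.congr_fun h1 d
    rw [← ha, hg0 d hd] at h3
    exact h3
  refine dvd_or_dvd_of_pow_le hQ hu ham k ?_ p q
  -- The lift maps the maximal ideal at `y` onto generators of the augmentation ideal, so the `k`-th
  -- power of the latter is generated by the image of `d`, modulo the `(k + 1)`-st power.
  have h3 : m.map mk ≤ (IsLocalRing.maximalIdeal (U.left.presheaf.stalk y)).map g := by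
    refine (congrArg (Ideal.map mk) ker_augmentation_eq_span).trans_le ?_
    rw [Ideal.map_span, Ideal.span_le]
    rintro _ ⟨_, ⟨q, hq, rfl⟩, rfl⟩
    have h4 : mk (MonoidAlgebra.single q 1) = ((v q)⁻¹ : _ˣ) * g (chartGerm y φ q) := by
      rw [h2, Units.inv_mul_cancel_left]
      rfl
    refine Eq.symm h4 ▸ Ideal.mul_mem_left _ _ (Ideal.mem_map_of_mem g (hm q hq))
  have h4 : m ^ k ≤ (Ideal.span {mk a}).comap mk := by
    rw [← Ideal.map_le_iff_le_comap, Ideal.map_pow]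
    refine (Ideal.pow_right_mono h3 k).trans ?_
    rw [← Ideal.map_pow]
    refine (Ideal.map_mono hk).trans ?_
    rw [Ideal.map_span, Set.image_singleton]
    exact le_of_eq (by rw [← ha])
  refine h4.trans ?_
  rw [← Set.image_singleton, ← Ideal.map_span, Ideal.comap_map_of_surjective _
    Ideal.Quotient.mk_surjective]
  refine sup_le_sup_left ?_ _
  exact le_of_eq (Ideal.mk_ker (I := m ^ (k + 1)))

end LogScheme

/-! ### Infinitesimal lifting for the underlying scheme -/

section Powers

variable {Q : Type*} [CommMonoid Q] [IsCancelMul Q]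

lemma pow_injective_of_isUnit_imp (hu : ∀ q : Q, IsUnit q → q = 1) {t : Q} (ht : t ≠ 1) :
    Function.Injective (fun n : ℕ => t ^ n) := by
  have key (m n : ℕ) (hmn : m < n) (h : t ^ m = t ^ n) : False := by
    obtain ⟨k, rfl⟩ := Nat.exists_eq_add_of_lt hmn
    rw [add_assoc, pow_add] at h
    have h1 : t ^ (k + 1) = 1 := (mul_left_cancel ((mul_one _).trans h)).symm
    refine ht (hu t ?_)
    rw [pow_succ'] at h1
    exact IsUnit.of_mul_eq_one _ h1
  intro m n h
  rcases lt_trichotomy m n with h1 | h1 | h1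
  · exact (key m n h1 h).elim
  · exact h1
  · exact (key n m h1 h.symm).elim

/-- A monoid that is trivial or isomorphic to `ℕ` is projective. -/
lemma exists_monoidHom_lift (hu : ∀ q : Q, IsUnit q → q = 1) {t : Q}
    (ht : ∀ p, ∃ n : ℕ, p = t ^ n) {B B' : Type*} [CommMonoid B] [CommMonoid B'] (π : B →* B')
    (hπ : Function.Surjective π) (γ : Q →* B') : ∃ β : Q →* B, ∀ q, π (β q) = γ q := by
  by_cases h : t = 1
  · refine ⟨1, fun q => ?_⟩
    obtain ⟨n, rfl⟩ := ht q
    simp [h]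
  · choose N hN using ht
    have hinj := pow_injective_of_isUnit_imp hu h
    obtain ⟨b, hb⟩ := hπ (γ t)
    refine ⟨⟨⟨fun q => b ^ N q, ?_⟩, fun p q => ?_⟩, fun q => ?_⟩
    · rw [show N 1 = 0 from hinj (by simp only [← hN, pow_zero]), pow_zero]
    · change b ^ N (p * q) = b ^ N p * b ^ N q
      rw [← pow_add]
      congr 1
      refine hinj ?_
      simp only [pow_add, ← hN]
    · change π (b ^ N q) = _
      rw [map_pow, hb, ← map_pow, ← hN]

end Powers

namespace LogScheme

variable {K : Type u} [Field K] {X : LogScheme.{u}} {f : X ⟶ trivial (Spec (.of K))}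

/-- Charts of log smooth curves: every point has an étale neighbourhood with a chart by a monoid
that is trivial or free on one element `t`, and `t` vanishes at the point in the latter case. -/
theorem IsLogSmoothCurve.exists_chart (hf : IsLogSmoothCurve f) (x : X.scheme) :
    ∃ (U : X.scheme.Etale) (y : U.left) (Q : Type u) (_ : CommMonoid Q) (φ : Q →* X.sections U)
      (t : Q), U.hom y = x ∧ Monoid.FG Q ∧ IsCancelMul Q ∧ IsChart φ ∧
      (∀ q, y ∈ U.left.basicOpen (X.α U (φ q)) → q = 1) ∧ ∀ p, ∃ n : ℕ, p = t ^ n := by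
  obtain ⟨U, y, Q, _, φ, hy, hQ1, hQ2, hQ3, hφ, hφy⟩ := hf.fs.exists_sharp_chart x
  have := hf.logSmooth.locallyOfFinitePresentation
  have : IsLocallyNoetherian (trivial (Spec (.of K))).scheme :=
    inferInstanceAs (IsLocallyNoetherian (Spec (.of K)))
  have : IsLocallyNoetherian X.scheme := LocallyOfFiniteType.isLocallyNoetherian f.base
  have : Etale U.hom := U.prop
  obtain ⟨e, k, he, hk⟩ := exists_maximalIdeal_stalk_pow_le_span hf.pureDimensionOne U.hom y
  have hu (q : Q) (hq : IsUnit q) : q = 1 :=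
    hφy q ((isUnit_germTop_iff y _).1 (hq.map (chartGerm y φ)))
  rcases eq_one_or_exists_generator hu (hf.logSmooth.dvd_or_dvd y hQ3 hφ hφy he hk) with
    h1 | ⟨t, -, ht⟩
  · exact ⟨U, y, Q, _, φ, 1, hy, hQ1, hQ2, hφ, hφy, fun p => ⟨0, by rw [h1 p, pow_zero]⟩⟩
  · exact ⟨U, y, Q, _, φ, t, hy, hQ1, hQ2, hφ, hφy, ht⟩

lemma stalkMap_comp_stalkScalar {Y Z : Scheme.{u}} (h : Y ⟶ Z) (p : Z ⟶ Spec (.of K)) (y : Y) :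
    (h.stalkMap y).hom.comp (stalkScalar (h y) p) = stalkScalar y (h ≫ p) := by
  refine congrArg CommRingCat.Hom.hom (Spec.map_injective
    (a₁ := CommRingCat.ofHom ((h.stalkMap y).hom.comp (stalkScalar (h y) p)))
    (a₂ := CommRingCat.ofHom (stalkScalar y (h ≫ p))) ?_)
  rw [map_stalkScalar, CommRingCat.ofHom_comp, Spec.map_comp, map_stalkScalar]
  refine (Category.assoc _ _ _).symm.trans ?_
  refine (congrArg (· ≫ p) (Scheme.SpecMap_stalkMap_fromSpecStalk h (x := y))).trans ?_
  exact Category.assoc _ _ _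

lemma comp_stalkMap_eq {Y Z : Scheme.{u}} (h : Y ⟶ Z) (y : Y) {B : Type u} [CommRing B]
    {g : Y.presheaf.stalk y →+* B} {g' : Z.presheaf.stalk (h y) →+* B}
    (e : (Spec.map (CommRingCat.ofHom g) ≫ Y.fromSpecStalk y) ≫ h =
      Spec.map (CommRingCat.ofHom g') ≫ Z.fromSpecStalk (h y)) :
    g.comp (h.stalkMap y).hom = g' := by
  apply map_fromSpecStalk_injective
  rw [← e, CommRingCat.ofHom_comp, Spec.map_comp, Category.assoc, Category.assoc]
  exact congrArg (Spec.map (CommRingCat.ofHom g) ≫ ·)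
    (Scheme.SpecMap_stalkMap_fromSpecStalk h (x := y))

/-- The local rings of a log smooth curve satisfy the classical infinitesimal lifting property for
local rings with nilpotent maximal ideal and separably closed residue field: given a classical
lifting problem, the log structures can be chosen so as to obtain a logarithmic one. -/
theorem IsLogSmoothCurve.exists_ringHom (hf : IsLogSmoothCurve f) (x : X.scheme) {Ω : Type u}
    [Field Ω] [IsSepClosed Ω] {B' : Type u} [CommRing B'] (ρ' : B' →+* Ω)
    (hρ : Function.Surjective ρ') (hn : IsNilpotent (RingHom.ker ρ'))
    (g' : X.scheme.presheaf.stalk x →+* B') (hg' : IsLocalHom g') {B : Type u} [CommRing B]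
    (π : B →+* B') (hπ : Function.Surjective π) (hπn : IsNilpotent (RingHom.ker π)) (c : K →+* B)
    (hc : π.comp c = g'.comp (stalkScalar x f.base)) :
    ∃ g : X.scheme.presheaf.stalk x →+* B, π.comp g = g' ∧ g.comp (stalkScalar x f.base) = c := by
  obtain ⟨U, y, Q, _, φ, t, hy, hQ1, hQ2, hφ, hφy, ht⟩ := hf.exists_chart x
  have hu (q : Q) (hq : IsUnit q) : q = 1 :=
    hφy q ((isUnit_germTop_iff y _).1 (hq.map (chartGerm y φ)))
  have := IsStrictPoint.of_surjective ρ' hρ hn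
  have := isLocalRing_of_isNilpotent_ker ρ' hρ hn
  have : Etale U.hom := U.prop
  -- The lifting problem at `x` is transferred to the étale neighbourhood `U`.
  obtain ⟨h, hh, hhy⟩ := IsStrictPoint.exists_lift U.hom
    (Spec.map (CommRingCat.ofHom g') ≫ X.scheme.fromSpecStalk x) y (IsLocalRing.closedPoint B')
    (hy.trans (map_fromSpecStalk_closedPoint x g').symm)
  obtain ⟨g₁, hg₁, rfl⟩ := exists_eq_map_fromSpecStalk y h (hhy _)
  subst hy
  have hg₁' : g₁.comp (U.hom.stalkMap y).hom = g' := comp_stalkMap_eq U.hom y hh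
  have hsc : (U.hom.stalkMap y).hom.comp (stalkScalar (U.hom y) f.base) = scalar f y :=
    stalkMap_comp_stalkScalar _ _ _
  -- The log structures on the test objects: `Spec B'` carries the pullback of the one of `X`, which
  -- extends to `Spec B` since the monoid of the chart is projective.
  obtain ⟨β, hβ⟩ := exists_monoidHom_lift hu ht (π : B →* B') hπ
    ((g₁ : _ →* B').comp (chartGerm y φ))
  have hunit (q : Q) (hq : IsUnit (ρ' (g₁ (chartGerm y φ q)))) : q = 1 := by
    have hl : IsLocalHom ρ' := hρ.isLocalHom _
    exact hφy q ((isUnit_germTop_iff y _).1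
      (isUnit_of_map_unit g₁ _ (isUnit_of_map_unit ρ' _ hq)))
  obtain ⟨g, -, -, h1, h2, -, -⟩ := hf.logSmooth.exists_ringHom_of_isNilpotent hφ y ρ' hρ hn g₁ hg₁
    1 π hπ hπn β (fun q hq => hunit q (by
      rw [show π (β q) = g₁ (chartGerm y φ q) from hβ q] at hq
      exact hq)) (fun q => by
      rw [show π (β q) = g₁ (chartGerm y φ q) from hβ q]
      simp) c (by
      rw [hc, ← hg₁', RingHom.comp_assoc, hsc])
  exact ⟨g.comp (U.hom.stalkMap y).hom, by rw [← RingHom.comp_assoc, h1, hg₁'],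
    by rw [RingHom.comp_assoc, hsc, h2]⟩

end LogScheme

/-! ### Formal smoothness from infinitesimal lifting at a geometric point -/

section FormallySmooth

open TensorProduct

lemma mem_mul_of_forall_mem_sup_pow {R : Type*} [CommRing R] [IsNoetherianRing R] {J M : Ideal R}
    {w : R} (hw : w ∈ J) (h : ∀ n : ℕ, w ∈ J * M ⊔ M ^ (n + 1)) : w ∈ J * M := by
  let q := Ideal.Quotient.mk (J * M)
  have hq : Function.Surjective q := Ideal.Quotient.mk_surjective
  have h1 : q w ∈ (⨅ i : ℕ, (M.map q) ^ i • ⊤ : Submodule (R ⧸ J * M) (R ⧸ J * M)) := by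
    rw [Submodule.mem_iInf]
    intro i
    rw [smul_eq_mul, Ideal.mul_top]
    have h2 : q w ∈ (J * M ⊔ M ^ (i + 1)).map q := Ideal.mem_map_of_mem q (h i)
    rw [Ideal.map_sup, Ideal.map_quotient_self, bot_sup_eq, Ideal.map_pow] at h2
    exact Ideal.pow_le_pow_right i.le_succ h2
  obtain ⟨⟨r, hr⟩, hrw⟩ := (Ideal.mem_iInf_smul_pow_eq_bot_iff _ _).1 h1
  obtain ⟨r, hrM, rfl⟩ := (Ideal.mem_map_iff_of_surjective q hq).1 hr
  have h3 : r * w - w ∈ J * M := Ideal.Quotient.eq.1 hrw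
  have h4 : r * w ∈ J * M := by
    rw [mul_comm r w]
    exact Ideal.mul_mem_mul hw hrM
  exact (Submodule.sub_mem_iff_right _ h4).1 h3

variable {P R Ω : Type*} [CommRing P] [CommRing R] [Algebra P R] [CommRing Ω] [Algebra P Ω]
  (ε : R →ₐ[P] Ω)

lemma eq_zero_of_rTensor_eq_zero (hε : Function.Surjective ε) {N T : Type*} [AddCommGroup N]
    [Module P N] [AddCommGroup T] [Module P T] (Λ : R ⊗[P] N →ₗ[P] T)
    (hΛ : ∀ m n, ε m = 0 → Λ (m ⊗ₜ n) = 0) {u : R ⊗[P] N}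
    (hu : ε.toLinearMap.rTensor N u = 0) : Λ u = 0 := by
  have h1 : Function.Exact (LinearMap.ker ε.toLinearMap).subtype ε.toLinearMap :=
    LinearMap.exact_subtype_ker_map _
  obtain ⟨v, rfl⟩ := (rTensor_exact N h1 hε u).1 hu
  induction v with
  | zero => simp
  | add x y hx hy =>
    rw [map_add, map_add, hx (by
      exact (rTensor_exact N h1 hε _).2 ⟨x, rfl⟩), hy (by
      exact (rTensor_exact N h1 hε _).2 ⟨y, rfl⟩), add_zero]
  | tmul m n => exact hΛ _ _ m.2

/-- For `J` an ideal of `P` and `R` flat over `P`, the map `Ω ⊗ J → J R / J R M` is injective,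
where `M` is the kernel of `R → Ω`. -/
lemma rTensor_eq_zero_of_mem_mul [Module.Flat P R] (J : Ideal P) {z : R ⊗[P] J}
    (hz : TensorProduct.rid P R (J.subtype.lTensor R z) ∈
      J.map (algebraMap P R) * RingHom.ker ε) : ε.toLinearMap.rTensor J z = 0 := by
  have hinj : Function.Injective (J.subtype.lTensor R) :=
    Module.Flat.lTensor_preserves_injective_linearMap _ J.injective_subtype
  have key : ∀ w ∈ J.map (algebraMap P R), ∀ m : R, m ∈ RingHom.ker ε →
      ∃ y : R ⊗[P] J, TensorProduct.rid P R (J.subtype.lTensor R y) = w * m ∧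
        ε.toLinearMap.rTensor J y = 0 := by
    intro w hw m hm
    induction hw using Submodule.span_induction with
    | mem w hw =>
      obtain ⟨j, hj, rfl⟩ := hw
      refine ⟨m ⊗ₜ ⟨j, hj⟩, ?_, ?_⟩
      · simp [Algebra.smul_def]
      · rw [LinearMap.rTensor_tmul]
        rw [show ε.toLinearMap m = 0 from hm, zero_tmul]
    | zero => exact ⟨0, by simp, by simp⟩
    | add a b _ _ ha hb =>
      obtain ⟨y, hy, hy'⟩ := ha
      obtain ⟨y₁, hy₁, hy₁'⟩ := hb
      exact ⟨y + y₁, by simp only [map_add, hy, hy₁, add_mul], by rw [map_add, hy', hy₁', add_zero]⟩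
    | smul r a _ ha =>
      obtain ⟨y, hy, hy'⟩ := ha
      refine ⟨r • y, ?_, ?_⟩
      · have h1 (y : R ⊗[P] J) : TensorProduct.rid P R (J.subtype.lTensor R (r • y)) =
            r * TensorProduct.rid P R (J.subtype.lTensor R y) := by
          induction y with
          | zero => simp
          | add a b ha hb => simp only [smul_add, map_add, ha, hb, mul_add]
          | tmul a b => simp [smul_tmul']
        rw [h1, hy, smul_eq_mul, mul_assoc]
      · have h1 (y : R ⊗[P] J) : ε.toLinearMap.rTensor J (r • y) =
            (ε r) • ε.toLinearMap.rTensor J y := by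
          induction y with
          | zero => simp
          | add a b ha hb => simp only [smul_add, map_add, ha, hb]
          | tmul a b => simp [smul_tmul']
        rw [h1, hy', smul_zero]
  have key2 : ∀ w ∈ J.map (algebraMap P R) * RingHom.ker ε,
      ∃ y : R ⊗[P] J, TensorProduct.rid P R (J.subtype.lTensor R y) = w ∧
        ε.toLinearMap.rTensor J y = 0 := by
    intro w hw
    induction hw using Submodule.mul_induction_on' with
    | mem_mul_mem m hm n hn => exact key m hm n hn
    | add a _ b _ ha hb =>
      obtain ⟨y, hy, hy'⟩ := ha
      obtain ⟨y₁, hy₁, hy₁'⟩ := hb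
      exact ⟨y + y₁, by simp only [map_add, hy, hy₁], by rw [map_add, hy', hy₁', add_zero]⟩
  obtain ⟨y, hy, hy'⟩ := key2 _ hz
  rwa [hinj ((TensorProduct.rid P R).injective hy)] at hy'

/-- The infinitesimal lifting property of a `K`-algebra `S` at a geometric point `S → Ω`, for
local rings with nilpotent maximal ideal and residue field `Ω`. -/
def LiftsAt (K S Ω : Type u) [Field K] [CommRing S] [Algebra K S] [Field Ω] [Algebra S Ω] : Prop :=
  ∀ (B' : Type u) [CommRing B'] (ρ' : B' →+* Ω), Function.Surjective ρ' →
    IsNilpotent (RingHom.ker ρ') → ∀ g' : S →+* B', ρ'.comp g' = algebraMap S Ω →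
    ∀ (B : Type u) [CommRing B] (π : B →+* B'), Function.Surjective π →
    IsNilpotent (RingHom.ker π) → ∀ c : K →+* B, π.comp c = g'.comp (algebraMap K S) →
    ∃ g : S →+* B, π.comp g = g' ∧ g.comp (algebraMap K S) = c

/-- The main step of the Jacobian criterion `formallySmooth_of_liftsAt`. For `S = P / J`, and with
`J` and `M` the ideals in a flat `P`-algebra `R` generated by `J` and the kernel of `R → Ω`, the
ring `R / (J + M ^ (n + 1))` is a test object. A lift of `S` to `R / (J M + M ^ (n + 1))` yields a
derivation of `P` that extends the negative of the natural map `J → J / (J M + J ∩ M ^ (n + 1))`. -/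
lemma mem_sup_pow_of_cotangentComplex_eq_zero {K S Ω P R : Type u} [Field K] [CommRing S]
    [Algebra K S] [Field Ω] [Algebra S Ω] [CommRing P] [Algebra K P] [Algebra P S]
    [IsScalarTower K P S] [Algebra P Ω] [IsScalarTower P S Ω]
    [CommRing R] [Algebra P R] [Algebra K R] [IsScalarTower K P R]
    (H : LiftsAt K S Ω) (h₁ : Function.Surjective (algebraMap P S))
    (ε : R →ₐ[P] Ω) (hε : Function.Surjective ε)
    {z : R ⊗[P] RingHom.ker (algebraMap P S)}
    (hz : KaehlerDifferential.cotangentComplexBaseChange K S P Ω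
      (ε.toLinearMap.rTensor _ z) = 0) (n : ℕ) :
    TensorProduct.rid P R ((RingHom.ker (algebraMap P S)).subtype.lTensor R z) ∈
      (RingHom.ker (algebraMap P S)).map (algebraMap P R) * RingHom.ker ε ⊔
        RingHom.ker ε ^ (n + 1) := by
  let J := RingHom.ker (algebraMap P S)
  let JR := J.map (algebraMap P R)
  let M := RingHom.ker ε
  have hJM : JR ≤ M := by
    refine Ideal.map_le_iff_le_comap.2 fun j hj => ?_
    change ε (algebraMap P R j) = 0
    rw [AlgHom.commutes, IsScalarTower.algebraMap_apply P S Ω, show algebraMap P S j = 0 from hj,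
      map_zero]
  have hMM : M ^ (n + 1) ≤ M := Ideal.pow_le_self n.succ_ne_zero
  let L := JR * M ⊔ M ^ (n + 1)
  let T := R ⧸ L
  let mk : R →+* T := Ideal.Quotient.mk L
  have hL : L ≤ M := sup_le Ideal.mul_le_right hMM
  -- The square-zero ideal `I` of `T = R / (J M + M ^ (n + 1))` is killed by `M`.
  let I : Ideal T := (JR ⊔ M ^ (n + 1)).map mk
  have hIM (i : T) (hi : i ∈ I) (m : R) (hm : m ∈ M) : mk m * i = 0 := by
    obtain ⟨i, hi', rfl⟩ := (Ideal.mem_map_iff_of_surjective mk Ideal.Quotient.mk_surjective).1 hi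
    rw [← map_mul]
    refine Ideal.Quotient.eq_zero_iff_mem.2 ?_
    rw [mul_comm]
    have h1 := Ideal.mul_mem_mul hi' hm
    rw [Ideal.sup_mul] at h1
    have h2 : JR * M ⊔ M ^ (n + 1) * M ≤ L := sup_le_sup le_rfl Ideal.mul_le_left
    exact h2 h1
  have hIle : I ≤ M.map mk := Ideal.map_mono (sup_le hJM hMM)
  have hI2 : I ^ 2 = ⊥ := by
    rw [pow_two, eq_bot_iff, Ideal.mul_le]
    intro a ha b hb
    obtain ⟨a, ha', rfl⟩ := (Ideal.mem_map_iff_of_surjective mk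
      Ideal.Quotient.mk_surjective).1 (hIle ha)
    exact (Ideal.mem_bot).2 (hIM b hb a ha')
  let T' := T ⧸ I
  let π : T →+* T' := Ideal.Quotient.mk I
  let ρ : T →+* Ω := Ideal.Quotient.lift L (ε : R →+* Ω) hL
  have hρI : ∀ i ∈ I, ρ i = 0 := by
    intro i hi
    obtain ⟨i, hi', rfl⟩ := (Ideal.mem_map_iff_of_surjective mk
      Ideal.Quotient.mk_surjective).1 (hIle hi)
    exact hi'
  let ρ' : T' →+* Ω := Ideal.Quotient.lift I ρ hρI
  have hρ' : Function.Surjective ρ' := fun ω => by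
    obtain ⟨r, rfl⟩ := hε ω
    exact ⟨π (mk r), rfl⟩
  have hn : IsNilpotent (RingHom.ker ρ') := by
    refine ⟨n + 1, ?_⟩
    have h1 : RingHom.ker ρ' ≤ M.map (π.comp mk) := by
      intro a ha
      obtain ⟨a, rfl⟩ := Ideal.Quotient.mk_surjective a
      obtain ⟨a, rfl⟩ := Ideal.Quotient.mk_surjective a
      exact Ideal.mem_map_of_mem (π.comp mk) ha
    refine le_bot_iff.1 ((Ideal.pow_right_mono h1 _).trans ?_)
    rw [← Ideal.map_pow, Ideal.map_le_iff_le_comap]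
    intro a ha
    refine (Ideal.mem_bot).2 ?_
    refine (congrArg π (Ideal.Quotient.eq_zero_iff_mem.2 ?_)).trans (map_zero π)
    exact (le_sup_right : M ^ (n + 1) ≤ L) ha
  have hker : ∀ j ∈ J, (π.comp (mk.comp (algebraMap P R))) j = 0 := fun j hj => by
    refine Ideal.Quotient.eq_zero_iff_mem.2 ?_
    exact Ideal.mem_map_of_mem mk ((le_sup_left : JR ≤ _) (Ideal.mem_map_of_mem _ hj))
  let g' : S →+* T' := (algebraMap P S).liftOfRightInverse (Function.surjInv h₁)
    (Function.rightInverse_surjInv h₁) ⟨π.comp (mk.comp (algebraMap P R)), hker⟩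
  have hg' (p : P) : g' (algebraMap P S p) = π (mk (algebraMap P R p)) :=
    RingHom.liftOfRightInverse_comp_apply _ _ _ _ _
  obtain ⟨g, hg, hgc⟩ := H T' ρ' hρ' hn g' (by
      refine RingHom.ext fun s => ?_
      obtain ⟨p, rfl⟩ := h₁ s
      rw [RingHom.comp_apply, hg', ← IsScalarTower.algebraMap_apply]
      exact ε.commutes p) T π Ideal.Quotient.mk_surjective
    ⟨2, by rw [Ideal.mk_ker]; exact hI2⟩ (algebraMap K T) (by
      refine RingHom.ext fun r => ?_
      rw [RingHom.comp_apply, RingHom.comp_apply, IsScalarTower.algebraMap_apply K P S, hg',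
        ← IsScalarTower.algebraMap_apply K P R]
      rfl)
  let a : P →ₐ[K] T := ⟨g.comp (algebraMap P S), fun r => by
    change g (algebraMap P S (algebraMap K P r)) = _
    rw [← IsScalarTower.algebraMap_apply K P S]
    exact RingHom.congr_fun hgc r⟩
  -- The difference of the lift and the natural map `P → T`.
  let D : Derivation K P I := derivationToSquareZeroOfLift I hI2 a (by
    ext p
    exact (RingHom.congr_fun hg (algebraMap P S p)).trans (hg' p))
  have hD (j : P) (hj : j ∈ J) : (D j : T) = - mk (algebraMap P R j) := by
    refine (derivationToSquareZeroOfLift_apply I hI2 a _ j).trans ?_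
    have h1 : a j = 0 := (congrArg g (show algebraMap P S j = 0 from hj)).trans (map_zero g)
    rw [h1, zero_sub]
    rfl
  -- `Λ` factors through `Ω ⊗ Ω[P⁄K]` since `M` kills `I`, and its composition with `J → Ω[P⁄K]` is
  -- the negative of the natural map.
  let Λ : R ⊗[P] Ω[P⁄K] →ₗ[R] T :=
    ((I.subtype.restrictScalars P) ∘ₗ D.liftKaehlerDifferential).liftBaseChange R
  have hΛ (r : R) (w : Ω[P⁄K]) : Λ (r ⊗ₜ w) = mk r * (D.liftKaehlerDifferential w : T) := by
    refine (LinearMap.liftBaseChange_tmul _ _ _ _).trans ?_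
    exact Algebra.smul_def _ _
  have key (z : R ⊗[P] J) : ∃ u : R ⊗[P] Ω[P⁄K], ε.toLinearMap.rTensor _ u =
      KaehlerDifferential.cotangentComplexBaseChange K S P Ω (ε.toLinearMap.rTensor _ z) ∧
      Λ u = - mk (TensorProduct.rid P R (J.subtype.lTensor R z)) := by
    induction z with
    | zero => exact ⟨0, by simp, by simp⟩
    | add x y hx hy =>
      obtain ⟨u, hu, hu'⟩ := hx
      obtain ⟨v, hv, hv'⟩ := hy
      exact ⟨u + v, by simp only [map_add, hu, hv], by simp only [map_add, hu', hv', neg_add]⟩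
    | tmul r j =>
      refine ⟨r ⊗ₜ KaehlerDifferential.D K P j, ?_, ?_⟩
      · rw [LinearMap.rTensor_tmul, LinearMap.rTensor_tmul,
          KaehlerDifferential.cotangentComplexBaseChange_tmul,
          KaehlerDifferential.kerToTensor_apply, smul_tmul', smul_eq_mul, mul_one]
      · rw [hΛ, Derivation.liftKaehlerDifferential_comp_D, hD j j.2, mul_neg, ← map_mul]
        congr 2
        simp [Algebra.smul_def, mul_comm]
  obtain ⟨u, hu, hu'⟩ := key z
  have h0 : Λ u = 0 := eq_zero_of_rTensor_eq_zero ε hε (Λ.restrictScalars P) (fun m w hm =>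
    (hΛ m w).trans (hIM _ (D.liftKaehlerDifferential w).2 m hm)) (hu.trans hz)
  rw [h0] at hu'
  exact Ideal.Quotient.eq_zero_iff_mem.1 (neg_eq_zero.1 hu'.symm)

lemma formallySmooth_of_liftsAt_of_surjective {K S Ω P : Type u} [Field K] [CommRing S]
    [IsLocalRing S] [Algebra K S] [Field Ω] [Algebra S Ω] [IsLocalHom (algebraMap S Ω)]
    (H : LiftsAt K S Ω) [CommRing P] [Algebra K P] [Algebra P S] [IsScalarTower K P S]
    [Algebra.FormallySmooth K P] [Module.Free P Ω[P⁄K]] [Algebra.EssFiniteType K P]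
    (hP : Function.Surjective (algebraMap P S)) : Algebra.FormallySmooth K S := by
  let : Algebra P Ω := ((algebraMap S Ω).comp (algebraMap P S)).toAlgebra
  have : IsScalarTower P S Ω := .of_algebraMap_eq' rfl
  let : Algebra K Ω := ((algebraMap S Ω).comp (algebraMap K S)).toAlgebra
  have : IsScalarTower K S Ω := .of_algebraMap_eq' rfl
  have : IsScalarTower K P Ω := .to₁₂₄ _ _ S _
  let ε : P ⊗[K] Ω →ₐ[P] Ω := Algebra.TensorProduct.lift (Algebra.ofId P Ω) (AlgHom.id K Ω)
    fun _ _ => .all _ _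
  have hε : Function.Surjective ε := fun ω => ⟨1 ⊗ₜ ω, by simp [ε]⟩
  have : IsNoetherianRing P := Algebra.EssFiniteType.isNoetherianRing K P
  have : IsNoetherianRing (Ω ⊗[K] P) := Algebra.EssFiniteType.isNoetherianRing Ω (Ω ⊗[K] P)
  have : IsNoetherianRing (P ⊗[K] Ω) :=
    isNoetherianRing_of_ringEquiv (Ω ⊗[K] P) (Algebra.TensorProduct.comm K Ω P).toRingEquiv
  have h3 : IsLocalRing.maximalIdeal S ≤ RingHom.ker (algebraMap S Ω) := fun a ha => by
    by_contra h
    exact ha (isUnit_of_map_unit (algebraMap S Ω) a (isUnit_iff_ne_zero.2 h))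
  rw [Algebra.FormallySmooth.iff_injective_cotangentComplexBaseChange P Ω hP
    (IsNoetherian.noetherian _) h3, injective_iff_map_eq_zero]
  intro z hz
  obtain ⟨z, rfl⟩ := LinearMap.rTensor_surjective _ (g := ε.toLinearMap) hε z
  refine rTensor_eq_zero_of_mem_mul ε _ (mem_mul_of_forall_mem_sup_pow ?_
    fun n => mem_sup_pow_of_cotangentComplex_eq_zero H hP ε hε hz n)
  clear hz
  induction z with
  | zero => simp
  | add x y hx hy => simpa only [map_add] using add_mem hx hy
  | tmul r j =>
    simp only [LinearMap.lTensor_tmul, TensorProduct.rid_tmul, Algebra.smul_def]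
    exact Ideal.mul_mem_right _ _ (Ideal.mem_map_of_mem _ j.2)

/-- An essentially of finite type algebra is a quotient of a localization of a polynomial ring. -/
lemma exists_surjective_of_essFiniteType (K S : Type u) [Field K] [CommRing S] [Algebra K S]
    [Algebra.EssFiniteType K S] :
    ∃ (P : Type u) (_ : CommRing P) (_ : Algebra K P) (g : P →ₐ[K] S),
      Algebra.FormallySmooth K P ∧ Module.Free P Ω[P⁄K] ∧ Algebra.EssFiniteType K P ∧
      Function.Surjective g := by
  obtain ⟨n, f₀, hf₀⟩ := Algebra.FiniteType.iff_quotient_mvPolynomial''.mp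
    (inferInstance : Algebra.FiniteType K (Algebra.EssFiniteType.subalgebra K S))
  let A := Algebra.EssFiniteType.subalgebra K S
  let M := Algebra.EssFiniteType.submonoid K S
  let M' := M.comap f₀
  let fP : Localization M' →ₐ[K] S := IsLocalization.liftAlgHom (M := M')
      (f := (IsScalarTower.toAlgHom K A S).comp f₀) fun x ↦ by
    simpa using IsLocalization.map_units (M := M) S ⟨f₀ x.1, x.2⟩
  have hfP : Function.Surjective fP := by
    intro x
    obtain ⟨x, ⟨s, hs⟩, rfl⟩ := IsLocalization.exists_mk'_eq M x
    obtain ⟨x, rfl⟩ := hf₀ x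
    obtain ⟨s, rfl⟩ := hf₀ s
    refine ⟨IsLocalization.mk' (M := M') _ x ⟨s, hs⟩, ?_⟩
    simp only [fP, IsLocalization.coe_liftAlgHom, AlgHom.toRingHom_eq_coe,
      IsLocalization.lift_mk', Units.mul_inv_eq_iff_eq_mul]
    exact (IsLocalization.mk'_spec S (f₀ x) (⟨f₀ s, hs⟩ : M)).symm
  have h1 : Algebra.FormallyEtale (MvPolynomial (Fin n) K) (Localization M') :=
    .of_isLocalization M'
  have h2 : Algebra.EssFiniteType (MvPolynomial (Fin n) K) (Localization M') :=
    .of_isLocalization _ M'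
  exact ⟨Localization M', _, _, fP, .comp _ (MvPolynomial (Fin n) K) _,
    .of_equiv (KaehlerDifferential.tensorKaehlerEquivOfFormallyEtale K (MvPolynomial (Fin n) K) _),
    .comp K (MvPolynomial (Fin n) K) _, hfP⟩

/-- An essentially of finite type local algebra over a field is formally smooth if it has the
infinitesimal lifting property at a geometric point over the closed point. -/
theorem formallySmooth_of_liftsAt {K S Ω : Type u} [Field K] [CommRing S] [IsLocalRing S]
    [Algebra K S] [Algebra.EssFiniteType K S] [Field Ω] [Algebra S Ω]
    [IsLocalHom (algebraMap S Ω)] (H : LiftsAt K S Ω) : Algebra.FormallySmooth K S := by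
  obtain ⟨P, _, _, g, _, _, _, hg⟩ := exists_surjective_of_essFiniteType K S
  let : Algebra P S := g.toRingHom.toAlgebra
  have : IsScalarTower K P S := .of_algebraMap_eq' g.comp_algebraMap.symm
  exact formallySmooth_of_liftsAt_of_surjective H hg

end FormallySmooth

/-! ### Smoothness of log smooth curves -/

section

variable {K : Type u} [Field K] {Y : Scheme.{u}} (p : Y ⟶ Spec (.of K)) (y : Y)

lemma algebraMap_stalk_surjective (x : PrimeSpectrum K) :
    Function.Surjective (algebraMap K ((Spec.structureSheaf K).presheaf.stalk x)) := fun a => by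
  obtain ⟨⟨r, s⟩, h⟩ := IsLocalization.surj x.asIdeal.primeCompl a
  have hs : (s : K) ≠ 0 := fun h0 => s.2 (by rw [h0]; exact zero_mem _)
  refine ⟨r * (s : K)⁻¹, ?_⟩
  rw [map_mul, ← h, mul_assoc, ← map_mul, mul_inv_cancel₀ hs, map_one, mul_one]

lemma stalkScalar_id (x : Spec (.of K)) :
    stalkScalar x (𝟙 (Spec (.of K))) = (StructureSheaf.toStalk K x).hom := by
  refine congrArg CommRingCat.Hom.hom (Spec.map_injective
    (a₁ := CommRingCat.ofHom (stalkScalar x (𝟙 (Spec (.of K)))))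
    (a₂ := StructureSheaf.toStalk K x) ?_)
  rw [map_stalkScalar, Category.comp_id]
  exact Spec.fromSpecStalk_eq' (.of K) x

lemma stalkScalar_id_surjective (x : Spec (.of K)) :
    Function.Surjective (stalkScalar x (𝟙 (Spec (.of K)))) := by
  rw [stalkScalar_id]
  exact algebraMap_stalk_surjective _

lemma stalkScalar_eq_comp : stalkScalar y p =
    (p.stalkMap y).hom.comp (stalkScalar (p y) (𝟙 (Spec (.of K)))) := by
  rw [LogScheme.stalkMap_comp_stalkScalar, Category.comp_id]

lemma essFiniteType_stalkScalar [LocallyOfFiniteType p] : (stalkScalar y p).EssFiniteType := by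
  rw [stalkScalar_eq_comp]
  exact RingHom.EssFiniteType.stableUnderComposition _ _
    (RingHom.FiniteType.of_surjective _ (stalkScalar_id_surjective (p y))).essFiniteType
    (LocallyOfFiniteType.stalkMap p y)

lemma formallySmooth_stalkMap_of_stalkScalar (h : (stalkScalar y p).FormallySmooth) :
    (p.stalkMap y).hom.FormallySmooth := by
  let R := (Spec (.of K)).presheaf.stalk (p y)
  let : Algebra K R := (stalkScalar (p y) (𝟙 (Spec (.of K)))).toAlgebra
  let : Algebra K (Y.presheaf.stalk y) := (stalkScalar y p).toAlgebra
  let : Algebra R (Y.presheaf.stalk y) := (p.stalkMap y).hom.toAlgebra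
  have : IsScalarTower K R (Y.presheaf.stalk y) := .of_algebraMap_eq' (stalkScalar_eq_comp p y)
  have : Algebra.FormallyUnramified K R :=
    .of_surjective (Algebra.ofId K R) (stalkScalar_id_surjective (p y))
  have : Algebra.FormallySmooth K (Y.presheaf.stalk y) := h
  exact Algebra.FormallySmooth.of_restrictScalars K R (Y.presheaf.stalk y)

end

namespace LogScheme

variable {K : Type u} [Field K] {X : LogScheme.{u}} {f : X ⟶ trivial (Spec (.of K))}

/-- The underlying scheme of a log smooth curve is smooth. -/
theorem IsLogSmoothCurve.smooth (hf : IsLogSmoothCurve f) : Smooth f.base := by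
  have := hf.logSmooth.locallyOfFinitePresentation
  refine Scheme.Hom.smoothLocus_eq_top_iff.1 (top_le_iff.1 fun x _ => ?_)
  rw [Scheme.Hom.mem_smoothLocus]
  refine formallySmooth_stalkMap_of_stalkScalar f.base x ?_
  let : Algebra K (X.scheme.presheaf.stalk x) := (stalkScalar x f.base).toAlgebra
  let Ω := AlgebraicClosure (IsLocalRing.ResidueField (X.scheme.presheaf.stalk x))
  let : Algebra (X.scheme.presheaf.stalk x) Ω := (geometricPoint x).toAlgebra
  have h1 : IsLocalHom (algebraMap (X.scheme.presheaf.stalk x) Ω) := isLocalHom_geometricPoint x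
  have : Algebra.EssFiniteType K (X.scheme.presheaf.stalk x) := by
    have h2 : LocallyOfFiniteType f.base := inferInstance
    exact @essFiniteType_stalkScalar K _ X.scheme f.base x h2
  refine formallySmooth_of_liftsAt (Ω := Ω) ?_
  intro B' _ ρ' hρ' hn g' hg' B _ π hπ hπn c hc
  have hl : IsLocalHom (ρ'.comp g') := by
    rw [hg']
    exact h1
  exact hf.exists_ringHom x ρ' hρ' hn g' (isLocalHom_of_comp g' ρ') π hπ hπn c hc

end LogScheme

/-! ### The relative dimension -/

section RelativeDimension

lemma height_eq_of_isMaximal_mvPolynomial (k : Type*) [Field k] (n : ℕ)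
    (P : Ideal (MvPolynomial (Fin n) k)) [hP : P.IsMaximal] : P.height = n := by
  induction n with
  | zero =>
    let e := MvPolynomial.isEmptyAlgEquiv k (Fin 0)
    have hf : IsField (MvPolynomial (Fin 0) k) :=
      MulEquiv.isField (Field.toIsField k) e.toMulEquiv
    let := hf.toField
    rw [Ideal.eq_bot_of_prime P, Ideal.height_eq_zero_iff_eq_bot.2 rfl]
    rfl
  | succ n ih =>
    let e := (MvPolynomial.finSuccEquiv k n).symm.toRingEquiv
    have h1 : (P.comap e).IsMaximal := Ideal.comap_isMaximal_of_equiv e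
    have h2 : ((P.comap e).comap Polynomial.C).IsMaximal :=
      Polynomial.isMaximal_comap_C_of_isJacobsonRing _
    have h3 : (P.comap e).LiesOver ((P.comap e).comap Polynomial.C) := ⟨rfl⟩
    have h4 := Polynomial.height_eq_height_add_one ((P.comap e).comap Polynomial.C)
      (P.comap e)
    have h5 : P.height = (P.comap e).height := (RingEquiv.height_comap e P).symm
    rw [h5, h4, ih]
    push_cast
    rfl

lemma isMaximal_comap_of_finiteType {R A : Type*} [CommRing R] [IsJacobsonRing R] [CommRing A]
    [Algebra R A] [Algebra.FiniteType R A] (P : Ideal A) [hP : P.IsMaximal] :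
    (P.comap (algebraMap R A)).IsMaximal := by
  let : Field (A ⧸ P) := Ideal.Quotient.field P
  have : Module.Finite R (A ⧸ P) := finite_of_finite_type_of_isJacobsonRing R (A ⧸ P)
  have h := Ideal.isMaximal_comap_of_isIntegral_of_isMaximal (R := R) (⊥ : Ideal (A ⧸ P))
  have h1 : (⊥ : Ideal (A ⧸ P)).comap (algebraMap R (A ⧸ P)) = P.comap (algebraMap R A) := by
    rw [IsScalarTower.algebraMap_eq R A (A ⧸ P), ← Ideal.comap_comap]
    congr 1
    exact Ideal.mk_ker
  exact h1 ▸ h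

/-- Étale algebras over polynomial rings in `n` variables over a field have dimension `n` at all
maximal ideals. -/
lemma height_eq_of_etale (k : Type u) [Field k] (n : ℕ) {A : Type u} [CommRing A]
    [Algebra (MvPolynomial (Fin n) k) A] [Algebra.Etale (MvPolynomial (Fin n) k) A]
    (P : Ideal A) [hP : P.IsMaximal] : P.height = n := by
  let q := P.comap (algebraMap (MvPolynomial (Fin n) k) A)
  have hq : q.IsMaximal := isMaximal_comap_of_finiteType P
  have : P.LiesOver q := ⟨rfl⟩
  have : IsNoetherianRing A := Algebra.FiniteType.isNoetherianRing (MvPolynomial (Fin n) k) A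
  have h1 := Ideal.height_eq_height_add_of_liesOver_of_hasGoingDown q P
  rw [h1, height_eq_of_isMaximal_mvPolynomial k n q]
  let L := MvPolynomial (Fin n) k ⧸ q
  let : Field L := Ideal.Quotient.field q
  -- The fibre `C` over `q` is finite over a field, so it does not contribute to the height.
  let C := A ⧸ q.map (algebraMap (MvPolynomial (Fin n) k) A)
  have hfu : Algebra.FormallyUnramified (MvPolynomial (Fin n) k) C :=
    .comp _ A _
  have hfu' : Algebra.FormallyUnramified L C :=
    .of_restrictScalars (MvPolynomial (Fin n) k) L C
  have hft : Algebra.FiniteType (MvPolynomial (Fin n) k) C :=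
    .trans (S := A) inferInstance inferInstance
  have hft' : Algebra.FiniteType L C := .of_restrictScalars_finiteType (MvPolynomial (Fin n) k) L C
  have : Module.Finite L C := Algebra.FormallyUnramified.finite_of_free L C
  have : IsArtinianRing C := IsArtinianRing.of_finite L C
  have hP' : (P.map (Ideal.Quotient.mk (q.map (algebraMap (MvPolynomial (Fin n) k) A)))).IsPrime :=
    Ideal.map_isPrime_of_surjective Ideal.Quotient.mk_surjective (by
      rw [Ideal.mk_ker]
      exact Ideal.map_comap_le)
  have h0 : (P.map (Ideal.Quotient.mk (q.map (algebraMap (MvPolynomial (Fin n) k) A)))).height =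
      0 := by
    rw [Ideal.height_eq_zero_iff]
    exact Ring.KrullDimLE.mem_minimalPrimes_iff.2 ⟨hP', bot_le⟩
  rw [h0, add_zero]

lemma exists_isStandardSmoothOfRelativeDimension {R S : Type u} [CommRing R] [CommRing S]
    {g : R →+* S} (hg : g.IsStandardSmooth) : ∃ n, g.IsStandardSmoothOfRelativeDimension n := by
  algebraize [g]
  obtain ⟨_, _, _, _, ⟨P⟩⟩ := hg
  exact ⟨_, _, _, _, ‹_›, P, rfl⟩

lemma isField_section {K : Type u} [Field K] (U : (Spec (.of K)).Opens) (hU : Nonempty U) :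
    IsField Γ(Spec (.of K), U) := by
  have hU' : U = ⊤ := by
    obtain ⟨x, hx⟩ := hU
    refine top_le_iff.1 fun y _ => ?_
    have : Subsingleton (PrimeSpectrum K) := inferInstance
    rwa [show y = x from this.elim y x]
  subst hU'
  exact MulEquiv.isField (Field.toIsField K)
    (Scheme.ΓSpecIso (.of K)).commRingCatIsoToRingEquiv.toMulEquiv

end RelativeDimension

namespace LogScheme

variable {K : Type u} [Field K] {X : LogScheme.{u}} {f : X ⟶ trivial (Spec (.of K))}

lemma height_primeIdealOf_eq_one {X : Scheme.{u}}
    (hX : ∀ Z ∈ irreducibleComponents X, topologicalKrullDim Z = 1) {V : X.Opens}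
    (hV : IsAffineOpen V) (x : V) (hx : IsClosed {(x : X)}) :
    (hV.primeIdealOf x).asIdeal.height = 1 := by
  let := TopCat.Presheaf.algebra_section_stalk X.presheaf x
  have : IsLocalization.AtPrime (X.presheaf.stalk (x : X)) (hV.primeIdealOf x).asIdeal :=
    hV.isLocalization_stalk x
  have h1 := IsLocalization.AtPrime.ringKrullDim_eq_height (hV.primeIdealOf x).asIdeal
    (X.presheaf.stalk (x : X))
  rw [ringKrullDim_stalk_eq_coheight,
    le_antisymm (coheight_le_one hX _) (one_le_coheight hX hx)] at h1
  exact_mod_cast h1.symm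

theorem IsLogSmoothCurve.smoothOfRelativeDimension_one (hf : IsLogSmoothCurve f) :
    SmoothOfRelativeDimension 1 f.base := by
  have := hf.smooth
  have hj : JacobsonSpace (trivial (Spec (.of K))).scheme :=
    inferInstanceAs (JacobsonSpace (PrimeSpectrum K))
  have : JacobsonSpace X.scheme := LocallyOfFiniteType.jacobsonSpace f.base
  refine ⟨fun x => ?_⟩
  obtain ⟨U, hU, V, hV, hx, e, hs⟩ := Smooth.exists_isStandardSmooth f.base x
  obtain ⟨n, hn⟩ := exists_isStandardSmoothOfRelativeDimension hs
  -- The relative dimension `n` on a neighbourhood is read off at a closed point, where the local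
  -- ring has dimension one.
  obtain ⟨z, hzV, hz⟩ := nonempty_inter_closedPoints (Z := (V : Set X.scheme)) ⟨x, hx⟩
    V.2.isLocallyClosed
  have h1 := height_primeIdealOf_eq_one hf.pureDimensionOne hV ⟨z, hzV⟩ hz
  have hmax := hV.primeIdealOf_isMaximal_of_isClosed ⟨z, hzV⟩ hz
  let k : Field Γ((trivial (Spec (.of K))).scheme, U) :=
    (isField_section (K := K) U ⟨f.base x, e hx⟩).toField
  obtain ⟨g, -, hg⟩ := hn.exists_etale_mvPolynomial
  let : Algebra (MvPolynomial (Fin n) Γ((trivial (Spec (.of K))).scheme, U)) Γ(X.scheme, V) :=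
    g.toAlgebra
  have : Algebra.Etale (MvPolynomial (Fin n) Γ((trivial (Spec (.of K))).scheme, U))
    Γ(X.scheme, V) := hg
  have h2 := height_eq_of_etale Γ((trivial (Spec (.of K))).scheme, U) n
    (hV.primeIdealOf ⟨z, hzV⟩).asIdeal
  have h3 : n = 1 := by
    rw [h1] at h2
    exact_mod_cast h2.symm
  subst h3
  exact ⟨U, hU, V, hV, hx, e, hn⟩

end LogScheme

/-! ### Generators of the log structure are local parameters -/

section

open KaehlerDifferential

/-- If the differentials of a local algebra over a field are generated by one element, then every
element of the maximal ideal on which some derivation does not vanish at the closed point generates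
the maximal ideal, and the residue field is finite separable over the base: the quotient by such an
element is unramified over the base field. -/
lemma maximalIdeal_eq_span_of_derivation {K O : Type u} {Ω : Type*} [Field K] [CommRing O]
    [IsLocalRing O] [Algebra K O] [Algebra.EssFiniteType K O] (ω : Ω[O⁄K])
    (hω : Submodule.span O {ω} = ⊤) [Field Ω] [Algebra O Ω] [Algebra K Ω]
    [IsScalarTower K O Ω] [IsLocalHom (algebraMap O Ω)] (D : Derivation K O Ω) {a : O}
    (ha : a ∈ IsLocalRing.maximalIdeal O) (hD : D a ≠ 0) :
    IsLocalRing.maximalIdeal O = Ideal.span {a} ∧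
      Algebra.IsSeparable K (IsLocalRing.ResidueField O) ∧
      Module.Finite K (IsLocalRing.ResidueField O) := by
  obtain ⟨c, hc⟩ := Submodule.mem_span_singleton.1 (hω.symm ▸ Submodule.mem_top :
    KaehlerDifferential.D K O a ∈ Submodule.span O {ω})
  -- As `D a ≠ 0`, the differential `d a` is itself a generator.
  have hcu : IsUnit c := by
    by_contra hcu
    have h0 : algebraMap O Ω c = 0 := by
      by_contra h0
      exact hcu (isUnit_of_map_unit (algebraMap O Ω) c (isUnit_iff_ne_zero.2 h0))
    refine hD ?_
    rw [← D.liftKaehlerDifferential_comp_D, ← hc, map_smul, Algebra.smul_def, h0, zero_mul]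
  have hda : Submodule.span O {KaehlerDifferential.D K O a} = ⊤ := by
    rw [← hω, ← hc]
    exact Submodule.span_singleton_smul_eq hcu ω
  let A := O ⧸ Ideal.span {a}
  have hA : Algebra.FormallyUnramified K A := by
    refine ⟨subsingleton_of_forall_eq 0 fun w => ?_⟩
    obtain ⟨v, rfl⟩ := KaehlerDifferential.map_surjective_of_surjective K K O A
      Ideal.Quotient.mk_surjective w
    obtain ⟨r, rfl⟩ := Submodule.mem_span_singleton.1 (hda.symm ▸ Submodule.mem_top :
      v ∈ Submodule.span O {KaehlerDifferential.D K O a})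
    rw [map_smul, KaehlerDifferential.map_D]
    have : algebraMap O A a = 0 :=
      Ideal.Quotient.eq_zero_iff_mem.2 (Ideal.mem_span_singleton_self a)
    rw [this, map_zero, smul_zero]
  have hle : Ideal.span {a} ≤ IsLocalRing.maximalIdeal O := by
    rwa [Ideal.span_singleton_le_iff_mem]
  have hnt : Nontrivial A := Ideal.Quotient.nontrivial_iff.2 fun h =>
    (IsLocalRing.maximalIdeal.isMaximal O).ne_top (top_le_iff.1 (h ▸ hle))
  have hEF : Algebra.EssFiniteType K A := .comp K O A
  have hlr : IsLocalRing A := .of_surjective' _ Ideal.Quotient.mk_surjective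
  have hred : IsReduced A := Algebra.FormallyUnramified.isReduced_of_field K A
  have hfin : Module.Finite K A := Algebra.FormallyUnramified.finite_of_free K A
  have hart : IsArtinianRing A := IsArtinianRing.of_finite K A
  have hfield : IsField A := IsArtinianRing.isField_of_isReduced_of_isLocalRing A
  have hmax : (Ideal.span {a}).IsMaximal := Ideal.Quotient.maximal_of_isField _ hfield
  have heq : IsLocalRing.maximalIdeal O = Ideal.span {a} :=
    (IsLocalRing.eq_maximalIdeal hmax).symm
  refine ⟨heq, ?_⟩
  have hsurj : Function.Surjective (algebraMap O (IsLocalRing.ResidueField O)) :=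
    IsLocalRing.residue_surjective
  let q : A →ₐ[K] IsLocalRing.ResidueField O :=
    Ideal.Quotient.liftₐ _ (IsScalarTower.toAlgHom K O (IsLocalRing.ResidueField O))
      fun x hx => (IsLocalRing.residue_eq_zero_iff x).2 (hle hx)
  have hq : Function.Surjective q := Ideal.Quotient.lift_surjective_of_surjective _ _ hsurj
  have hfin' : Module.Finite K (IsLocalRing.ResidueField O) := .of_surjective q.toLinearMap hq
  have : Algebra.FormallyUnramified K (IsLocalRing.ResidueField O) :=
    .of_surjective q hq
  exact ⟨Algebra.FormallyUnramified.isSeparable K _, hfin'⟩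

variable {K : Type u} [Field K]

/-- The differentials of the local rings of a smooth curve are generated by one element. -/
lemma exists_span_kaehlerDifferential_eq_top {Y : Scheme.{u}} (p : Y ⟶ Spec (.of K))
    [hp : SmoothOfRelativeDimension 1 p] (y : Y) :
    letI := (stalkScalar y p).toAlgebra
    ∃ ω : Ω[Y.presheaf.stalk y⁄K], Submodule.span (Y.presheaf.stalk y) {ω} = ⊤ := by
  let O := Y.presheaf.stalk y
  let S := (Spec (.of K)).presheaf.stalk (p y)
  let : Algebra K O := (stalkScalar y p).toAlgebra
  let : Algebra K S := (stalkScalar (p y) (𝟙 (Spec (.of K)))).toAlgebra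
  let : Algebra S O := (p.stalkMap y).hom.toAlgebra
  have : IsScalarTower K S O := .of_algebraMap_eq' (stalkScalar_eq_comp p y)
  obtain ⟨U, hU, V, hV, hx, e, hs⟩ := hp.exists_isStandardSmoothOfRelativeDimension y
  let R := Γ(Spec (.of K), U)
  let A := Γ(Y, V)
  let : Algebra R A := (p.appLE U V e).hom.toAlgebra
  let : Algebra R S := ((Spec (.of K)).presheaf.germ U (p y) (e hx)).hom.toAlgebra
  let : Algebra A O := TopCat.Presheaf.algebra_section_stalk Y.presheaf ⟨y, hx⟩
  let : Algebra R O := ((Y.presheaf.germ V y hx).hom.comp (p.appLE U V e).hom).toAlgebra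
  have : IsScalarTower R A O := .of_algebraMap_eq' rfl
  have : IsScalarTower R S O := .of_algebraMap_eq' (by
    have h := Scheme.Hom.germ_stalkMap p U y (e hx)
    have h' : p.appLE U V e ≫ Y.presheaf.germ V y hx =
        p.app U ≫ Y.presheaf.germ (p ⁻¹ᵁ U) y (e hx) := by
      rw [Scheme.Hom.appLE, Category.assoc, TopCat.Presheaf.germ_res]
    exact congrArg CommRingCat.Hom.hom (h'.trans h.symm))
  have hloc : IsLocalization.AtPrime O (hV.primeIdealOf ⟨y, hx⟩).asIdeal :=
    hV.isLocalization_stalk ⟨y, hx⟩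
  have hstd : Algebra.IsStandardSmoothOfRelativeDimension 1 R A := hs
  have hnt : Nontrivial A := (algebraMap A O).domain_nontrivial
  have : Algebra.IsStandardSmooth R A :=
    Algebra.IsStandardSmoothOfRelativeDimension.isStandardSmooth 1
  have hrank := Algebra.IsStandardSmoothOfRelativeDimension.rank_kaehlerDifferential (R := R)
    (S := A) 1
  obtain ⟨ω₀, -, hω₀⟩ := finrank_eq_one_iff'.1 (Module.finrank_eq_of_rank_eq hrank)
  have h1 : Submodule.span O {map R R A O ω₀} = ⊤ := by
    rw [eq_top_iff, ← span_range_map_derivation_of_isLocalization R A O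
      (hV.primeIdealOf ⟨y, hx⟩).asIdeal.primeCompl, Submodule.span_le]
    rintro _ ⟨b, rfl⟩
    obtain ⟨r, hr⟩ := hω₀ (KaehlerDifferential.D R A b)
    rw [Function.comp_apply, ← hr, map_smul, ← algebraMap_smul O]
    exact Submodule.smul_mem _ _ (Submodule.mem_span_singleton_self _)
  -- Differentials over the sections `R` on an open neighbourhood in `Spec K`, over the stalk `S`,
  -- and over `K` are the same.
  have h2 : Submodule.span O {map R S O O (map R R A O ω₀)} = ⊤ := by
    rw [← Set.image_singleton, ← Submodule.map_span, h1, Submodule.map_top,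
      LinearMap.range_eq_top]
    exact KaehlerDifferential.map_surjective R S O
  have hfu : Algebra.FormallyUnramified K S :=
    .of_surjective (Algebra.ofId K S) (stalkScalar_id_surjective (p y))
  have hinj : Function.Injective (map K S O O) := by
    rw [injective_iff_map_eq_zero]
    intro z hz
    obtain ⟨w, rfl⟩ := (KaehlerDifferential.exact_mapBaseChange_map K S O z).1 hz
    rw [Subsingleton.elim w 0, map_zero]
  obtain ⟨ω, hω⟩ := KaehlerDifferential.map_surjective K S O (map R S O O (map R R A O ω₀))
  refine ⟨ω, Submodule.map_injective_of_injective hinj ?_⟩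
  rw [Submodule.map_span, Set.image_singleton, hω, h2, Submodule.map_top,
    LinearMap.range_eq_top.2 (KaehlerDifferential.map_surjective K S O)]

end

lemma mem_nonZeroDivisors_of_maximalIdeal_eq_span {O : Type*} [CommRing O] [IsLocalRing O]
    [IsNoetherianRing O] {a : O} (h : IsLocalRing.maximalIdeal O = Ideal.span {a})
    (ha : ¬ IsNilpotent a) : a ∈ nonZeroDivisors O := by
  refine mem_nonZeroDivisors_iff_right.2 fun c hc => ?_
  have key (n : ℕ) : c ∈ Ideal.span {a} ^ n := by
    induction n with
    | zero => simp
    | succ n ih =>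
      rw [Ideal.span_singleton_pow, Ideal.mem_span_singleton'] at ih ⊢
      obtain ⟨r, rfl⟩ := ih
      have hr : r ∈ Ideal.span {a} := by
        rw [← h]
        intro hu
        refine ha ⟨n + 1, ?_⟩
        rwa [mul_assoc, ← pow_succ, hu.mul_right_eq_zero] at hc
      obtain ⟨r', rfl⟩ := Ideal.mem_span_singleton'.1 hr
      exact ⟨r', by ring⟩
  have h1 := Ideal.iInf_pow_eq_bot_of_isLocalRing (Ideal.span {a})
    (h ▸ (IsLocalRing.maximalIdeal.isMaximal O).ne_top)
  have h2 : c ∈ ⨅ i, Ideal.span {a} ^ i := (Submodule.mem_iInf _).2 key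
  rwa [h1] at h2

namespace LogScheme

variable {K : Type u} [Field K] {X : LogScheme.{u}} {f : X ⟶ trivial (Spec (.of K))}

section

variable (hf : IsLogSmoothCurve f) {U : X.scheme.Etale} (y : U.left) {Q : Type u} [CommMonoid Q]
  [IsCancelMul Q] [Monoid.FG Q] {φ : Q →* X.sections U} (hφ : IsChart φ)
  (hy : ∀ q, y ∈ U.left.basicOpen (X.α U (φ q)) → q = 1) {t : Q} (ht : ∀ p, ∃ n : ℕ, p = t ^ n)

include hf hφ hy ht

/-- The geometric point at the vanishing point of a chart `ℕ → M_X` extends to any infinitesimal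
thickening in such a way that the generator of the chart maps to a given nilpotent element, up to a
unit. -/
lemma IsLogSmoothCurve.exists_ringHom_apply_eq (ht1 : t ≠ 1) {B : Type u} [CommRing B]
    [Algebra (AlgebraicClosure (IsLocalRing.ResidueField (U.left.presheaf.stalk y))) B]
    (π : B →ₐ[AlgebraicClosure (IsLocalRing.ResidueField (U.left.presheaf.stalk y))]
      AlgebraicClosure (IsLocalRing.ResidueField (U.left.presheaf.stalk y)))
    (hπ : IsNilpotent (RingHom.ker π)) {b : B} (hb : π b = 0) :
    ∃ (g : U.left.presheaf.stalk y →+* B) (v : Bˣ), (π : B →+* _).comp g = geometricPoint y ∧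
      g.comp (scalar f y) = (algebraMap _ B).comp ((geometricPoint y).comp (scalar f y)) ∧
      g (chartGerm y φ t) = v * b := by
  let Ω := AlgebraicClosure (IsLocalRing.ResidueField (U.left.presheaf.stalk y))
  have hu (q : Q) (hq : IsUnit q) : q = 1 :=
    hy q ((isUnit_germTop_iff y _).1 (hq.map (chartGerm y φ)))
  have hinj := pow_injective_of_isUnit_imp hu ht1
  have hm (q : Q) (hq : q ≠ 1) :
      chartGerm y φ q ∈ IsLocalRing.maximalIdeal (U.left.presheaf.stalk y) :=
    fun h => hq (hy q ((isUnit_germTop_iff y _).1 h))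
  have hg0 (a) (ha : a ∈ IsLocalRing.maximalIdeal (U.left.presheaf.stalk y)) :
      geometricPoint y a = 0 := by
    refine (congrArg (algebraMap _ Ω) ((IsLocalRing.residue_eq_zero_iff a).2 ha)).trans ?_
    exact map_zero _
  -- The log structure on `Spec B` in which the generator of the chart is mapped to `b`.
  choose N hN using ht
  have hN1 : N 1 = 0 := hinj (by simp only [← hN, pow_zero])
  have hNt : N t = 1 := hinj (by simp only [← hN, pow_one])
  let β : Q →* B := ⟨⟨fun q => b ^ N q, by rw [hN1, pow_zero]⟩, fun p q => by
    change b ^ N (p * q) = b ^ N p * b ^ N q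
    rw [← pow_add]
    congr 1
    refine hinj ?_
    simp only [pow_add, ← hN]⟩
  have hβ0 (q : Q) (hq : q ≠ 1) : π (β q) = 0 := by
    have : N q ≠ 0 := fun h => hq (by rw [hN q, h, pow_zero])
    change π (b ^ N q) = 0
    rw [map_pow, hb, zero_pow this]
  obtain ⟨g, v, -, h1, h2, h3, -⟩ := hf.logSmooth.exists_ringHom_of_isNilpotent hφ y (RingHom.id Ω)
    Function.surjective_id
    ⟨1, by rw [pow_one]; exact (RingHom.ker_eq_bot_iff_eq_zero _).2 fun _ => id⟩
    (geometricPoint y) inferInstance 1 (π : B →+* Ω)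
    (fun r => ⟨algebraMap Ω B r, π.commutes r⟩) hπ β
    (fun q hq => by
      by_contra hq'
      have := hβ0 q hq'
      exact not_isUnit_zero ((congrArg IsUnit this).mp hq)) (fun q => by
      by_cases hq : q = 1
      · subst hq
        simp
      · have h0 : (π : B →+* Ω) (β q) = 0 := hβ0 q hq
        rw [h0, hg0 _ (hm q hq), mul_zero])
    ((algebraMap Ω B).comp ((geometricPoint y).comp (scalar f y))) (by
      refine RingHom.ext fun r => ?_
      exact π.commutes _)
  refine ⟨g, v t, h1, h2, (h3 t).trans ?_⟩
  change (v t : B) * b ^ N t = _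
  rw [hNt, pow_one]

/-- The generator of a chart `ℕ → M_X` is a local parameter at the points where it vanishes, and the
residue fields of these points are finite separable over the base field. -/
theorem IsLogSmoothCurve.maximalIdeal_eq_span (ht1 : t ≠ 1) :
    IsLocalRing.maximalIdeal (U.left.presheaf.stalk y) = Ideal.span {chartGerm y φ t} ∧
      letI := (scalar f y).toAlgebra
      Algebra.IsSeparable K (IsLocalRing.ResidueField (U.left.presheaf.stalk y)) ∧
      Module.Finite K (IsLocalRing.ResidueField (U.left.presheaf.stalk y)) := by
  let Ω := AlgebraicClosure (IsLocalRing.ResidueField (U.left.presheaf.stalk y))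
  have hsm := hf.smoothOfRelativeDimension_one
  have : Etale U.hom := U.prop
  have hsm' : SmoothOfRelativeDimension 1 (U.hom ≫ f.base) :=
    inferInstanceAs (SmoothOfRelativeDimension (0 + 1) (U.hom ≫ f.base))
  have := hf.smooth
  have hft : LocallyOfFiniteType (U.hom ≫ f.base) := inferInstance
  let : Algebra K (U.left.presheaf.stalk y) := (scalar f y).toAlgebra
  have : Algebra.EssFiniteType K (U.left.presheaf.stalk y) :=
    @essFiniteType_stalkScalar K _ U.left (U.hom ≫ f.base) y hft
  obtain ⟨ω, hω⟩ : ∃ ω : Ω[U.left.presheaf.stalk y⁄K],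
      Submodule.span (U.left.presheaf.stalk y) {ω} = ⊤ :=
    @exists_span_kaehlerDifferential_eq_top K _ U.left (U.hom ≫ f.base) hsm' y
  have : IsLocalHom (algebraMap (U.left.presheaf.stalk y) Ω) := isLocalHom_geometricPoint y
  let B := TrivSqZeroExt Ω Ω
  let π : B →ₐ[Ω] Ω := TrivSqZeroExt.fstHom Ω Ω Ω
  have hπ : IsNilpotent (RingHom.ker π) := ⟨2, TrivSqZeroExt.kerIdeal_sq Ω Ω⟩
  obtain ⟨g, v, h1, h2, h3⟩ := hf.exists_ringHom_apply_eq y hφ hy ht ht1 (B := B) π hπ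
    (b := TrivSqZeroExt.inr (1 : Ω)) (TrivSqZeroExt.fst_inr Ω (1 : Ω))
  have hfst (x : U.left.presheaf.stalk y) : (g x).fst = geometricPoint y x := RingHom.congr_fun h1 x
  -- The tangent vector along which the generator of the chart is not constant.
  let D : Derivation K (U.left.presheaf.stalk y) Ω := Derivation.mk'
    { toFun := fun x => (g x).snd
      map_add' := fun a b => by rw [map_add]; rfl
      map_smul' := fun r a => by
        have h4 : g (scalar f y r) = TrivSqZeroExt.inl (geometricPoint y (scalar f y r)) :=
          RingHom.congr_fun h2 r
        rw [Algebra.smul_def, map_mul, TrivSqZeroExt.snd_mul]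
        refine Eq.trans ?_ (Algebra.smul_def r (g a).snd).symm
        change (g (scalar f y r)).fst • (g a).snd +
          MulOpposite.op (g a).fst • (g (scalar f y r)).snd = _
        rw [h4, TrivSqZeroExt.snd_inl, smul_zero, add_zero,
          IsScalarTower.algebraMap_apply K (U.left.presheaf.stalk y) Ω]
        rfl } (fun a b => by
      refine Eq.trans ?_ (congrArg₂ (· + ·) (Algebra.smul_def a (g b).snd)
        (Algebra.smul_def b (g a).snd)).symm
      change (g (a * b)).snd = geometricPoint y a * (g b).snd + geometricPoint y b * (g a).snd
      rw [map_mul, TrivSqZeroExt.snd_mul, hfst, hfst]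
      exact congrArg (geometricPoint y a * (g b).snd + ·) (mul_comm (g a).snd _))
  have hD : D (chartGerm y φ t) ≠ 0 := by
    change (g (chartGerm y φ t)).snd ≠ 0
    have hv : (v : B).fst ≠ 0 := (v.isUnit.map (TrivSqZeroExt.fstHom Ω Ω Ω)).ne_zero
    rw [h3, TrivSqZeroExt.snd_mul, TrivSqZeroExt.fst_inr, TrivSqZeroExt.snd_inr]
    simpa using hv
  exact maximalIdeal_eq_span_of_derivation ω hω D
    (fun h => ht1 (hy t ((isUnit_germTop_iff y _).1 h))) hD

lemma IsLogSmoothCurve.chartGerm_mem_nonZeroDivisors (ht1 : t ≠ 1) :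
    chartGerm y φ t ∈ nonZeroDivisors (U.left.presheaf.stalk y) := by
  let Ω := AlgebraicClosure (IsLocalRing.ResidueField (U.left.presheaf.stalk y))
  have := hf.logSmooth.locallyOfFinitePresentation
  have : IsLocallyNoetherian (trivial (Spec (.of K))).scheme :=
    inferInstanceAs (IsLocallyNoetherian (Spec (.of K)))
  have : IsLocallyNoetherian X.scheme := LocallyOfFiniteType.isLocallyNoetherian f.base
  have : Etale U.hom := U.prop
  have : IsLocallyNoetherian U.left :=
    @LocallyOfFiniteType.isLocallyNoetherian _ _ U.hom inferInstance
      (inferInstanceAs (IsLocallyNoetherian X.scheme))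
  refine mem_nonZeroDivisors_of_maximalIdeal_eq_span
    (hf.maximalIdeal_eq_span y hφ hy ht ht1).1 ?_
  rintro ⟨n, hn⟩
  -- The generator of the chart would map to a unit multiple of `X` in `Ω[X] / (X ^ (n + 1))`.
  let I : Ideal (Polynomial Ω) := Ideal.span {Polynomial.X ^ (n + 1)}
  have hI (a : Polynomial Ω) (ha : a ∈ I) : Polynomial.aeval (0 : Ω) a = 0 := by
    obtain ⟨r, rfl⟩ := Ideal.mem_span_singleton'.1 ha
    simp
  let π : (Polynomial Ω ⧸ I) →ₐ[Ω] Ω := Ideal.Quotient.liftₐ I (Polynomial.aeval (0 : Ω)) hI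
  have hπ : IsNilpotent (RingHom.ker π) := by
    refine ⟨n + 1, ?_⟩
    have hle : RingHom.ker π ≤ Ideal.span {Ideal.Quotient.mk I Polynomial.X} := by
      intro a ha
      obtain ⟨p, rfl⟩ := Ideal.Quotient.mk_surjective a
      have hp : Polynomial.aeval (0 : Ω) p = 0 := ha
      rw [Polynomial.coe_aeval_eq_eval, ← Polynomial.coeff_zero_eq_eval_zero,
        ← Polynomial.X_dvd_iff] at hp
      exact Ideal.mem_span_singleton.2 (map_dvd (Ideal.Quotient.mk I) hp)
    have h0 : Ideal.Quotient.mk I Polynomial.X ^ (n + 1) = 0 := by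
      rw [← map_pow]
      exact Ideal.Quotient.eq_zero_iff_mem.2 (Ideal.mem_span_singleton_self _)
    refine le_bot_iff.1 ((Ideal.pow_right_mono hle _).trans ?_)
    rw [Ideal.span_singleton_pow, h0, Ideal.span_singleton_eq_bot.2 rfl]
  obtain ⟨g, v, -, -, h3⟩ := hf.exists_ringHom_apply_eq y hφ hy ht ht1 π hπ
    (b := Ideal.Quotient.mk I Polynomial.X)
    (by
      change Polynomial.aeval (0 : Ω) Polynomial.X = 0
      simp)
  have h4 : Ideal.Quotient.mk I Polynomial.X ^ n = 0 := by
    have := congrArg (· ^ n) h3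
    simp only [← map_pow, hn, map_zero, mul_pow] at this
    rw [← Units.val_pow_eq_pow_val] at this
    rw [← map_pow]
    exact (Units.mul_right_eq_zero _).1 this.symm
  rw [← map_pow, Ideal.Quotient.eq_zero_iff_mem, Ideal.mem_span_singleton,
    Polynomial.X_pow_dvd_iff] at h4
  have := h4 n (Nat.lt_succ_self n)
  simp at this

end

end LogScheme

/-! ### Local parameters on schemes -/

section Algebra

/-- Inclusions of finitely generated ideals at a prime hold in a neighbourhood of the prime. -/
lemma exists_notMem_forall_mul_mem {R : Type*} [CommRing R] (p : Ideal R) [p.IsPrime]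
    {A : Type*} [CommRing A] [Algebra R A] [IsLocalization.AtPrime A p] {I J : Ideal R} (hI : I.FG)
    (h : I.map (algebraMap R A) ≤ J.map (algebraMap R A)) : ∃ f ∉ p, ∀ b ∈ I, f * b ∈ J := by
  obtain ⟨S, rfl⟩ := hI
  have h1 (b : S) : ∃ f ∉ p, f * (b : R) ∈ J := by
    have h2 : algebraMap R A b ∈ J.map (algebraMap R A) :=
      h (Ideal.mem_map_of_mem _ (Ideal.subset_span b.2))
    obtain ⟨⟨j, s⟩, hjs⟩ := (IsLocalization.mem_map_algebraMap_iff p.primeCompl A).1 h2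
    rw [← map_mul] at hjs
    obtain ⟨c, hc⟩ := (IsLocalization.eq_iff_exists p.primeCompl A).1 hjs
    refine ⟨c * s, (c * s).2, ?_⟩
    have h3 : (c : R) * s * b = c * j := by rw [← hc]; ring
    rw [h3]
    exact J.mul_mem_left _ j.2
  choose f hf hfb using h1
  refine ⟨∏ b, f b, fun hmem => ?_, fun b hb => ?_⟩
  · obtain ⟨b, -, hb⟩ := Ideal.IsPrime.prod_mem_iff.1 hmem
    exact hf b hb
  · have hle : Ideal.span (S : Set R) ≤ Submodule.comap (LinearMap.mulLeft R (∏ b, f b)) J := by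
      rw [Ideal.span, Submodule.span_le]
      intro b hb
      change (∏ b, f b) * b ∈ J
      exact J.mem_of_dvd (mul_dvd_mul_right (Finset.dvd_prod_of_mem f (Finset.mem_univ ⟨b, hb⟩)) b)
        (hfb ⟨b, hb⟩)
    exact hle hb

/-- Local parameters descend along flat local homomorphisms that are unramified in the sense that
the maximal ideal generates the maximal ideal. -/
lemma exists_maximalIdeal_eq_span {A B : Type*} [CommRing A] [CommRing B] [IsLocalRing A]
    [IsLocalRing B] [Algebra A B] [Module.Flat A B] [IsLocalHom (algebraMap A B)]
    (h : (IsLocalRing.maximalIdeal A).map (algebraMap A B) = IsLocalRing.maximalIdeal B) {a : B}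
    (ha : IsLocalRing.maximalIdeal B = Ideal.span {a}) (ha' : a ∈ nonZeroDivisors B) :
    ∃ s ∈ nonZeroDivisors A, IsLocalRing.maximalIdeal A = Ideal.span {s} := by
  have : Module.FaithfullyFlat A B := .of_flat_of_isLocalHom
  -- An element of the maximal ideal of `A` whose image is not in the square of that of `B`.
  obtain ⟨s, hs, hs2⟩ : ∃ s ∈ IsLocalRing.maximalIdeal A,
      algebraMap A B s ∉ Ideal.span {a * a} := by
    by_contra! hcon
    have h1 : a ∈ Ideal.span {a * a} := by
      have h2 : IsLocalRing.maximalIdeal B ≤ Ideal.span {a * a} := by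
        rw [← h, Ideal.map_le_iff_le_comap]
        exact hcon
      exact h2 (ha ▸ Ideal.mem_span_singleton_self a)
    obtain ⟨r, hr⟩ := Ideal.mem_span_singleton'.1 h1
    have h2 : (r * a - 1) * a = 0 := by linear_combination hr
    have h3 : r * a - 1 = 0 := (mem_nonZeroDivisors_iff_right.1 ha') _ h2
    have h4 : a ∈ IsLocalRing.maximalIdeal B := ha ▸ Ideal.mem_span_singleton_self a
    exact h4 (IsUnit.of_mul_eq_one_right r (sub_eq_zero.1 h3))
  have h1 : algebraMap A B s ∈ Ideal.span {a} := by
    rw [← ha, ← h]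
    exact Ideal.mem_map_of_mem _ hs
  obtain ⟨r, hr⟩ := Ideal.mem_span_singleton'.1 h1
  have hru : IsUnit r := by
    by_contra hru
    have h2 : r ∈ Ideal.span {a} := ha ▸ hru
    obtain ⟨r', rfl⟩ := Ideal.mem_span_singleton'.1 h2
    exact hs2 (Ideal.mem_span_singleton'.2 ⟨r', by rw [← hr]; ring⟩)
  refine ⟨s, mem_nonZeroDivisors_iff_right.2 fun c hc => ?_, ?_⟩
  · apply FaithfulSMul.algebraMap_injective A B
    rw [map_zero]
    have h2 := congrArg (algebraMap A B) hc
    rw [map_mul, ← hr, map_zero, ← mul_assoc] at h2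
    have h3 := (mem_nonZeroDivisors_iff_right.1 ha') _ h2
    rwa [hru.mul_left_eq_zero] at h3
  · rw [← Ideal.comap_map_eq_self_of_faithfullyFlat (B := B) (Ideal.span {s}),
      ← Ideal.comap_map_eq_self_of_faithfullyFlat (B := B) (IsLocalRing.maximalIdeal A), h, ha,
      Ideal.map_span, Set.image_singleton, ← hr, Ideal.span_singleton_mul_left_unit hru]

end Algebra

section Schemes

variable {Y : Scheme.{u}}

lemma mem_primeIdealOf_iff {W : Y.Opens} (hW : IsAffineOpen W) (x : Y) (hx : x ∈ W)
    (g : Γ(Y, W)) : g ∈ (hW.primeIdealOf ⟨x, hx⟩).asIdeal ↔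
      Y.presheaf.germ W x hx g ∈ IsLocalRing.maximalIdeal (Y.presheaf.stalk x) := by
  rw [hW.primeIdealOf_eq_map_closedPoint]
  rfl

lemma mem_primeIdealOf_iff_notMem_basicOpen {W : Y.Opens} (hW : IsAffineOpen W) (x : Y)
    (hx : x ∈ W) (g : Γ(Y, W)) :
    g ∈ (hW.primeIdealOf ⟨x, hx⟩).asIdeal ↔ x ∉ Y.basicOpen g := by
  rw [Scheme.mem_basicOpen Y g x hx, mem_primeIdealOf_iff]
  rfl

/-- A function that generates the maximal ideal at a closed point vanishes only at this point in a
neighbourhood. -/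
lemma exists_open_forall_eq_of_notMem_basicOpen [IsLocallyNoetherian Y] (y : Y)
    (hy : IsClosed {y}) (a : Γ(Y, ⊤))
    (h : IsLocalRing.maximalIdeal (Y.presheaf.stalk y) = Ideal.span {germTop y a}) :
    ∃ V : Y.Opens, y ∈ V ∧ ∀ u ∈ V, u ∉ Y.basicOpen a → u = y := by
  obtain ⟨_, ⟨W, hW, rfl⟩, hyW, -⟩ :=
    Y.isBasis_affineOpens.exists_subset_of_mem_open (Set.mem_univ y) isOpen_univ
  let : Algebra Γ(Y, W) (Y.presheaf.stalk y) :=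
    TopCat.Presheaf.algebra_section_stalk Y.presheaf ⟨y, hyW⟩
  have hloc : IsLocalization.AtPrime (Y.presheaf.stalk y) (hW.primeIdealOf ⟨y, hyW⟩).asIdeal :=
    hW.isLocalization_stalk ⟨y, hyW⟩
  have hmax := hW.primeIdealOf_isMaximal_of_isClosed ⟨y, hyW⟩ hy
  have hno : IsNoetherianRing Γ(Y, W) := IsLocallyNoetherian.component_noetherian ⟨W, hW⟩
  let a' : Γ(Y, W) := Y.presheaf.map (homOfLE le_top).op a
  have ha' : algebraMap Γ(Y, W) (Y.presheaf.stalk y) a' = germTop y a :=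
    TopCat.Presheaf.germ_res_apply Y.presheaf (homOfLE le_top) y hyW a
  obtain ⟨f, hf, hfb⟩ := exists_notMem_forall_mul_mem (hW.primeIdealOf ⟨y, hyW⟩).asIdeal
    (A := Y.presheaf.stalk y) (I := (hW.primeIdealOf ⟨y, hyW⟩).asIdeal) (J := Ideal.span {a'})
    (IsNoetherian.noetherian _) (by
    rw [Ideal.map_span, Set.image_singleton, ha', ← h,
      IsLocalization.AtPrime.map_eq_maximalIdeal])
  have hmem (u : Y) (huW : u ∈ W) (g : Γ(Y, W)) :
      g ∈ (hW.primeIdealOf ⟨u, huW⟩).asIdeal ↔ u ∉ Y.basicOpen g :=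
    mem_primeIdealOf_iff_notMem_basicOpen hW u huW g
  refine ⟨Y.basicOpen f, by_contra fun hcon => hf ((hmem y hyW f).2 hcon), fun u hu hua => ?_⟩
  have huW : u ∈ W := Y.basicOpen_le f hu
  have hua' : a' ∈ (hW.primeIdealOf ⟨u, huW⟩).asIdeal := by
    rw [hmem, Scheme.basicOpen_res]
    exact fun hcon => hua hcon.2
  have hle : (hW.primeIdealOf ⟨y, hyW⟩).asIdeal ≤ (hW.primeIdealOf ⟨u, huW⟩).asIdeal := by
    intro b hb
    have h1 : f * b ∈ (hW.primeIdealOf ⟨u, huW⟩).asIdeal :=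
      (Ideal.span_singleton_le_iff_mem _).2 hua' (hfb b hb)
    exact ((hW.primeIdealOf ⟨u, huW⟩).2.mem_or_mem h1).resolve_left
      fun hcon => (hmem u huW f).1 hcon hu
  have heq : hW.primeIdealOf ⟨y, hyW⟩ = hW.primeIdealOf ⟨u, huW⟩ :=
    PrimeSpectrum.ext (hmax.eq_of_le (hW.primeIdealOf ⟨u, huW⟩).2.ne_top hle)
  have h3 := congrArg hW.fromSpec heq
  rw [hW.fromSpec_primeIdealOf, hW.fromSpec_primeIdealOf] at h3
  exact h3.symm

/-- A local parameter at a point spreads out to a neighbourhood. -/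
lemma exists_affineOpen_primeIdealOf_eq_span [IsLocallyNoetherian Y] (x : Y) {V₀ : Y.Opens}
    (hx : x ∈ V₀) {s : Y.presheaf.stalk x} (hs : s ∈ nonZeroDivisors (Y.presheaf.stalk x))
    (h : IsLocalRing.maximalIdeal (Y.presheaf.stalk x) = Ideal.span {s}) :
    ∃ (V : Y.Opens) (hV : IsAffineOpen V) (hxV : x ∈ V) (s' : Γ(Y, V)), V ≤ V₀ ∧
      s' ∈ nonZeroDivisors Γ(Y, V) ∧ (hV.primeIdealOf ⟨x, hxV⟩).asIdeal = Ideal.span {s'} := by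
  obtain ⟨_, ⟨W, hW, rfl⟩, hxW, hWV⟩ :=
    Y.isBasis_affineOpens.exists_subset_of_mem_open (show x ∈ (V₀ : Set Y) from hx) V₀.2
  let : Algebra Γ(Y, W) (Y.presheaf.stalk x) :=
    TopCat.Presheaf.algebra_section_stalk Y.presheaf ⟨x, hxW⟩
  let p := (hW.primeIdealOf ⟨x, hxW⟩).asIdeal
  have hloc : IsLocalization.AtPrime (Y.presheaf.stalk x) p := hW.isLocalization_stalk ⟨x, hxW⟩
  have hno : IsNoetherianRing Γ(Y, W) := IsLocallyNoetherian.component_noetherian ⟨W, hW⟩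
  obtain ⟨⟨s₀, d⟩, hsd⟩ := IsLocalization.surj p.primeCompl s
  have hd : IsUnit (algebraMap Γ(Y, W) (Y.presheaf.stalk x) d) := IsLocalization.map_units _ d
  have hs₀ : algebraMap Γ(Y, W) (Y.presheaf.stalk x) s₀ ∈
      nonZeroDivisors (Y.presheaf.stalk x) := by
    rw [← hsd]
    exact mul_mem hs hd.mem_nonZeroDivisors
  -- On the open set where `f₁` is invertible, `s₀` generates the ideal `p`; on the one where `f₂`
  -- is invertible, it is a nonzerodivisor.
  obtain ⟨f₁, hf₁, hfb₁⟩ := exists_notMem_forall_mul_mem p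
    (A := Y.presheaf.stalk x) (I := p) (J := Ideal.span {s₀}) (IsNoetherian.noetherian _) (by
    rw [Ideal.map_span, Set.image_singleton, ← hsd, Ideal.span_singleton_mul_right_unit hd, ← h,
      IsLocalization.AtPrime.map_eq_maximalIdeal])
  obtain ⟨f₂, hf₂, hfb₂⟩ := exists_notMem_forall_mul_mem p
    (A := Y.presheaf.stalk x) (I := LinearMap.ker (LinearMap.mulLeft Γ(Y, W) s₀)) (J := ⊥)
    (IsNoetherian.noetherian _) (by
    rw [Ideal.map_le_iff_le_comap]
    intro c hc
    have hc' : s₀ * c = 0 := hc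
    rw [Ideal.map_bot, Ideal.mem_comap, Ideal.mem_bot]
    refine mem_nonZeroDivisors_iff_right.1 hs₀ _ ?_
    rw [← map_mul, mul_comm, hc', map_zero])
  let f := f₁ * f₂
  have hf : f ∉ p := fun hcon => ((hW.primeIdealOf ⟨x, hxW⟩).2.mem_or_mem hcon).elim hf₁ hf₂
  have hxf : x ∈ Y.basicOpen f := by_contra fun hcon =>
    hf ((mem_primeIdealOf_iff_notMem_basicOpen hW x hxW f).2 hcon)
  have haff : IsLocalization.Away f Γ(Y, Y.basicOpen f) := hW.isLocalization_basicOpen f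
  let r := algebraMap Γ(Y, W) Γ(Y, Y.basicOpen f)
  have hrf : IsUnit (r f) := IsLocalization.Away.algebraMap_isUnit f
  have hgerm (b : Γ(Y, W)) : Y.presheaf.germ (Y.basicOpen f) x hxf (r b) =
      algebraMap Γ(Y, W) (Y.presheaf.stalk x) b := TopCat.Presheaf.germ_res_apply _ _ _ _ _
  have hmem (b : Γ(Y, W)) : r b ∈ ((hW.basicOpen f).primeIdealOf ⟨x, hxf⟩).asIdeal ↔ b ∈ p := by
    refine (mem_primeIdealOf_iff _ x hxf _).trans
      (Iff.trans ?_ (mem_primeIdealOf_iff _ x hxW b).symm)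
    exact iff_of_eq (congrArg (· ∈ IsLocalRing.maximalIdeal (Y.presheaf.stalk x)) (hgerm b))
  refine ⟨Y.basicOpen f, hW.basicOpen f, hxf, r s₀, (Y.basicOpen_le f).trans hWV, ?_, ?_⟩
  · refine mem_nonZeroDivisors_iff_right.2 fun c hc => ?_
    obtain ⟨n, c₀, hc₀⟩ := IsLocalization.Away.surj f c
    have h1 : r (c₀ * s₀) = 0 := by
      rw [map_mul, ← hc₀, mul_right_comm, hc, zero_mul]
    obtain ⟨⟨_, m, rfl⟩, hm⟩ := (IsLocalization.map_eq_zero_iff (.powers f) _ _).1 h1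
    have h2 : f₂ * (f ^ m * c₀) = 0 := hfb₂ _ (by
      change s₀ * _ = 0
      rw [← hm]
      ring)
    have h3 : r f * (r f ^ m * r c₀) = 0 := by
      rw [← map_pow, ← map_mul, ← map_mul, mul_assoc, h2, mul_zero, map_zero]
    rwa [hrf.mul_right_eq_zero, (hrf.pow m).mul_right_eq_zero, ← hc₀,
      (hrf.pow n).mul_left_eq_zero] at h3
  · apply le_antisymm
    · intro b hb
      obtain ⟨n, b₀, hb₀⟩ := IsLocalization.Away.surj f b
      have h1 : b₀ ∈ p := (hmem b₀).1 (by
        rw [← hb₀]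
        exact Ideal.mul_mem_right _ _ hb)
      obtain ⟨e, he⟩ := Ideal.mem_span_singleton'.1 (hfb₁ b₀ h1)
      have h2 : IsUnit (r f₁) := by
        have := hrf
        rw [map_mul] at this
        exact isUnit_of_mul_isUnit_left this
      rw [← Ideal.mul_unit_mem_iff_mem _ (hrf.pow n), hb₀, ← Ideal.unit_mul_mem_iff_mem _ h2,
        ← map_mul, ← he, map_mul]
      exact Ideal.mul_mem_left _ _ (Ideal.mem_span_singleton_self _)
    · rw [Ideal.span_singleton_le_iff_mem, hmem]
      have h1 : algebraMap Γ(Y, W) (Y.presheaf.stalk x) s₀ ∈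
          IsLocalRing.maximalIdeal (Y.presheaf.stalk x) := by
        rw [h, ← hsd]
        exact Ideal.mul_mem_right _ _ (Ideal.mem_span_singleton_self _)
      exact (IsLocalization.AtPrime.to_map_mem_maximal_iff (Y.presheaf.stalk x) p s₀).1 h1

/-- Points with residue field finite over the base field are closed. -/
lemma isClosed_singleton_of_finite {K : Type u} [Field K] (p : Y ⟶ Spec (.of K))
    [LocallyOfFiniteType p] (y : Y)
    (h : ((IsLocalRing.residue (Y.presheaf.stalk y)).comp (stalkScalar y p)).Finite) :
    IsClosed {y} := by
  have hj : JacobsonSpace (Spec (.of K)) := inferInstanceAs (JacobsonSpace (PrimeSpectrum K))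
  have : JacobsonSpace Y := LocallyOfFiniteType.jacobsonSpace p
  rw [isClosed_singleton_iff_locallyOfFiniteType]
  have h1 : Y.fromSpecResidueField y ≫ p = Spec.map (CommRingCat.ofHom
      ((IsLocalRing.residue (Y.presheaf.stalk y)).comp (stalkScalar y p))) := by
    rw [CommRingCat.ofHom_comp, Spec.map_comp, map_stalkScalar]
    exact Category.assoc _ _ _
  have h2 : LocallyOfFiniteType (Y.fromSpecResidueField y ≫ p) := by
    rw [h1]
    exact (HasRingHomProperty.Spec_iff (P := @LocallyOfFiniteType)).2 h.to_finiteType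
  exact locallyOfFiniteType_of_comp _ p

end Schemes

/-! ### The support of the log structure -/

lemma exists_common_preimage {X : Scheme.{u}} (V₁ V₂ : X.Etale) (y₁ : V₁.left) (y₂ : V₂.left)
    (e : V₁.hom y₁ = V₂.hom y₂) :
    ∃ (V₃ : X.Etale) (p₁ : V₃ ⟶ V₁) (p₂ : V₃ ⟶ V₂) (z : V₃.left),
      p₁.left z = y₁ ∧ p₂.left z = y₂ := by
  obtain ⟨z, h1, h2⟩ := Scheme.Pullback.exists_preimage_pullback y₁ y₂ e
  let V₃ : X.Etale := Scheme.Etale.mk (pullback.fst V₁.hom V₂.hom ≫ V₁.hom)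
  exact ⟨V₃, MorphismProperty.Over.homMk (pullback.fst V₁.hom V₂.hom) rfl,
    MorphismProperty.Over.homMk (pullback.snd V₁.hom V₂.hom) pullback.condition.symm, z, h1, h2⟩

lemma exists_opens_mem_iff_of_etale {U X : Scheme.{u}} (h : U ⟶ X) [Etale h] (V : U.Opens) :
    ∃ W : X.Opens, ∀ x, x ∈ W ↔ ∃ u ∈ V, h u = x :=
  ⟨⟨h '' V, h.isOpenMap _ V.2⟩, fun _ => Iff.rfl⟩

namespace LogScheme

variable {X : LogScheme.{u}}

lemma IsChart.res {U W : X.scheme.Etale} {P : Type u} [CommMonoid P] {φ : P →* X.sections U}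
    (hφ : IsChart φ) (r : W ⟶ U) : IsChart ((X.res r).comp φ) where
  locally_surjective V h m x := by
    obtain ⟨V', k, x', p, w, h1, h2, h3⟩ := hφ.locally_surjective V (h ≫ r) m x
    refine ⟨V', k, x', p, w, h1, h2, h3.trans ?_⟩
    rw [← Category.assoc]
    exact congrArg (w * ·) (X.logStructure.res_res _ _ _).symm
  locally_injective V h p q w hw e x := by
    have h0 (V' : X.scheme.Etale) (k : V' ⟶ W) (p : P) :
        X.res k ((X.res r).comp φ p) = X.res (k ≫ r) (φ p) := X.logStructure.res_res _ _ _
    rw [h0, h0] at e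
    obtain ⟨V', k, x', a, b, h1, h2, h3, h4, h5⟩ := hφ.locally_injective V (h ≫ r) p q w hw e x
    rw [← Category.assoc] at h2 h3 h5
    rw [← h0] at h2 h3
    rw [← h0, ← h0] at h5
    exact ⟨V', k, x', a, b, h1, h2, h3, h4, h5⟩

/-- A chart by a monoid consisting of the powers of one element `t`, all of which except `1` vanish
at the point `y`. The monoid is trivial or isomorphic to `ℕ`. -/
structure IsMonogenicChart {U : X.scheme.Etale} {Q : Type u} [CommMonoid Q]
    (φ : Q →* X.sections U) (t : Q) (y : U.left) : Prop where
  fg : Monoid.FG Q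
  isCancelMul : IsCancelMul Q
  isChart : IsChart φ
  eq_one : ∀ q, y ∈ U.left.basicOpen (X.α U (φ q)) → q = 1
  exists_eq_pow : ∀ p, ∃ n : ℕ, p = t ^ n

lemma α_res_mem_basicOpen {U W : X.scheme.Etale} (r : W ⟶ U) (m : X.sections U) (w : W.left) :
    w ∈ W.left.basicOpen (X.α W (X.res r m)) ↔ r.left w ∈ U.left.basicOpen (X.α U m) := by
  rw [show X.α W (X.res r m) = _ from X.logStructure.α_res r m]
  exact appTop_mem_basicOpen _ _ _

lemma IsMonogenicChart.res {U W : X.scheme.Etale} {Q : Type u} [CommMonoid Q]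
    {φ : Q →* X.sections U} {t : Q} {y : U.left} (h : IsMonogenicChart φ t y) (r : W ⟶ U)
    {w : W.left} (hw : r.left w = y) : IsMonogenicChart ((X.res r).comp φ) t w where
  fg := h.fg
  isCancelMul := h.isCancelMul
  isChart := h.isChart.res r
  eq_one q hq := h.eq_one q (hw ▸ (α_res_mem_basicOpen r _ w).1 hq)
  exists_eq_pow := h.exists_eq_pow

variable (X) in
/-- The support of a log structure: the set of points at which it is not trivial. -/
def boundary : Set X.scheme :=
  {x | ∃ (U : X.scheme.Etale) (y : U.left) (m : X.sections U),
    U.hom y = x ∧ y ∉ U.left.basicOpen (X.α U m)}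

lemma hom_mem_boundary_iff {U : X.scheme.Etale} {Q : Type u} [CommMonoid Q]
    {φ : Q →* X.sections U} (hφ : IsChart φ) {t : Q} (ht : ∀ p, ∃ n : ℕ, p = t ^ n) (u : U.left) :
    U.hom u ∈ X.boundary ↔ u ∉ U.left.basicOpen (X.α U (φ t)) := by
  refine ⟨?_, fun h => ⟨U, u, φ t, rfl, h⟩⟩
  rintro ⟨U', y', m, hy', hm⟩ hu
  obtain ⟨W, h, h', w, hw, hw'⟩ := exists_common_preimage U U' u y' hy'.symm
  obtain ⟨W', k, w', p, v, hkw, hv, hp⟩ := hφ.locally_surjective W h (X.res h' m) w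
  refine hm ?_
  rw [← hw', ← α_res_mem_basicOpen, ← hkw, ← α_res_mem_basicOpen, hp, map_mul,
    Scheme.basicOpen_mul]
  refine ⟨?_, ?_⟩
  · rw [Scheme.basicOpen_of_isUnit _ (hv.map (X.α W'))]
    trivial
  · refine (α_res_mem_basicOpen _ _ _).2 ?_
    obtain ⟨n, rfl⟩ := ht p
    have h1 : (k ≫ h).left w' = u := by
      rw [← hw, ← hkw]
      exact Scheme.Hom.comp_apply k.left h.left w'
    rw [h1, map_pow, map_pow]
    exact (U.left.mem_basicOpen _ u (TopologicalSpace.Opens.mem_top u)).2 (by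
      rw [map_pow]
      exact ((U.left.mem_basicOpen _ u (TopologicalSpace.Opens.mem_top u)).1 hu).pow n)

variable {K : Type u} [Field K] {f : X ⟶ trivial (Spec (.of K))}

theorem IsLogSmoothCurve.exists_isMonogenicChart (hf : IsLogSmoothCurve f) (W : X.scheme.Etale)
    (w : W.left) :
    ∃ (W' : X.scheme.Etale) (k : W' ⟶ W) (w' : W'.left) (Q : Type u) (_ : CommMonoid Q)
      (φ : Q →* X.sections W') (t : Q), k.left w' = w ∧ IsMonogenicChart φ t w' := by
  obtain ⟨U, y, Q, _, φ, t, hy, h1, h2, h3, h4, h5⟩ := hf.exists_chart (W.hom w)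
  obtain ⟨W', k, r, w', hk, hr⟩ := exists_common_preimage W U w y hy.symm
  exact ⟨W', k, w', Q, _, _, t, hk, IsMonogenicChart.res ⟨h1, h2, h3, h4, h5⟩ r hr⟩

lemma IsLogSmoothCurve.isClosed_boundary (hf : IsLogSmoothCurve f) : IsClosed X.boundary := by
  rw [← isOpen_compl_iff, isOpen_iff_forall_mem_open]
  intro x hx
  obtain ⟨U, y, Q, _, φ, t, rfl, h1, h2, h3, h4, h5⟩ := hf.exists_chart x
  have : Etale U.hom := U.prop
  obtain ⟨W, hW⟩ := exists_opens_mem_iff_of_etale (X := X.scheme) U.hom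
    (U.left.basicOpen (X.α U (φ t)))
  refine ⟨(W : Set X.scheme), ?_, W.2, (hW _).2 ⟨y, ?_, rfl⟩⟩
  · intro z hz hu'
    obtain ⟨u, hu, rfl⟩ := (hW z).1 hz
    exact (hom_mem_boundary_iff h3 h5 u).1 hu' hu
  · by_contra hcon
    exact hx ((hom_mem_boundary_iff h3 h5 y).2 hcon)

lemma IsMonogenicChart.ne_one {U : X.scheme.Etale} {Q : Type u} [CommMonoid Q]
    {φ : Q →* X.sections U} {t : Q} {y : U.left} (h : IsMonogenicChart φ t y)
    (hy : U.hom y ∈ X.boundary) : t ≠ 1 := by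
  rintro rfl
  refine (hom_mem_boundary_iff h.isChart h.exists_eq_pow y).1 hy ?_
  rw [map_one, map_one, Scheme.basicOpen_of_isUnit _ isUnit_one]
  trivial

/-- Finiteness and separability of the residue field over `K` descend along local homomorphisms. -/
lemma finite_isSeparable_residueField {A B : Type*} [CommRing A] [CommRing B] [IsLocalRing A]
    [IsLocalRing B] [Algebra K A] [Algebra K B] [Algebra A B] [IsScalarTower K A B]
    [IsLocalHom (algebraMap A B)]
    [Algebra.IsSeparable K (IsLocalRing.ResidueField B)]
    [Module.Finite K (IsLocalRing.ResidueField B)] :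
    Algebra.IsSeparable K (IsLocalRing.ResidueField A) ∧
      Module.Finite K (IsLocalRing.ResidueField A) := by
  have : IsScalarTower K (IsLocalRing.ResidueField A) (IsLocalRing.ResidueField B) :=
    .of_algebraMap_eq fun r => by
      rw [IsScalarTower.algebraMap_apply K B (IsLocalRing.ResidueField B),
        IsScalarTower.algebraMap_apply K A B,
        IsScalarTower.algebraMap_apply K A (IsLocalRing.ResidueField A)]
      rfl
  exact ⟨Algebra.isSeparable_tower_bot_of_isSeparable K _ (IsLocalRing.ResidueField B),
    .of_injective (IsScalarTower.toAlgHom K (IsLocalRing.ResidueField A)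
      (IsLocalRing.ResidueField B)).toLinearMap (algebraMap (IsLocalRing.ResidueField A)
      (IsLocalRing.ResidueField B)).injective⟩

/-- Near a point of its support, the support of the log structure of a log smooth curve consists of
this point only. It is cut out by a nonzerodivisor, and its residue field is finite separable. -/
theorem IsLogSmoothCurve.exists_affineOpen (hf : IsLogSmoothCurve f) {x : X.scheme}
    (hx : x ∈ X.boundary) :
    ∃ (V : X.scheme.Opens) (hV : IsAffineOpen V) (hxV : x ∈ V) (s : Γ(X.scheme, V)),
      (∀ z ∈ V, z ∈ X.boundary → z = x) ∧ s ∈ nonZeroDivisors Γ(X.scheme, V) ∧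
      (hV.primeIdealOf ⟨x, hxV⟩).asIdeal = Ideal.span {s} ∧
      IsClosed {x} ∧
      letI := (stalkScalar x f.base).toAlgebra
      Algebra.IsSeparable K (IsLocalRing.ResidueField (X.scheme.presheaf.stalk x)) ∧
      Module.Finite K (IsLocalRing.ResidueField (X.scheme.presheaf.stalk x)) := by
  obtain ⟨U, y, Q, _, φ, t, rfl, h1, h2, h3, h4, h5⟩ := hf.exists_chart x
  have ht : t ≠ 1 := IsMonogenicChart.ne_one ⟨h1, h2, h3, h4, h5⟩ hx
  have := hf.logSmooth.locallyOfFinitePresentation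
  have : IsLocallyNoetherian (trivial (Spec (.of K))).scheme :=
    inferInstanceAs (IsLocallyNoetherian (Spec (.of K)))
  have : IsLocallyNoetherian X.scheme := LocallyOfFiniteType.isLocallyNoetherian f.base
  have : Etale U.hom := U.prop
  have : IsLocallyNoetherian U.left :=
    @LocallyOfFiniteType.isLocallyNoetherian _ _ U.hom inferInstance
      (inferInstanceAs (IsLocallyNoetherian X.scheme))
  have hft : LocallyOfFiniteType (U.hom ≫ f.base) := inferInstance
  have hft' : LocallyOfFiniteType f.base := inferInstance
  obtain ⟨hm, hsep, hfin⟩ := hf.maximalIdeal_eq_span y h3 h4 h5 ht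
  have hnz := hf.chartGerm_mem_nonZeroDivisors y h3 h4 h5 ht
  let A := X.scheme.presheaf.stalk (U.hom y)
  let B := U.left.presheaf.stalk y
  let : Algebra K A := (stalkScalar (U.hom y) f.base).toAlgebra
  let : Algebra K B := (scalar f y).toAlgebra
  let : Algebra A B := (U.hom.stalkMap y).hom.toAlgebra
  have : IsScalarTower K A B := .of_algebraMap_eq' (stalkMap_comp_stalkScalar _ _ _).symm
  have : IsLocalHom (algebraMap A B) := inferInstanceAs <| IsLocalHom (U.hom.stalkMap y).hom
  have : Module.Flat A B := Flat.stalkMap U.hom y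
  have hsf : Algebra.IsSeparable K (IsLocalRing.ResidueField A) ∧
      Module.Finite K (IsLocalRing.ResidueField A) :=
    @finite_isSeparable_residueField K _ A B _ _ _ _ _ _ _ _ _ hsep hfin
  have hyc : IsClosed {y} := @isClosed_singleton_of_finite U.left K _ (U.hom ≫ f.base) hft y
    (RingHom.finite_algebraMap.2 hfin)
  have hxc : IsClosed {U.hom y} := @isClosed_singleton_of_finite X.scheme K _ f.base hft' (U.hom y)
    (RingHom.finite_algebraMap.2 hsf.2)
  obtain ⟨U', hyU', hU'⟩ := exists_open_forall_eq_of_notMem_basicOpen y hyc (X.α U (φ t)) hm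
  -- The generator of the chart is a function on the étale neighbourhood `U` only; its properties
  -- descend to `X`.
  obtain ⟨s, hs, hms⟩ := exists_maximalIdeal_eq_span (A := A) (B := B)
    (map_maximalIdeal_stalkMap U.hom y) hm hnz
  obtain ⟨V₀, hV₀⟩ := exists_opens_mem_iff_of_etale (X := X.scheme) U.hom U'
  obtain ⟨V, hV, hxV, s', hVV, hs', hps⟩ := exists_affineOpen_primeIdealOf_eq_span
    (Y := X.scheme) (U.hom y) ((hV₀ _).2 ⟨y, hyU', rfl⟩) hs hms
  refine ⟨V, hV, hxV, s', fun z hz hzb => ?_, hs', hps, hxc, hsf⟩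
  obtain ⟨u, hu, rfl⟩ := (hV₀ z).1 (hVV hz)
  rw [hU' u hu ((hom_mem_boundary_iff h3 h5 u).1 hzb)]

end LogScheme

/-! ### The divisor -/

lemma etale_quotient {K R A : Type u} [Field K] [CommRing R] [CommRing A] [IsLocalRing A]
    [Algebra K R] [Algebra K A] [Algebra R A] [IsScalarTower K R A]
    [Algebra.IsSeparable K (IsLocalRing.ResidueField A)]
    [Module.Finite K (IsLocalRing.ResidueField A)] (p : Ideal R) [p.IsMaximal]
    (hp : ∀ b ∈ p, algebraMap R A b ∈ IsLocalRing.maximalIdeal A) : Algebra.Etale K (R ⧸ p) := by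
  let : Field (R ⧸ p) := Ideal.Quotient.field p
  let q : R ⧸ p →ₐ[K] IsLocalRing.ResidueField A :=
    Ideal.Quotient.liftₐ p (IsScalarTower.toAlgHom K R (IsLocalRing.ResidueField A))
      fun b hb => (IsLocalRing.residue_eq_zero_iff _).2 (hp b hb)
  have hq : Function.Injective q := q.toRingHom.injective
  have : Module.Finite K (R ⧸ p) := .of_injective q.toLinearMap hq
  have : Algebra.IsSeparable K (R ⧸ p) := .of_algHom K _ q
  have : Algebra.FormallyEtale K (R ⧸ p) := .of_isSeparable K _
  exact ⟨inferInstance, Algebra.FinitePresentation.of_finiteType.1 inferInstance⟩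

variable {K : Type u} [Field K]

/-- Over an affine open on which an ideal sheaf is the ideal of a closed point with finite separable
residue field, the closed subscheme is étale. -/
lemma etale_subschemeCover_comp {Y : Scheme.{u}} (p : Y ⟶ Spec (.of K)) (D : Y.IdealSheafData)
    {x : Y} (hx : IsClosed {x}) {V : Y.Opens} (hV : IsAffineOpen V) (hxV : x ∈ V)
    (hD : D.ideal ⟨V, hV⟩ = (hV.primeIdealOf ⟨x, hxV⟩).asIdeal)
    (h : letI := (stalkScalar x p).toAlgebra
      Algebra.IsSeparable K (IsLocalRing.ResidueField (Y.presheaf.stalk x)) ∧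
      Module.Finite K (IsLocalRing.ResidueField (Y.presheaf.stalk x))) :
    Etale (D.subschemeCover.f ⟨V, hV⟩ ≫ D.subschemeι ≫ p) := by
  obtain ⟨ψ, hψ⟩ := Spec.map_surjective (R := .of K) (S := Γ(Y, V)) (hV.fromSpec ≫ p)
  have h1 : D.subschemeCover.f ⟨V, hV⟩ ≫ D.subschemeι ≫ p =
      Spec.map (ψ ≫ CommRingCat.ofHom (Ideal.Quotient.mk (D.ideal ⟨V, hV⟩))) := by
    refine (Category.assoc _ _ _).symm.trans ?_
    refine (congrArg (· ≫ p) ((D.subschemeCover_map_subschemeι ⟨V, hV⟩).trans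
      (D.glueDataObjι_ι ⟨V, hV⟩))).trans ?_
    refine (Category.assoc _ _ _).trans ?_
    rw [Spec.map_comp, hψ]
    rfl
  have h2 : (Y.presheaf.germ V x hxV).hom.comp ψ.hom = stalkScalar x p := by
    refine congrArg CommRingCat.Hom.hom (Spec.map_injective
      (a₁ := ψ ≫ Y.presheaf.germ V x hxV) (a₂ := CommRingCat.ofHom (stalkScalar x p)) ?_)
    refine Eq.trans ?_ (map_stalkScalar x p).symm
    rw [Spec.map_comp, hψ, ← hV.fromSpecStalk_eq_fromSpecStalk hxV,
      IsAffineOpen.fromSpecStalk, Category.assoc]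
  rw [h1]
  refine (HasRingHomProperty.Spec_iff (P := @Etale)).2 ?_
  obtain ⟨hsep, hfin⟩ := h
  let : Algebra K Γ(Y, V) := ψ.hom.toAlgebra
  let : Algebra K (Y.presheaf.stalk x) := (stalkScalar x p).toAlgebra
  let : Algebra Γ(Y, V) (Y.presheaf.stalk x) := (Y.presheaf.germ V x hxV).hom.toAlgebra
  have : IsScalarTower K Γ(Y, V) (Y.presheaf.stalk x) := .of_algebraMap_eq' h2.symm
  have : (D.ideal ⟨V, hV⟩).IsMaximal :=
    hD ▸ hV.primeIdealOf_isMaximal_of_isClosed ⟨x, hxV⟩ hx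
  exact etale_quotient (K := K) (R := Γ(Y, V)) (A := Y.presheaf.stalk x) (D.ideal ⟨V, hV⟩)
    fun b hb => (mem_primeIdealOf_iff hV x hxV b).1 (hD ▸ hb)

namespace LogScheme

variable {X : LogScheme.{u}} {f : X ⟶ trivial (Spec (.of K))}

/-- The reduced closed subscheme structure on the support of the log structure of a log smooth
curve. -/
noncomputable def IsLogSmoothCurve.divisor (hf : IsLogSmoothCurve f) : X.scheme.IdealSheafData :=
  .vanishingIdeal ⟨X.boundary, hf.isClosed_boundary⟩

lemma IsLogSmoothCurve.coe_support_divisor (hf : IsLogSmoothCurve f) :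
    (hf.divisor.support : Set X.scheme) = X.boundary := by
  rw [IsLogSmoothCurve.divisor, Scheme.IdealSheafData.coe_support_vanishingIdeal]
  rfl

lemma IsLogSmoothCurve.divisor_ideal_eq (hf : IsLogSmoothCurve f) {x : X.scheme}
    (hx : x ∈ X.boundary) {V : X.scheme.Opens} (hV : IsAffineOpen V) (hxV : x ∈ V)
    (h : ∀ z ∈ V, z ∈ X.boundary → z = x) :
    hf.divisor.ideal ⟨V, hV⟩ = (hV.primeIdealOf ⟨x, hxV⟩).asIdeal := by
  have h1 : hV.fromSpec ⁻¹' X.boundary = {hV.primeIdealOf ⟨x, hxV⟩} := by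
    refine Set.ext fun z => Iff.trans ?_ Set.mem_singleton_iff.symm
    constructor
    · intro hz
      have h2 : hV.fromSpec z ∈ V := by
        have : hV.fromSpec z ∈ Set.range hV.fromSpec := ⟨z, rfl⟩
        rwa [hV.range_fromSpec] at this
      exact hV.fromSpec.isOpenEmbedding.injective
        ((h _ h2 hz).trans (hV.fromSpec_primeIdealOf ⟨x, hxV⟩).symm)
    · rintro rfl
      change hV.fromSpec (hV.primeIdealOf ⟨x, hxV⟩) ∈ X.boundary
      rwa [hV.fromSpec_primeIdealOf]
  rw [IsLogSmoothCurve.divisor, Scheme.IdealSheafData.vanishingIdeal_ideal]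
  refine (congrArg PrimeSpectrum.vanishingIdeal h1).trans ?_
  exact PrimeSpectrum.vanishingIdeal_singleton _

theorem IsLogSmoothCurve.isEffectiveCartierDivisor (hf : IsLogSmoothCurve f) :
    IsEffectiveCartierDivisor hf.divisor := by
  intro x
  by_cases hx : x ∈ X.boundary
  · obtain ⟨V, hV, hxV, s, h1, h2, h3, -⟩ := hf.exists_affineOpen hx
    exact ⟨⟨V, hV⟩, s, hxV, h2, (hf.divisor_ideal_eq hx hV hxV h1).trans h3⟩
  · obtain ⟨_, ⟨V, hV, rfl⟩, hxV, hVZ⟩ := X.scheme.isBasis_affineOpens.exists_subset_of_mem_open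
      (show x ∈ X.boundaryᶜ from hx) hf.isClosed_boundary.isOpen_compl
    refine ⟨⟨V, hV⟩, 1, hxV, one_mem _, ?_⟩
    have h1 : hV.fromSpec ⁻¹' X.boundary = ∅ := by
      refine Set.eq_empty_iff_forall_notMem.2 fun z hz => hVZ ?_ hz
      rw [← hV.range_fromSpec]
      exact ⟨z, rfl⟩
    rw [IsLogSmoothCurve.divisor, Scheme.IdealSheafData.vanishingIdeal_ideal]
    refine (congrArg PrimeSpectrum.vanishingIdeal h1).trans ?_
    rw [Ideal.span_singleton_one]
    exact PrimeSpectrum.vanishingIdeal_empty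

theorem IsLogSmoothCurve.etale_divisor (hf : IsLogSmoothCurve f) :
    Etale (hf.divisor.subschemeι ≫ f.base) := by
  have key (z : hf.divisor.subscheme) : ∃ V : hf.divisor.subscheme.Opens, z ∈ V ∧
      Etale (V.ι ≫ hf.divisor.subschemeι ≫ f.base) := by
    have hz : hf.divisor.subschemeι z ∈ X.boundary := by
      rw [← hf.coe_support_divisor, ← Scheme.IdealSheafData.range_subschemeι]
      exact ⟨z, rfl⟩
    obtain ⟨V, hV, hxV, s, h1, -, h3, h4, h5⟩ := hf.exists_affineOpen hz
    have h6 := @etale_subschemeCover_comp K _ X.scheme f.base hf.divisor _ h4 V hV hxV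
      (hf.divisor_ideal_eq hz hV hxV h1) h5
    let g := hf.divisor.subschemeCover.f ⟨V, hV⟩
    have := etale_respectsIso.{u}
    have : IsOpenImmersion g := hf.divisor.subschemeCover.map_prop ⟨V, hV⟩
    refine ⟨g.opensRange, ?_, ?_⟩
    · rw [Scheme.IdealSheafData.opensRange_subschemeCover_map]
      exact hxV
    · rw [← MorphismProperty.cancel_left_of_respectsIso @Etale.{u} g.isoOpensRange.hom,
        ← Category.assoc, Scheme.Hom.isoOpensRange_hom_ι]
      exact h6
  choose V hzV hV using key
  have := HasRingHomProperty.instIsZariskiLocalAtSource (P := @Etale.{u}) (Q := RingHom.Etale)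
  exact IsZariskiLocalAtSource.of_iSup_eq_top (P := @Etale.{u}) V
    (top_le_iff.1 fun z _ => TopologicalSpace.Opens.mem_iSup.2 ⟨z, hzV z⟩) hV

end LogScheme

/-! ### Functions near a point -/

section

variable {Y : Scheme.{u}}

lemma ι_appTop_eq_map (V : Y.Opens) (i : V ⟶ ⊤) (s : Γ(Y, ⊤)) :
    V.ι.appTop s =
      Y.presheaf.map (homOfLE (Scheme.Opens.ι_image_le V ⊤)).op (Y.presheaf.map i.op s) := by
  rw [Scheme.Opens.ι_appTop]
  refine (congrArg (fun j : Γ(Y, ⊤) ⟶ Γ(Y, V.ι ''ᵁ ⊤) => j s) ?_).trans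
    (CategoryTheory.comp_apply (Y.presheaf.map i.op)
      (Y.presheaf.map (homOfLE (Scheme.Opens.ι_image_le V ⊤)).op) s)
  rw [← Functor.map_comp]
  rfl

/-- Equality of germs of global functions, up to a function with given germ, holds on a
neighbourhood. -/
lemma exists_open_ι_appTop_eq_mul {y : Y} {V₀ : Y.Opens} (hy : y ∈ V₀) (e : Γ(Y, V₀))
    (s s' : Γ(Y, ⊤)) (h : germTop y s = Y.presheaf.germ V₀ y hy e * germTop y s') :
    ∃ (V : Y.Opens) (_ : y ∈ V) (i : V.ι ''ᵁ ⊤ ⟶ V₀),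
      V.ι.appTop s = (show Γ(V, ⊤) from Y.presheaf.map i.op e) * V.ι.appTop s' := by
  have h1 : Y.presheaf.germ ⊤ y trivial s =
      Y.presheaf.germ V₀ y hy (e * Y.presheaf.map (homOfLE le_top).op s') := by
    rw [map_mul, TopCat.Presheaf.germ_res_apply]
    exact h
  obtain ⟨V, hyV, i, j, hV⟩ := Y.presheaf.germ_eq y (TopologicalSpace.Opens.mem_top y) hy _ _ h1
  refine ⟨V, hyV, homOfLE ((Scheme.Opens.ι_image_le V ⊤).trans j.le), ?_⟩
  rw [ι_appTop_eq_map V i, ι_appTop_eq_map V i, hV]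
  refine (congrArg _ (map_mul (Y.presheaf.map j.op).hom _ _)).trans ?_
  refine (map_mul (Y.presheaf.map (homOfLE (Scheme.Opens.ι_image_le V ⊤)).op).hom _ _).trans ?_
  refine congrArg₂ (· * ·) ?_ (congrArg _ ?_)
  · refine (CategoryTheory.comp_apply (Y.presheaf.map j.op)
      (Y.presheaf.map (homOfLE (Scheme.Opens.ι_image_le V ⊤)).op) e).symm.trans ?_
    rw [← Functor.map_comp]
    rfl
  · refine (CategoryTheory.comp_apply (Y.presheaf.map (homOfLE le_top).op)
      (Y.presheaf.map j.op) s').symm.trans ?_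
    rw [← Functor.map_comp]
    rfl

lemma exists_open_ι_appTop_eq {y : Y} {s s' : Γ(Y, ⊤)} (h : germTop y s = germTop y s') :
    ∃ (V : Y.Opens) (_ : y ∈ V), V.ι.appTop s = V.ι.appTop s' := by
  obtain ⟨V, hV, i, e⟩ := exists_open_ι_appTop_eq_mul (V₀ := ⊤) (y := y) trivial 1 s s' (by
    rw [map_one, one_mul, h])
  refine ⟨V, hV, e.trans ?_⟩
  rw [show (Y.presheaf.map i.op) 1 = 1 from map_one _]
  exact one_mul _

lemma exists_open_isUnit_ι_appTop_eq_mul {y : Y} {s s' : Γ(Y, ⊤)} {e : Y.presheaf.stalk y}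
    (he : IsUnit e) (h : germTop y s = e * germTop y s') :
    ∃ (V : Y.Opens) (_ : y ∈ V) (c : Γ(V, ⊤)), IsUnit c ∧ V.ι.appTop s = c * V.ι.appTop s' := by
  obtain ⟨V₀, hV₀, e, rfl⟩ := Y.presheaf.exists_germ_eq e
  have h1 : y ∈ Y.basicOpen e := (Y.mem_basicOpen e y hV₀).2 he
  obtain ⟨V, hV, i, hVe⟩ := exists_open_ι_appTop_eq_mul h1
    (Y.presheaf.map (homOfLE (Y.basicOpen_le e)).op e) s s' (by
    rw [TopCat.Presheaf.germ_res_apply, h])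
  exact ⟨V, hV, _, (RingedSpace.isUnit_res_basicOpen Y.toSheafedSpace e).map
    (Y.presheaf.map i.op).hom, hVe⟩

/-- A function divides a power of another one locally if it is invertible where the other one is. -/
lemma exists_germTop_dvd_pow (y : Y) {s a : Γ(Y, ⊤)} (h : Y.basicOpen a ≤ Y.basicOpen s) :
    ∃ k : ℕ, germTop y s ∣ germTop y a ^ k := by
  have key (b : Γ(Y, ⊤)) (p : Spec (Y.presheaf.stalk y)) :
      p ∈ PrimeSpectrum.basicOpen (germTop y b) ↔ Y.fromSpecStalk y p ∈ Y.basicOpen b := by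
    rw [← appTop_mem_basicOpen, basicOpen_eq_of_affine', Scheme.fromSpecStalk_appTop]
    refine iff_of_eq (congrArg (fun c => p ∈ PrimeSpectrum.basicOpen c) ?_)
    have h1 : (Y.presheaf.germ ⊤ y trivial ≫ (Scheme.ΓSpecIso (Y.presheaf.stalk y)).inv ≫
        (Spec (Y.presheaf.stalk y)).presheaf.map (homOfLE le_top).op) ≫
        (Scheme.ΓSpecIso (Y.presheaf.stalk y)).hom = Y.presheaf.germ ⊤ y trivial := by
      rw [Subsingleton.elim (homOfLE le_top).op (𝟙 (op (⊤ : (Spec (Y.presheaf.stalk y)).Opens))),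
        CategoryTheory.Functor.map_id, Category.comp_id, Category.assoc, Iso.inv_hom_id,
        Category.comp_id]
    exact (ConcreteCategory.congr_hom h1 b).symm
  have h1 : PrimeSpectrum.basicOpen (germTop y a) ≤ PrimeSpectrum.basicOpen (germTop y s) :=
    fun p hp => (key s p).2 (h ((key a p).1 hp))
  rw [PrimeSpectrum.basicOpen_le_basicOpen_iff] at h1
  obtain ⟨k, hk⟩ := h1
  exact ⟨k, Ideal.mem_span_singleton.1 hk⟩

end

section

variable {O : Type*} [CommRing O] [IsLocalRing O] {a : O} (ha : a ∈ nonZeroDivisors O)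
  (h : IsLocalRing.maximalIdeal O = Ideal.span {a})

include ha h

lemma exists_eq_unit_mul_pow_of_dvd {s : O} {k : ℕ} (hs : s ∣ a ^ k) :
    ∃ (e : O) (j : ℕ), IsUnit e ∧ s = e * a ^ j := by
  induction k generalizing s with
  | zero => exact ⟨s, 0, isUnit_of_dvd_one (by rwa [pow_zero] at hs), by simp⟩
  | succ k ih =>
    by_cases hsu : IsUnit s
    · exact ⟨s, 0, hsu, by simp⟩
    have h1 : s ∈ Ideal.span {a} := h ▸ hsu
    obtain ⟨s', rfl⟩ := Ideal.mem_span_singleton'.1 h1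
    obtain ⟨c, hc⟩ := hs
    obtain ⟨e, j, he, rfl⟩ := ih (s := s') ⟨c, by
      refine (mul_cancel_right_mem_nonZeroDivisors ha).1 ?_
      rw [← pow_succ, hc]
      ring⟩
    exact ⟨e, j + 1, he, by ring⟩

lemma eq_and_eq_of_unit_mul_pow_eq {u v : O} (hu : IsUnit u) (hv : IsUnit v) {m n : ℕ}
    (e : u * a ^ m = v * a ^ n) : m = n ∧ u = v := by
  have key (u v : O) (hu : IsUnit u) (m n : ℕ) (e : u * a ^ m = v * a ^ n) : n ≤ m := by
    by_contra! hlt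
    obtain ⟨k, rfl⟩ := Nat.exists_eq_add_of_lt hlt
    rw [add_assoc, pow_add, mul_left_comm, mul_comm] at e
    have h1 : u = v * a ^ (k + 1) :=
      (mul_cancel_left_mem_nonZeroDivisors (pow_mem ha m)).1 e
    have h2 : u ∈ IsLocalRing.maximalIdeal O := by
      rw [h, h1, pow_succ, ← mul_assoc]
      exact Ideal.mul_mem_left _ _ (Ideal.mem_span_singleton_self _)
    exact h2 hu
  obtain rfl := le_antisymm (key v u hv n m e.symm) (key u v hu m n e)
  exact ⟨rfl, (mul_cancel_right_mem_nonZeroDivisors (pow_mem ha m)).1 e⟩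

end

/-! ### The log structure consists of the functions invertible outside the divisor -/

lemma mem_smallEtaleTopology {X : Scheme.{u}} {V : X.Etale} (S : Sieve V)
    (h : ∀ x : V.left, ∃ (W : X.Etale) (k : W ⟶ V) (w : W.left), S k ∧ k.left w = x) :
    S ∈ X.smallEtaleTopology V := by
  let Z : (Σ W : X.Etale, {k : W ⟶ V // S k}) → X.Etale := fun i => i.1
  have h1 : Sieve.ofArrows Z (fun i => i.2.1) ∈ X.smallEtaleTopology V := by
    rw [Scheme.ofArrows_mem_smallEtaleTopology_iff, Set.eq_univ_iff_forall]
    intro x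
    obtain ⟨W, k, w, hk, hw⟩ := h x
    exact Set.mem_iUnion.2 ⟨⟨W, k, hk⟩, w, hw⟩
  refine GrothendieckTopology.superset_covering _ ?_ h1
  rw [Sieve.ofArrows, Sieve.generate_le_iff]
  rintro W _ ⟨i⟩
  exact i.2.2

namespace LogScheme

variable {X : LogScheme.{u}}

/-- Sections of a log structure that agree locally are equal. -/
lemma eq_of_locally_eq {W : X.scheme.Etale} {m m' : X.sections W}
    (h : ∀ w : W.left, ∃ (W' : X.scheme.Etale) (k : W' ⟶ W) (w' : W'.left),
      k.left w' = w ∧ X.res k m = X.res k m') : m = m' := by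
  let S : Sieve W :=
    { arrows := fun W' k => X.res k m = X.res k m'
      downward_closed := fun {W' W''} k hk g => by
        have h1 (n : X.sections W) : X.res (g ≫ k) n = X.res g (X.res k n) :=
          (X.logStructure.res_res _ _ _).symm
        change X.res (g ≫ k) m = X.res (g ≫ k) m'
        rw [h1, h1, show X.res k m = X.res k m' from hk] }
  have hS : S ∈ X.scheme.smallEtaleTopology W := mem_smallEtaleTopology S fun w => by
    obtain ⟨W', k, w', hw, hk⟩ := h w
    exact ⟨W', k, w', hk, hw⟩
  exact (X.logStructure.isSheaf.isSeparated S hS).ext fun W' k hk => hk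

lemma IsMonogenicChart.exists_res_eq_mul_pow {U : X.scheme.Etale} {Q : Type u} [CommMonoid Q]
    {φ : Q →* X.sections U} {t : Q} {y : U.left} (h : IsMonogenicChart φ t y)
    (m : X.sections U) :
    ∃ (W : X.scheme.Etale) (k : W ⟶ U) (w : W.left) (v : X.sections W) (n : ℕ),
      k.left w = y ∧ IsUnit v ∧ X.res k m = v * X.res k (φ t) ^ n := by
  obtain ⟨W, k, w, p, v, hw, hv, e⟩ := h.isChart.locally_surjective U (𝟙 U) m y
  obtain ⟨n, rfl⟩ := h.exists_eq_pow p
  refine ⟨W, k, w, v, n, hw, hv, e.trans ?_⟩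
  rw [Category.comp_id, map_pow, map_pow]

variable {K : Type u} [Field K] {f : X ⟶ trivial (Spec (.of K))}

/-- Two sections of the log structure with the same image in the structure sheaf, both of the form
unit times power of a generator of a chart at a point, agree near that point. -/
lemma IsLogSmoothCurve.exists_res_eq_of_α_eq (hf : IsLogSmoothCurve f) {U : X.scheme.Etale}
    {Q : Type u} [CommMonoid Q] {ψ : Q →* X.sections U} {t : Q} {y : U.left}
    (hψ : IsMonogenicChart ψ t y) (ht : t ≠ 1) {v v' : X.sections U} (hv : IsUnit v)
    (hv' : IsUnit v') {n n' : ℕ} (e : X.α U (v * ψ t ^ n) = X.α U (v' * ψ t ^ n')) :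
    ∃ (U' : X.scheme.Etale) (k : U' ⟶ U) (y' : U'.left), k.left y' = y ∧
      X.res k (v * ψ t ^ n) = X.res k (v' * ψ t ^ n') := by
  have := hψ.fg
  have := hψ.isCancelMul
  have hg : germTop y (X.α U v) * chartGerm y ψ t ^ n =
      germTop y (X.α U v') * chartGerm y ψ t ^ n' := by
    have := congrArg (germTop y) e
    rw [map_mul, map_mul, map_pow, map_mul, map_mul, map_pow, map_pow, map_pow] at this
    exact this
  have hnz := hf.chartGerm_mem_nonZeroDivisors y hψ.isChart hψ.eq_one hψ.exists_eq_pow ht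
  have hmax := (hf.maximalIdeal_eq_span y hψ.isChart hψ.eq_one hψ.exists_eq_pow ht).1
  have hu : IsUnit (germTop y (X.α U v)) := IsUnit.map (germTop y) (hv.map (X.α U))
  have hu' : IsUnit (germTop y (X.α U v')) := IsUnit.map (germTop y) (hv'.map (X.α U))
  obtain ⟨rfl, hg'⟩ := eq_and_eq_of_unit_mul_pow_eq hnz hmax hu hu' hg
  obtain ⟨V, hV, e₄⟩ := exists_open_ι_appTop_eq hg'
  refine ⟨restrictOpen U V, restrictOpenι U V, ⟨y, hV⟩, rfl, ?_⟩
  have e₅ : X.res (restrictOpenι U V) v = X.res (restrictOpenι U V) v' := by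
    have h1 : IsUnit (X.res (restrictOpenι U V) v) := hv.map _
    have h2 : IsUnit (X.α (restrictOpen U V) (X.res (restrictOpenι U V) v)) :=
      IsUnit.map (X.α (restrictOpen U V)) h1
    have h3 (r : X.sections U) : X.α (restrictOpen U V) (X.res (restrictOpenι U V) r) =
        V.ι.appTop (X.α U r) := X.logStructure.α_res (restrictOpenι U V) r
    exact eq_of_α_eq h2 ((h3 v).trans (Eq.trans e₄ (h3 v').symm))
  rw [map_mul, map_mul, e₅]

/-- The map from the log structure of a log smooth curve to the structure sheaf is injective: the
generator of a chart is a nonzerodivisor. -/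
theorem IsLogSmoothCurve.α_injective (hf : IsLogSmoothCurve f) (W : X.scheme.Etale) :
    Function.Injective (X.α W) := by
  intro m m' e
  refine eq_of_locally_eq fun w => ?_
  obtain ⟨U, k, y, Q, _, φ, t, hy, hφ⟩ := hf.exists_isMonogenicChart W w
  obtain ⟨U₁, k₁, y₁, v, n, hy₁, hv, e₁⟩ := hφ.exists_res_eq_mul_pow (X.res k m)
  obtain ⟨U₂, k₂, y₂, v', n', hy₂, hv', e₂⟩ :=
    (hφ.res k₁ hy₁).exists_res_eq_mul_pow (X.res k₁ (X.res k m'))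
  have hφ₂ := (hφ.res k₁ hy₁).res k₂ hy₂
  let ψ : Q →* X.sections U₂ := (X.res k₂).comp ((X.res k₁).comp φ)
  have e₁' : X.res k₂ (X.res k₁ (X.res k m)) = X.res k₂ v * ψ t ^ n := by
    rw [e₁, map_mul, map_pow]
    rfl
  have e₂' : X.res k₂ (X.res k₁ (X.res k m')) = v' * ψ t ^ n' := e₂
  have hα (r : X.sections W) : X.α U₂ (X.res k₂ (X.res k₁ (X.res k r))) =
      k₂.left.appTop (k₁.left.appTop (k.left.appTop (X.α W r))) := by
    refine (X.logStructure.α_res k₂ _).trans (congrArg _ ?_)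
    refine (X.logStructure.α_res k₁ _).trans (congrArg _ ?_)
    exact X.logStructure.α_res k _
  have e₃ : X.α U₂ (X.res k₂ v * ψ t ^ n) = X.α U₂ (v' * ψ t ^ n') := by
    rw [← e₁', ← e₂', hα, hα, e]
  have hv₂ : IsUnit (X.res k₂ v) := hv.map _
  suffices ∃ (U₃ : X.scheme.Etale) (k₃ : U₃ ⟶ U₂) (y₃ : U₃.left), k₃.left y₃ = y₂ ∧
      X.res k₃ (X.res k₂ v * ψ t ^ n) = X.res k₃ (v' * ψ t ^ n') by
    obtain ⟨U₃, k₃, y₃, hy₃, e₄⟩ := this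
    refine ⟨U₃, k₃ ≫ k₂ ≫ k₁ ≫ k, y₃, ?_, ?_⟩
    · rw [← hy, ← hy₁, ← hy₂, ← hy₃]
      refine (Scheme.Hom.comp_apply k₃.left (k₂ ≫ k₁ ≫ k).left y₃).trans ?_
      refine (Scheme.Hom.comp_apply k₂.left (k₁ ≫ k).left (k₃.left y₃)).trans ?_
      exact Scheme.Hom.comp_apply k₁.left k.left _
    · have h1 (r : X.sections W) : X.res (k₃ ≫ k₂ ≫ k₁ ≫ k) r =
          X.res k₃ (X.res k₂ (X.res k₁ (X.res k r))) := by
        rw [X.logStructure.res_res, X.logStructure.res_res, X.logStructure.res_res]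
        simp only [Category.assoc]
      rw [h1, h1, e₁', e₂', e₄]
  by_cases ht : t = 1
  · have h1 : ψ t = 1 := by rw [ht, map_one]
    rw [h1, one_pow, one_pow, mul_one, mul_one] at e₃ ⊢
    refine ⟨U₂, 𝟙 U₂, y₂, rfl, ?_⟩
    rw [eq_of_α_eq (hv₂.map (X.α U₂)) e₃]
  · exact hf.exists_res_eq_of_α_eq hφ₂ ht hv₂ hv' e₃

/-- Functions that are invertible outside the support of the log structure of a log smooth curve
come locally from the log structure: locally they are units times powers of the generator of a
chart. -/
lemma IsLogSmoothCurve.exists_α_eq_locally (hf : IsLogSmoothCurve f) {W : X.scheme.Etale}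
    {s : Γ(W.left, ⊤)} (hs : ∀ w : W.left, W.hom w ∉ X.boundary → w ∈ W.left.basicOpen s)
    (w : W.left) :
    ∃ (W' : X.scheme.Etale) (k : W' ⟶ W) (w' : W'.left) (m : X.sections W'), k.left w' = w ∧
      X.α W' m = k.left.appTop s := by
  obtain ⟨U, k, y, Q, _, φ, t, hy, hφ⟩ := hf.exists_isMonogenicChart W w
  let a : Γ(U.left, ⊤) := X.α U (φ t)
  have hle : U.left.basicOpen a ≤ U.left.basicOpen (k.left.appTop s) := by
    intro u hu
    rw [appTop_mem_basicOpen]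
    refine hs _ fun hcon => ?_
    have h1 : W.hom (k.left u) = U.hom u :=
      (Scheme.Hom.comp_apply k.left W.hom u).symm.trans
        (congrArg (fun g : U.left ⟶ X.scheme => g u) (left_hom k))
    rw [h1] at hcon
    exact (hom_mem_boundary_iff hφ.isChart hφ.exists_eq_pow u).1 hcon hu
  obtain ⟨e, j, he, hej⟩ : ∃ (e : U.left.presheaf.stalk y) (j : ℕ), IsUnit e ∧
      germTop y (k.left.appTop s) = e * germTop y (a ^ j) := by
    by_cases ht : t = 1
    · refine ⟨germTop y (k.left.appTop s), 0, (isUnit_germTop_iff y _).2 (hle ?_), by simp⟩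
      refine (U.left.mem_basicOpen a y (TopologicalSpace.Opens.mem_top y)).2 ?_
      have : a = 1 := by
        simp only [a, ht, map_one]
      rw [this, map_one]
      exact isUnit_one
    · have := hφ.fg
      have := hφ.isCancelMul
      obtain ⟨N, hN⟩ := exists_germTop_dvd_pow y hle
      obtain ⟨e, j, he, hej⟩ := exists_eq_unit_mul_pow_of_dvd
        (hf.chartGerm_mem_nonZeroDivisors y hφ.isChart hφ.eq_one hφ.exists_eq_pow ht)
        (hf.maximalIdeal_eq_span y hφ.isChart hφ.eq_one hφ.exists_eq_pow ht).1 hN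
      exact ⟨e, j, he, hej.trans (by rw [map_pow]; rfl)⟩
  obtain ⟨V, hV, c, hc, e₁⟩ := exists_open_isUnit_ι_appTop_eq_mul he hej
  obtain ⟨v, hv, -⟩ := X.logStructure.existsUnique_of_isUnit (restrictOpen U V) c hc
  refine ⟨restrictOpen U V, restrictOpenι U V ≫ k, ⟨y, hV⟩,
    v * X.res (restrictOpenι U V) (φ t ^ j), ?_, ?_⟩
  · exact (Scheme.Hom.comp_apply (restrictOpenι U V).left k.left _).trans hy
  · have h1 : X.α _ (X.res (restrictOpenι U V) (φ t ^ j)) = V.ι.appTop (a ^ j) := by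
      refine (X.logStructure.α_res _ _).trans ?_
      exact congrArg V.ι.appTop (map_pow (X.α U) _ _)
    have h2 : (restrictOpenι U V ≫ k).left.appTop s = V.ι.appTop (k.left.appTop s) :=
      congrArg (fun g => g s) (Scheme.Hom.comp_appTop (restrictOpenι U V).left k.left)
    refine (map_mul (X.α (restrictOpen U V)) v _).trans ?_
    exact (congrArg₂ (fun a b : Γ(V, ⊤) => a * b) hv h1).trans (e₁.symm.trans h2.symm)

/-- The functions that come from the log structure of a log smooth curve are those that are
invertible outside its support. -/
theorem IsLogSmoothCurve.exists_α_eq_iff (hf : IsLogSmoothCurve f) {W : X.scheme.Etale}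
    {s : Γ(W.left, ⊤)} :
    (∃ m, X.α W m = s) ↔ ∀ w : W.left, W.hom w ∉ X.boundary → w ∈ W.left.basicOpen s := by
  refine ⟨?_, fun hs => ?_⟩
  · rintro ⟨m, rfl⟩ w hw
    by_contra hcon
    exact hw ⟨W, w, m, rfl, hcon⟩
  let S : Sieve W :=
    { arrows := fun W' k => ∃ m, X.α W' m = k.left.appTop s
      downward_closed := by
        rintro W' W'' k ⟨m, hm⟩ g
        refine ⟨X.res g m, (X.logStructure.α_res g m).trans ?_⟩
        refine (congrArg g.left.appTop hm).trans ?_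
        exact (congrArg (fun g => g s) (Scheme.Hom.comp_appTop g.left k.left)).symm }
  have hS : S ∈ X.scheme.smallEtaleTopology W := mem_smallEtaleTopology S fun w => by
    obtain ⟨W', k, w', m, hw, hm⟩ := hf.exists_α_eq_locally hs w
    exact ⟨W', k, w', ⟨m, hm⟩, hw⟩
  let x : Presieve.FamilyOfElements (X.logStructure.presheaf ⋙ forget CommMonCat.{u}) S.arrows :=
    fun W' k hk => hk.choose
  have hx (W' : X.scheme.Etale) (k : W' ⟶ W) (hk : S k) :
      X.α W' (x k hk) = k.left.appTop s := hk.choose_spec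
  have hcomp : x.Compatible := by
    intro W₁ W₂ W₃ g₁ g₂ k₁ k₂ h₁ h₂ e
    refine hf.α_injective W₃ ?_
    have h3 {W' : X.scheme.Etale} (g : W₃ ⟶ W') (k : W' ⟶ W) (hk : S k) :
        X.α W₃ (X.res g (x k hk)) = (g ≫ k).left.appTop s := by
      refine (X.logStructure.α_res g _).trans ((congrArg g.left.appTop (hx _ k hk)).trans ?_)
      exact (congrArg (fun g => g s) (Scheme.Hom.comp_appTop g.left k.left)).symm
    exact (h3 g₁ k₁ h₁).trans (by rw [e]; exact (h3 g₂ k₂ h₂).symm)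
  obtain ⟨m, hm, -⟩ := X.logStructure.isSheaf S hS x hcomp
  refine ⟨m, ((isSheaf_etaleFunctions X.scheme).isSeparated S hS).ext fun W' k hk => ?_⟩
  refine (X.logStructure.α_res k m).symm.trans ?_
  exact (congrArg (X.α W') (hm k hk)).trans (hx W' k hk)

lemma IsLogSmoothCurve.mem_invertibleOn_iff (hf : IsLogSmoothCurve f) {W : X.scheme.Etale}
    {s : Γ(W.left, ⊤)} :
    s ∈ LogStructure.invertibleOn hf.divisor.support.compl W ↔ ∃ m, X.α W m = s := by
  rw [hf.exists_α_eq_iff]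
  refine forall_congr' fun w => imp_congr_left (not_congr ?_)
  exact Set.ext_iff.1 hf.coe_support_divisor (W.hom w)

/-- The sections of the log structure of a log smooth curve are the functions invertible outside the
divisor. -/
noncomputable def IsLogSmoothCurve.sectionsEquiv (hf : IsLogSmoothCurve f) (W : X.scheme.Etale) :
    X.sections W ≃* LogStructure.invertibleOn hf.divisor.support.compl W :=
  MulEquiv.ofBijective ((X.α W).codRestrict _ fun m => hf.mem_invertibleOn_iff.2 ⟨m, rfl⟩)
    ⟨fun _ _ h => hf.α_injective W (congrArg Subtype.val h), fun s =>
      (hf.mem_invertibleOn_iff.1 s.2).imp fun _ h => Subtype.ext h⟩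

/-- The log structure of a log smooth curve is induced by the divisor. -/
noncomputable def IsLogSmoothCurve.logStructureIso (hf : IsLogSmoothCurve f) :
    LogStructure.Iso X.logStructure (LogStructure.ofDivisor hf.divisor) where
  iso := NatIso.ofComponents (fun W => (hf.sectionsEquiv W.unop).toCommMonCatIso) fun {V W} h => by
    ext m
    exact Subtype.ext (X.logStructure.α_res h.unop m)
  α_hom _ _ := rfl

end LogScheme

end LogGeom

theorem lemma2p1 (K : Type u) [Field K] (X : LogGeom.LogScheme.{u})
    (f : X ⟶ LogGeom.LogScheme.trivial (Spec (.of K)))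
    (hf : LogGeom.LogScheme.IsLogSmoothCurve f) :
    SmoothOfRelativeDimension 1 f.base ∧
    ∃ D : X.scheme.IdealSheafData,
      LogGeom.IsEffectiveCartierDivisor D ∧
      Etale (D.subschemeι ≫ f.base) ∧
      Nonempty (LogGeom.LogStructure.Iso X.logStructure
        (LogGeom.LogStructure.ofDivisor D)) :=
  ⟨hf.smoothOfRelativeDimension_one, hf.divisor, hf.isEffectiveCartierDivisor, hf.etale_divisor,
    ⟨hf.logStructureIso⟩⟩
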